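/- Let $A$ be a bounded operator on a complex Hilbert space $H$, and let $\Omega\subset\mathbb C$ be a connected, bounded open set with smooth boundary (that is, $\partial\Omega$ is an embedded smooth curve and near each boundary point $\Omega=\{\rho<0\}$ for some smooth real $\rho$ with non-vanishing derivative at that point) such that $\sigma(A)\subset\Omega$. Let $n_\Omega$ be the outward unit normal on $\partial\Omega$, $|d\sigma|$ arc length, and $d\sigma=i\,n_\Omega(\sigma)|d\sigma|$. Put $$P_\Omega(\sigma,z)=\tfrac1\pi\operatorname{Re}\frac{n_\Omega(\sigma)}{\sigma-z},\qquad P_\Omega(\sigma,A)=\tfrac1\pi\operatorname{Re}\big(n_\Omega(\sigma)(\sigma-A)^{-1}\big),$$ where $\operatorname{Re}T=\frac12(T+T^*)$ for an operator $T$; for a function, ${}^*$ denotes complex conjugation. Let $\mathcal A(\Omega^-)\subset C(\partial\Omega)$ be the space of boundary values of continuous functions on the closure $\Omega^-$ that are analytic on $\Omega$, let $\mathcal H(\Omega^-)$ be the uniform closure of $\mathcal A(\Omega^-)+\mathcal A(\Omega^-)^*$ in $C(\partial\Omega)$, and let $\gamma(f)=\frac1{2\pi i}\int_{\partial\Omega}f(\sigma)(\sigma-A)^{-1}\,d\sigma$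 for $f\in\mathcal A(\Omega^-)$. Then the following hold. 1. There are unique bounded linear operators - $\hat\gamma\colon\mathcal H(\Omega^-)\to\mathcal L(H)$ with $\hat\gamma(f+g^*)=\gamma(f)+\gamma(g)^*$ for all $f,g\in\mathcal A(\Omega^-)$; - $K_\Omega^{\mathrm i}\colon C(\partial\Omega)\to\mathcal H(\Omega^-)$ such that, for every Hölder continuous $\varphi$ on $\partial\Omega$, the function $K_\Omega^{\mathrm i}(\varphi)$ gives the boundary values of $z\mapsto\int_{\partial\Omega}\varphi(\sigma)P_\Omega(\sigma,z)\,|d\sigma|$, $z\in\Omega$; - $K_\Omega\colon C(\partial\Omega)\to C(\partial\Omega)$ such that, for every Hölder continuous $\varphi$ on $\partial\Omega$ and every $z\in\partial\Omega$, $K_\Omega(\varphi)(z)=\mathrm{p.v.}\!\int_{\partial\Omega}\varphi(\sigma)P_\Omega(\sigma,z)\,|d\sigma|$. 2. For all $\varphi\in C(\partial\Omega)$, $$(\hat\gamma\circ K_\Omega^{\mathrm i})(\varphi)=\int_{\partial\Omega}\varphi(\sigma)\,P_\Omega(\sigma,A)\,|d\sigma| .$$ 3. For all $f\in\mathcal A(\Omega^-)$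 one has $K_\Omega(f)^*\in\mathcal A(\Omega^-)$ and $$(\hat\gamma\circ K_\Omega^{\mathrm i})(f)=\gamma(K_\Omega(f)^*)^*+\gamma(f).$$ -/

import Mathlib

open MeasureTheory Filter Topology
open scoped ContDiff

/-- `ρ` is a local smooth defining function of `Ω` at the point `p`: it is smooth, its derivative
does not vanish at `p`, and near `p` the set `Ω` is `{ρ < 0}`. -/
structure IsLocalDefiningFunction (Ω : Set ℂ) (p : ℂ) (ρ : ℂ → ℝ) : Prop where
  smooth : ContDiff ℝ ∞ ρ
  deriv_ne : fderiv ℝ ρ p ≠ 0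
  eventually_iff : ∀ᶠ z in 𝓝 p, (z ∈ Ω ↔ ρ z < 0)

/-- `Ω` is a smoothly bounded open subset of the plane: bounded, open, and its boundary is an
embedded smooth curve (a one-dimensional submanifold) with `Ω` on one side of it. -/
structure IsSmoothlyBounded (Ω : Set ℂ) : Prop where
  isOpen : IsOpen Ω
  isBounded : Bornology.IsBounded Ω
  exists_defining : ∀ p ∈ frontier Ω, ∃ ρ : ℂ → ℝ, IsLocalDefiningFunction Ω p ρ

/-- The outward unit normal vector to `Ω` at the boundary point `p`: the normalized gradient of a
local defining function (its value does not depend on the defining function). -/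
noncomputable def outwardNormal (Ω : Set ℂ) (p : ℂ) : ℂ :=
  Classical.epsilon fun n : ℂ =>
    ∃ ρ : ℂ → ℝ, IsLocalDefiningFunction Ω p ρ ∧ n = ‖gradient ρ p‖⁻¹ • gradient ρ p

/-- Arc length `|dσ|` on `∂Ω`, i.e. the one-dimensional Hausdorff measure on `∂Ω`. -/
noncomputable def arcLength (Ω : Set ℂ) : Measure (frontier Ω) :=
  Measure.comap (Subtype.val : frontier Ω → ℂ) (Measure.hausdorffMeasure 1)

/-- The space `𝒜(Ω⁻)`, identified with its image in `C(∂Ω)`: the boundary values of continuous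
functions on the closure of `Ω` that are holomorphic on `Ω`. -/
def analyticSpace (Ω : Set ℂ) : Submodule ℂ C(frontier Ω, ℂ) where
  carrier := {f | ∃ F : ℂ → ℂ, DiffContOnCl ℂ F Ω ∧ ∀ z : frontier Ω, f z = F z}
  add_mem' := by
    rintro f g ⟨F, hF, hf⟩ ⟨G, hG, hg⟩
    exact ⟨F + G, hF.add hG, fun z => by simp [hf, hg]⟩
  zero_mem' := ⟨0, diffContOnCl_const (c := (0 : ℂ)), fun z => by simp⟩
  smul_mem' := by
    rintro c f ⟨F, hF, hf⟩
    exact ⟨c • F, hF.const_smul c, fun z => by simp [hf]⟩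

/-- The sum `𝒜(Ω⁻) + 𝒜(Ω⁻)*` inside `C(∂Ω)`. -/
def analyticAddConj (Ω : Set ℂ) : Submodule ℂ C(frontier Ω, ℂ) where
  carrier := {u | ∃ f ∈ analyticSpace Ω, ∃ g ∈ analyticSpace Ω, u = f + star g}
  add_mem' := by
    rintro _ _ ⟨f, hf, g, hg, rfl⟩ ⟨f', hf', g', hg', rfl⟩
    exact ⟨f + f', add_mem hf hf', g + g', add_mem hg hg', by rw [star_add]; abel⟩
  zero_mem' := ⟨0, zero_mem _, 0, zero_mem _, by simp⟩
  smul_mem' := by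
    rintro c _ ⟨f, hf, g, hg, rfl⟩
    exact ⟨c • f, Submodule.smul_mem _ c hf, star c • g, Submodule.smul_mem _ _ hg, by
      rw [star_smul, star_star, smul_add]⟩

/-- The space `ℋ(Ω⁻)`: the uniform closure of `𝒜(Ω⁻) + 𝒜(Ω⁻)*` in `C(∂Ω)`. -/
noncomputable def harmonicSpace (Ω : Set ℂ) : Submodule ℂ C(frontier Ω, ℂ) :=
  (analyticAddConj Ω).topologicalClosure

theorem add_star_mem_harmonicSpace {Ω : Set ℂ} (f g : analyticSpace Ω) :
    (f : C(frontier Ω, ℂ)) + star (g : C(frontier Ω, ℂ)) ∈ harmonicSpace Ω :=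
  (analyticAddConj Ω).le_topologicalClosure ⟨f, f.2, g, g.2, rfl⟩

/-- Hölder continuity of a function on `∂Ω`, with some positive exponent. -/
def IsHolder {Ω : Set ℂ} (φ : C(frontier Ω, ℂ)) : Prop :=
  ∃ (c α : NNReal), 0 < α ∧ HolderWith c α φ

/-- The double-layer potential `P_Ω(σ, z) = π⁻¹ Re (n_Ω(σ) / (σ - z))`. -/
noncomputable def doubleLayer (Ω : Set ℂ) (σ z : ℂ) : ℝ :=
  Real.pi⁻¹ * (outwardNormal Ω σ / (σ - z)).re

/-- `K` is the interior double-layer transform of `Ω`: the bounded operator from `C(∂Ω)` to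
`ℋ(Ω⁻)` that sends each Hölder continuous `φ` to the boundary values of the (continuous extension
to the closure of the) function `z ↦ ∫_{∂Ω} φ(σ) P_Ω(σ, z) |dσ|` on `Ω`. -/
def IsInteriorDoubleLayerTransform (Ω : Set ℂ)
    (K : C(frontier Ω, ℂ) →L[ℂ] harmonicSpace Ω) : Prop :=
  ∀ φ : C(frontier Ω, ℂ), IsHolder φ → ∀ z : frontier Ω,
    Tendsto (fun w : ℂ => ∫ σ, φ σ * (doubleLayer Ω σ w : ℂ) ∂(arcLength Ω)) (𝓝[Ω] (z : ℂ))
      (𝓝 ((K φ : C(frontier Ω, ℂ)) z))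

/-- The interior double-layer transform `K_Ω^i : C(∂Ω) → ℋ(Ω⁻)`. -/
noncomputable def interiorDoubleLayerTransform (Ω : Set ℂ) :
    C(frontier Ω, ℂ) →L[ℂ] harmonicSpace Ω :=
  Classical.epsilon (IsInteriorDoubleLayerTransform Ω)

/-- `K` is the singular double-layer transform (Neumann-Poincaré operator) of `Ω`: the bounded
operator on `C(∂Ω)` that sends each Hölder continuous `φ` to the principal value integral
`z ↦ p.v. ∫_{∂Ω} φ(σ) P_Ω(σ, z) |dσ|` on `∂Ω`. -/
def IsSingularDoubleLayerTransform (Ω : Set ℂ)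
    (K : C(frontier Ω, ℂ) →L[ℂ] C(frontier Ω, ℂ)) : Prop :=
  ∀ φ : C(frontier Ω, ℂ), IsHolder φ → ∀ z : frontier Ω,
    Tendsto (fun ε : ℝ => ∫ σ in {σ : frontier Ω | ε < dist σ z},
        φ σ * (doubleLayer Ω σ z : ℂ) ∂(arcLength Ω))
      (𝓝[>] 0) (𝓝 (K φ z))

/-- The singular double-layer transform `K_Ω : C(∂Ω) → C(∂Ω)`. -/
noncomputable def singularDoubleLayerTransform (Ω : Set ℂ) :
    C(frontier Ω, ℂ) →L[ℂ] C(frontier Ω, ℂ) :=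
  Classical.epsilon (IsSingularDoubleLayerTransform Ω)

section Operators

variable {H : Type*} [NormedAddCommGroup H] [InnerProductSpace ℂ H] [CompleteSpace H]

/-- The Cauchy integral `γ(f) = (2πi)⁻¹ ∫_{∂Ω} f(σ) (σ - A)⁻¹ dσ`. The boundary is positively
oriented with respect to the outward normal, that is `dσ = i n_Ω(σ) |dσ|`. -/
noncomputable def analyticCalculus (Ω : Set ℂ) (A : H →L[ℂ] H) (f : C(frontier Ω, ℂ)) :
    H →L[ℂ] H :=
  (2 * Real.pi * Complex.I)⁻¹ •
    ∫ σ, (f σ * (Complex.I * outwardNormal Ω σ)) • resolvent A (σ : ℂ) ∂(arcLength Ω)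

/-- `G` is the harmonic functional calculus of `A` on `Ω`: the bounded operator on `ℋ(Ω⁻)` with
`G(f + g*) = γ(f) + γ(g)*` for all `f, g` in `𝒜(Ω⁻)`. -/
def IsHarmonicCalculus (Ω : Set ℂ) (A : H →L[ℂ] H)
    (G : harmonicSpace Ω →L[ℂ] (H →L[ℂ] H)) : Prop :=
  ∀ f g : analyticSpace Ω,
    G ⟨(f : C(frontier Ω, ℂ)) + star (g : C(frontier Ω, ℂ)), add_star_mem_harmonicSpace f g⟩ =
      analyticCalculus Ω A f + star (analyticCalculus Ω A g)

/-- The harmonic functional calculus `γ̂ : ℋ(Ω⁻) → L(H)` of `A` on `Ω`. -/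
noncomputable def harmonicCalculus (Ω : Set ℂ) (A : H →L[ℂ] H) :
    harmonicSpace Ω →L[ℂ] (H →L[ℂ] H) :=
  Classical.epsilon (IsHarmonicCalculus Ω A)

/-- The operator-valued double-layer potential `P_Ω(σ, A) = π⁻¹ Re (n_Ω(σ) (σ - A)⁻¹)`, where
`Re T = (T + T*) / 2`. -/
noncomputable def operatorDoubleLayer (Ω : Set ℂ) (σ : ℂ) (A : H →L[ℂ] H) : H →L[ℂ] H :=
  (Real.pi⁻¹ : ℂ) • (realPart (outwardNormal Ω σ • resolvent A σ) : H →L[ℂ] H)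

end Operators

open scoped RealInnerProductSpace

/-! ### Defining functions and the outward normal -/

namespace IsLocalDefiningFunction

/-! Boundary values. Chords of a smooth boundary are tangential to second order: `|⟪n(σ), σ - z⟫| ≤
C‖σ - z‖²` for `σ, z ∈ ∂Ω`. Hence `P_Ω` is bounded on `∂Ω × ∂Ω`, the principal value is an
absolutely convergent integral, and `K_Ω` is bounded on `C(∂Ω)`. Writing the real part as a half-sum
gives `∫ φ P_Ω(·, w) = Cφ(w) + conj (C(φ*)(w))` inside `Ω`, where `C` is the Cauchy integral. For
Lipschitz `φ` both Cauchy integrals extend continuously to the closure (`tendsto_cauchyIntegral`),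
and since `P_Ω(·, z)` has total mass 2 for `z ∈ Ω` and 1 for `z ∈ ∂Ω`, the boundary value is `φ +
K_Ω φ`. Density of Lipschitz functions and the uniform bound on `∫ |P_Ω(σ, w)| |dσ|` extend this
jump relation to all of `C(∂Ω)`. So `K_Ω^i = id + K_Ω`, with values in `ℋ(Ω⁻)`.

Functional calculus. Green's theorem applied to a cutoff that is 1 near the spectrum turns `γ(f)`
into an area integral of the holomorphic extension of `f` against the resolvent, over a compact
subset of `Ω` off the spectrum (`IsCutoffWeight`). Thus `‖γ(f)‖` is controlled by the size of the
extension on a compact set. Borel–Carathéodory estimates, chained through the connected set `Ω`,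
bound the two halves of `F + conj G` there by its boundary values, once `G` is normalized at a base
point; the normalization shifts constants and is harmless because `γ(1) = 1`. This makes `f + g* ↦
γ(f) + γ(g)*` bounded, hence well defined and extendable to the closure.

The two formulas. Fubini in the area integral, with `γ((σ - ·)⁻¹) = (σ - A)⁻¹`, shows that `γ` of a
Cauchy integral is the resolvent integral of its density; adding the adjoint term yields the
integral of `P_Ω(σ, A)`. For `f ∈ 𝒜(Ω⁻)`, Cauchy's formula `Cf = f` leaves `K_Ω f` as the boundary
value of `conj (C(f*))`, which gives the last claim.

The analytic foundation is Green's theorem with arc length taken as Hausdorff measure. It is proved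
by seeing the boundary locally as a graph, comparing Hausdorff measure with Lebesgue measure under
projection, and applying Fubini along lines. -/

theorem inner_gradient {ρ : ℂ → ℝ} {p v : ℂ} : ⟪gradient ρ p, v⟫ = fderiv ℝ ρ p v := by
  rw [gradient, InnerProductSpace.toDual_symm_apply]

theorem eventually_isLocalDefiningFunction {Ω : Set ℂ} {p : ℂ} {ρ : ℂ → ℝ}
    (h : IsLocalDefiningFunction Ω p ρ) : ∀ᶠ q in 𝓝 p, IsLocalDefiningFunction Ω q ρ := by
  have hc : Continuous (fderiv ℝ ρ) := h.smooth.continuous_fderiv (by simp)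
  filter_upwards [h.eventually_iff.eventually_nhds, hc.continuousAt.eventually_ne h.deriv_ne]
    with q h1 h2
  exact ⟨h.smooth, h2, h1⟩

theorem gradient_ne_zero {Ω : Set ℂ} {p : ℂ} {ρ : ℂ → ℝ}
    (h : IsLocalDefiningFunction Ω p ρ) : gradient ρ p ≠ 0 := by
  intro h0
  refine h.deriv_ne (ContinuousLinearMap.ext fun v => ?_)
  rw [← inner_gradient, h0, inner_zero_left, zero_apply]

theorem apply_eq_zero {Ω : Set ℂ} {p : ℂ} {ρ : ℂ → ℝ} (h : IsLocalDefiningFunction Ω p ρ)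
    (hΩ : IsOpen Ω) (hp : p ∈ frontier Ω) : ρ p = 0 := by
  have h1 : ¬ ρ p < 0 := fun hlt => by
    have := h.eventually_iff.self_of_nhds.2 hlt
    rw [hΩ.frontier_eq] at hp
    exact hp.2 this
  refine le_antisymm ?_ (not_lt.1 h1)
  by_contra! hpos
  have h2 : ∀ᶠ z in 𝓝 p, 0 < ρ z := h.smooth.continuous.continuousAt.eventually_const_lt hpos
  have h3 : ∃ᶠ z in 𝓝 p, z ∈ Ω := mem_closure_iff_frequently.1 hp.1
  obtain ⟨z, hz1, hz2, hz3⟩ := (h3.and_eventually (h2.and h.eventually_iff)).exists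
  exact absurd (hz3.1 hz1) hz2.not_gt

theorem tendsto_slope {Ω : Set ℂ} {p : ℂ} {ρ : ℂ → ℝ} (h : IsLocalDefiningFunction Ω p ρ)
    (hΩ : IsOpen Ω) (hp : p ∈ frontier Ω) (u : ℂ) :
    Tendsto (fun t : ℝ => t⁻¹ * ρ (p + t • u)) (𝓝[>] 0) (𝓝 (fderiv ℝ ρ p u)) := by
  have h1 : HasDerivAt (fun t : ℝ => p + t • u) u 0 := by
    simpa using ((hasDerivAt_id (0 : ℝ)).smul_const u).const_add p
  have h2 : HasFDerivAt ρ (fderiv ℝ ρ p) (p + (0 : ℝ) • u) := by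
    simpa using (h.smooth.differentiable (by simp) p).hasFDerivAt
  have h3 := (h2.comp_hasDerivAt 0 h1).tendsto_slope_zero_right
  simpa [h.apply_eq_zero hΩ hp] using h3

theorem tendsto_add_smul (p u : ℂ) : Tendsto (fun t : ℝ => p + t • u) (𝓝[>] 0) (𝓝 p) := by
  have : Continuous fun t : ℝ => p + t • u := by fun_prop
  exact tendsto_nhdsWithin_of_tendsto_nhds (by simpa using this.tendsto 0)

theorem eventually_add_smul_mem {Ω : Set ℂ} {p : ℂ} {ρ : ℂ → ℝ}
    (h : IsLocalDefiningFunction Ω p ρ) (hΩ : IsOpen Ω) (hp : p ∈ frontier Ω) {u : ℂ}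
    (hu : fderiv ℝ ρ p u < 0) : ∀ᶠ t in 𝓝[>] (0 : ℝ), p + t • u ∈ Ω := by
  filter_upwards [(h.tendsto_slope hΩ hp u).eventually_lt_const hu, self_mem_nhdsWithin,
    (tendsto_add_smul p u).eventually h.eventually_iff] with t ht ht0 hiff
  exact hiff.2 (neg_of_mul_neg_right ht (inv_pos.2 ht0).le)

theorem eventually_add_smul_notMem {Ω : Set ℂ} {p : ℂ} {ρ : ℂ → ℝ}
    (h : IsLocalDefiningFunction Ω p ρ) (hΩ : IsOpen Ω) (hp : p ∈ frontier Ω) {u : ℂ}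
    (hu : 0 < fderiv ℝ ρ p u) : ∀ᶠ t in 𝓝[>] (0 : ℝ), p + t • u ∉ Ω := by
  filter_upwards [(h.tendsto_slope hΩ hp u).eventually_const_lt hu, self_mem_nhdsWithin,
    (tendsto_add_smul p u).eventually h.eventually_iff] with t ht ht0 hiff
  exact fun hm => (hiff.1 hm).not_gt (pos_of_mul_pos_right ht (inv_pos.2 ht0).le)

/-- A direction in which one defining function decreases is one in which no other increases. -/
theorem fderiv_apply_nonpos {Ω : Set ℂ} {p : ℂ} {ρ ρ' : ℂ → ℝ}
    (h : IsLocalDefiningFunction Ω p ρ) (h' : IsLocalDefiningFunction Ω p ρ')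
    (hΩ : IsOpen Ω) (hp : p ∈ frontier Ω) {u : ℂ} (hu : fderiv ℝ ρ p u < 0) :
    fderiv ℝ ρ' p u ≤ 0 := by
  by_contra! hpos
  obtain ⟨t, ht1, ht2⟩ := ((h.eventually_add_smul_mem hΩ hp hu).and
    (h'.eventually_add_smul_notMem hΩ hp hpos)).exists
  exact ht2 ht1

end IsLocalDefiningFunction

theorem inner_sub_lt_zero_of_norm_eq_one {E : Type*} [NormedAddCommGroup E] [InnerProductSpace ℝ E]
    {a b : E} (ha : ‖a‖ = 1) (hb : ‖b‖ = 1) (hab : a ≠ b) : ⟪a, b - a⟫ < 0 := by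
  rw [inner_sub_right, real_inner_self_eq_norm_sq, ha]
  have := (inner_lt_one_iff_real_of_norm_eq_one ha hb).2 hab
  linarith

/-- If two defining functions had distinct unit normals `a ≠ b`, the direction `b - a` would
strictly decrease the first and strictly increase the second, against `fderiv_apply_nonpos`. The
choice made by `Classical.epsilon` is therefore immaterial. -/
theorem outwardNormal_eq {Ω : Set ℂ} (hΩ : IsOpen Ω) {p : ℂ} (hp : p ∈ frontier Ω) {ρ : ℂ → ℝ}
    (h : IsLocalDefiningFunction Ω p ρ) :
    outwardNormal Ω p = ‖gradient ρ p‖⁻¹ • gradient ρ p := by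
  obtain ⟨ρ', h', hn⟩ := Classical.epsilon_spec
    (p := fun n : ℂ => ∃ ρ : ℂ → ℝ, IsLocalDefiningFunction Ω p ρ ∧
      n = ‖gradient ρ p‖⁻¹ • gradient ρ p) ⟨_, ρ, h, rfl⟩
  change outwardNormal Ω p = _ at hn
  rw [hn]
  by_contra hne
  have unit : ∀ {v : ℂ}, v ≠ 0 → ‖‖v‖⁻¹ • v‖ = 1 := fun hv => norm_smul_inv_norm (𝕜 := ℝ) hv
  have hn0 : ∀ {τ : ℂ → ℝ} {u : ℂ}, fderiv ℝ τ p u = ‖gradient τ p‖ *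
      ⟪‖gradient τ p‖⁻¹ • gradient τ p, u⟫ := by
    intro τ u
    rw [← IsLocalDefiningFunction.inner_gradient, real_inner_smul_left]
    by_cases h0 : gradient τ p = 0
    · simp [h0]
    · field_simp
  set a := ‖gradient ρ' p‖⁻¹ • gradient ρ' p
  set b := ‖gradient ρ p‖⁻¹ • gradient ρ p
  have ha := unit h'.gradient_ne_zero
  have hb := unit h.gradient_ne_zero
  have h1 := inner_sub_lt_zero_of_norm_eq_one ha hb hne
  have h2 := inner_sub_lt_zero_of_norm_eq_one hb ha (Ne.symm hne)
  have h3 := h'.fderiv_apply_nonpos h hΩ hp (u := b - a) (by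
    rw [hn0]; exact mul_neg_of_pos_of_neg (norm_pos_iff.2 h'.gradient_ne_zero) h1)
  rw [hn0] at h3
  have h4 := nonpos_of_mul_nonpos_right h3 (norm_pos_iff.2 h.gradient_ne_zero)
  rw [← neg_sub, inner_neg_right] at h2
  linarith

theorem IsSmoothlyBounded.norm_outwardNormal {Ω : Set ℂ} (hΩ : IsSmoothlyBounded Ω) {p : ℂ}
    (hp : p ∈ frontier Ω) : ‖outwardNormal Ω p‖ = 1 := by
  obtain ⟨ρ, h⟩ := hΩ.exists_defining p hp
  rw [outwardNormal_eq hΩ.isOpen hp h]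
  exact norm_smul_inv_norm (𝕜 := ℝ) h.gradient_ne_zero

theorem IsLocalDefiningFunction.continuous_gradient {Ω : Set ℂ} {p : ℂ} {ρ : ℂ → ℝ}
    (h : IsLocalDefiningFunction Ω p ρ) : Continuous (gradient ρ) :=
  (InnerProductSpace.toDual ℝ ℂ).symm.continuous.comp (h.smooth.continuous_fderiv (by simp))

theorem IsSmoothlyBounded.continuousOn_outwardNormal {Ω : Set ℂ} (hΩ : IsSmoothlyBounded Ω) :
    ContinuousOn (outwardNormal Ω) (frontier Ω) := by
  intro p hp
  obtain ⟨ρ, h⟩ := hΩ.exists_defining p hp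
  have hc := h.continuous_gradient
  have h1 : ContinuousAt (fun q => ‖gradient ρ q‖⁻¹ • gradient ρ q) p :=
    (hc.norm.continuousAt.inv₀ (norm_ne_zero_iff.2 h.gradient_ne_zero)).smul hc.continuousAt
  refine h1.continuousWithinAt.congr_of_eventuallyEq ?_ (outwardNormal_eq hΩ.isOpen hp h)
  filter_upwards [nhdsWithin_le_nhds h.eventually_isLocalDefiningFunction, self_mem_nhdsWithin]
    with q h1 h2 using outwardNormal_eq hΩ.isOpen h2 h1

theorem IsSmoothlyBounded.continuous_outwardNormal {Ω : Set ℂ} (hΩ : IsSmoothlyBounded Ω) :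
    Continuous fun σ : frontier Ω => outwardNormal Ω σ :=
  continuousOn_iff_continuous_domRestrict.1 hΩ.continuousOn_outwardNormal

theorem IsSmoothlyBounded.isCompact_closure {Ω : Set ℂ} (hΩ : IsSmoothlyBounded Ω) :
    IsCompact (closure Ω) := hΩ.isBounded.isCompact_closure

theorem IsSmoothlyBounded.isCompact_frontier {Ω : Set ℂ} (hΩ : IsSmoothlyBounded Ω) :
    IsCompact (frontier Ω) :=
  hΩ.isCompact_closure.of_isClosed_subset isClosed_frontier frontier_subset_closure

theorem IsSmoothlyBounded.compactSpace {Ω : Set ℂ} (hΩ : IsSmoothlyBounded Ω) :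
    CompactSpace (frontier Ω) := isCompact_iff_compactSpace.1 hΩ.isCompact_frontier

/-- Chords of the boundary are tangential up to second order, locally. -/
theorem IsLocalDefiningFunction.exists_abs_inner_le {Ω : Set ℂ} (hΩ : IsOpen Ω) {p : ℂ} {ρ : ℂ → ℝ}
    (h : IsLocalDefiningFunction Ω p ρ) : ∃ C r : ℝ, 0 < r ∧ ∀ σ ∈ frontier Ω ∩ Metric.ball p r,
      ∀ z ∈ frontier Ω ∩ Metric.ball p r, |⟪outwardNormal Ω σ, σ - z⟫| ≤ C * ‖σ - z‖ ^ 2 := by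
  have hd : ContDiff ℝ 1 (fderiv ℝ ρ) := (contDiff_infty_iff_fderiv.1 h.smooth).2.of_le (by simp)
  obtain ⟨K, t, ht, hK⟩ := hd.contDiffAt.exists_lipschitzOnWith (x := p)
  have hg : ∀ᶠ q in 𝓝 p, ‖gradient ρ p‖ / 2 < ‖gradient ρ q‖ :=
    h.continuous_gradient.norm.continuousAt.eventually_const_lt
      (half_lt_self (norm_pos_iff.2 h.gradient_ne_zero))
  obtain ⟨r, hr, hball⟩ := Metric.eventually_nhds_iff_ball.1
    (hg.and (h.eventually_isLocalDefiningFunction.and ht))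
  have hg0 : 0 < ‖gradient ρ p‖ / 2 := half_pos (norm_pos_iff.2 h.gradient_ne_zero)
  refine ⟨(‖gradient ρ p‖ / 2)⁻¹ * K, r, hr, fun σ hσ z hz => ?_⟩
  have hσ' := hball σ hσ.2
  have hz' := hball z hz.2
  -- Taylor's formula at `σ`: the derivative of `ρ` is Lipschitz, so the linear approximation errs
  -- by at most `K‖z - σ‖²`. As `ρ` vanishes at both points, the linear term itself obeys this
  -- bound.
  have hmv := (convex_segment (𝕜 := ℝ) σ z).norm_image_sub_le_of_norm_fderiv_le' (𝕜 := ℝ) (f := ρ)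
    (C := K * ‖z - σ‖) (φ := fderiv ℝ ρ σ)
    (fun x _ => h.smooth.differentiable (by simp) x) (fun x hx => ?_)
    (left_mem_segment ℝ σ z) (right_mem_segment ℝ σ z)
  · rw [hσ'.2.1.apply_eq_zero hΩ hσ.1, hz'.2.1.apply_eq_zero hΩ hz.1, sub_zero, zero_sub, norm_neg,
      ← IsLocalDefiningFunction.inner_gradient, ← neg_sub σ z, inner_neg_right, norm_neg, norm_neg,
      Real.norm_eq_abs] at hmv
    rw [outwardNormal_eq hΩ hσ.1 hσ'.2.1, real_inner_smul_left, abs_mul, abs_inv, abs_norm,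
      mul_assoc]
    calc _ ≤ (‖gradient ρ p‖ / 2)⁻¹ * (K * ‖σ - z‖ * ‖σ - z‖) := by
          gcongr
          exact hσ'.1.le
      _ = _ := by ring
  · have hseg : segment ℝ σ z ⊆ Metric.ball p r :=
      (convex_ball p r).segment_subset hσ.2 hz.2
    rw [← dist_eq_norm, dist_comm]
    refine (hK.dist_le_mul _ (hball σ hσ.2).2.2 _ (hball x (hseg hx)).2.2).trans ?_
    gcongr
    obtain ⟨s, hs, rfl⟩ := segment_eq_image_lineMap ℝ σ z ▸ hx
    rw [dist_left_lineMap, dist_eq_norm, norm_sub_rev, Real.norm_eq_abs, abs_of_nonneg hs.1]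
    exact mul_le_of_le_one_left (norm_nonneg _) hs.2

theorem IsCompact.exists_forall_le_of_locally {X : Type*} [TopologicalSpace X] {s : Set X}
    (hs : IsCompact s) {f : X → ℝ} (h : ∀ x ∈ s, ∃ C : ℝ, ∀ᶠ y in 𝓝[s] x, f y ≤ C) :
    ∃ C, ∀ x ∈ s, f x ≤ C := by
  refine hs.induction_on (p := fun t => ∃ C, ∀ x ∈ t, f x ≤ C) ⟨0, by simp⟩ ?_ ?_ ?_
  · rintro s t hst ⟨C, hC⟩
    exact ⟨C, fun x hx => hC x (hst hx)⟩
  · rintro s t ⟨C, hC⟩ ⟨D, hD⟩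
    refine ⟨max C D, fun x hx => ?_⟩
    rcases hx with hx | hx
    · exact (hC x hx).trans (le_max_left _ _)
    · exact (hD x hx).trans (le_max_right _ _)
  · intro x hx
    obtain ⟨C, hC⟩ := h x hx
    exact ⟨_, hC, C, fun y hy => hy⟩

/-- Chords of the boundary are tangential up to second order. -/
theorem IsSmoothlyBounded.exists_abs_inner_le {Ω : Set ℂ} (hΩ : IsSmoothlyBounded Ω) :
    ∃ C : ℝ, 0 ≤ C ∧ ∀ σ ∈ frontier Ω, ∀ z ∈ frontier Ω,
      |⟪outwardNormal Ω σ, σ - z⟫| ≤ C * ‖σ - z‖ ^ 2 := by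
  obtain ⟨C, hC⟩ := (hΩ.isCompact_frontier.prod hΩ.isCompact_frontier).exists_forall_le_of_locally
    (f := fun q => |⟪outwardNormal Ω q.1, q.1 - q.2⟫| / ‖q.1 - q.2‖ ^ 2) (by
    rintro ⟨p, q⟩ ⟨hp, hq⟩
    -- Near the diagonal the local chord estimate applies; away from it Cauchy–Schwarz suffices, the
    -- denominator being bounded below.
    by_cases hpq : p = q
    · subst hpq
      obtain ⟨ρ, h⟩ := hΩ.exists_defining p hp
      obtain ⟨C, r, hr, hC⟩ := h.exists_abs_inner_le hΩ.isOpen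
      refine ⟨max C 0, ?_⟩
      have : ∀ᶠ y : ℂ × ℂ in 𝓝 (p, p), y.1 ∈ Metric.ball p r ∧ y.2 ∈ Metric.ball p r :=
        prod_mem_nhds (Metric.ball_mem_nhds p hr) (Metric.ball_mem_nhds p hr)
      filter_upwards [nhdsWithin_le_nhds this, self_mem_nhdsWithin] with y hy hys
      have := hC y.1 ⟨hys.1, hy.1⟩ y.2 ⟨hys.2, hy.2⟩
      exact div_le_of_le_mul₀ (by positivity) (by positivity)
        (this.trans (by gcongr; exact le_max_left _ _))
    · refine ⟨(‖p - q‖ / 2)⁻¹, ?_⟩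
      have hc : Continuous fun y : ℂ × ℂ => ‖y.1 - y.2‖ := by fun_prop
      have h0 : 0 < ‖p - q‖ := norm_pos_iff.2 (sub_ne_zero.2 hpq)
      have : ∀ᶠ y : ℂ × ℂ in 𝓝 (p, q), ‖p - q‖ / 2 < ‖y.1 - y.2‖ :=
        hc.continuousAt.eventually_const_lt (half_lt_self h0)
      filter_upwards [nhdsWithin_le_nhds this, self_mem_nhdsWithin] with y hy hys
      have hy0 : 0 < ‖y.1 - y.2‖ := (half_pos h0).trans hy
      have hb := abs_real_inner_le_norm (outwardNormal Ω y.1) (y.1 - y.2)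
      rw [hΩ.norm_outwardNormal hys.1, one_mul] at hb
      calc _ ≤ ‖y.1 - y.2‖ / ‖y.1 - y.2‖ ^ 2 := by gcongr
        _ = (‖y.1 - y.2‖)⁻¹ := by field_simp
        _ ≤ _ := by gcongr)
  refine ⟨max C 0, le_max_right _ _, fun σ hσ z hz => ?_⟩
  by_cases hσz : σ = z
  · simp [hσz]
  · have h0 : 0 < ‖σ - z‖ := norm_pos_iff.2 (sub_ne_zero.2 hσz)
    have := (hC (σ, z) ⟨hσ, hz⟩).trans (le_max_left C 0)
    rwa [div_le_iff₀ (by positivity)] at this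

/-! ### Arc length in terms of projections -/

/-- Second countability reduces the neighbourhoods to a countable cover, which is made disjoint so
that both measures add up over the pieces. -/
theorem MeasureTheory.Measure.le_of_locally_le {X : Type*} [TopologicalSpace X]
    [SecondCountableTopology X] [MeasurableSpace X] [OpensMeasurableSpace X] {μ ν : Measure X}
    (h : ∀ x, ∃ V ∈ 𝓝 x, ∀ E ⊆ V, MeasurableSet E → μ E ≤ ν E) : μ ≤ ν := by
  rcases isEmpty_or_nonempty X with hX | hX
  · simp [Measure.eq_zero_of_isEmpty]
  choose V hV hE using h
  obtain ⟨s, hs, hsU⟩ := TopologicalSpace.countable_cover_nhds (f := fun x => interior (V x))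
    fun x => interior_mem_nhds.2 (hV x)
  have hne : s.Nonempty := by
    rw [Set.nonempty_iff_ne_empty]
    rintro rfl
    simp at hsU
    exact absurd hsU.symm (Set.univ_nonempty.ne_empty)
  obtain ⟨f, rfl⟩ := hs.exists_eq_range hne
  rw [Set.biUnion_range] at hsU
  set D := disjointed fun n => interior (V (f n))
  have hD : ∀ n, MeasurableSet (D n) :=
    MeasurableSet.disjointed fun n => isOpen_interior.measurableSet
  refine Measure.le_iff.2 fun E hE' => ?_
  have hdecomp : E = ⋃ n, E ∩ D n := by
    rw [← Set.inter_iUnion, iUnion_disjointed, hsU, Set.inter_univ]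
  have hdisj : Pairwise (Function.onFun Disjoint fun n => E ∩ D n) := fun i j hij =>
    (disjoint_disjointed _ hij).mono Set.inter_subset_right Set.inter_subset_right
  rw [hdecomp, measure_iUnion hdisj fun n => hE'.inter (hD n),
    measure_iUnion hdisj fun n => hE'.inter (hD n)]
  exact ENNReal.tsum_le_tsum fun n => hE (f n) _
    (Set.inter_subset_right.trans ((disjointed_subset _ n).trans interior_subset)) (hE'.inter (hD n))

theorem ENNReal.le_of_forall_le_ofReal_one_add_mul {a b : ENNReal}
    (h : ∀ η : ℝ, 0 < η → a ≤ ENNReal.ofReal (1 + η) * b) : a ≤ b := by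
  have h1 : Tendsto (fun η : ℝ => ENNReal.ofReal (1 + η) * b) (𝓝[>] 0)
      (𝓝 (ENNReal.ofReal (1 + 0) * b)) := by
    refine ENNReal.Tendsto.mul_const ?_ (Or.inl (by simp))
    refine (ENNReal.continuous_ofReal.comp (by fun_prop : Continuous fun η : ℝ => 1 + η)).tendsto 0
      |>.mono_left nhdsWithin_le_nhds
  simp only [add_zero, ENNReal.ofReal_one, one_mul] at h1
  exact ge_of_tendsto h1 (by filter_upwards [self_mem_nhdsWithin] with η hη using h η hη)

/-- A map to the line that is infinitesimally a dilation of ratio `c` expresses the length measure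
with density `c` as the pullback of Lebesgue measure. -/
theorem comap_volume_eq_withDensity {X : Type*} [MetricSpace X] [SecondCountableTopology X]
    [MeasurableSpace X] [BorelSpace X] {π : X → ℝ} (hπ : MeasurableEmbedding π) {c : X → ℝ}
    (hc : Continuous c) (hpos : ∀ x, 0 < c x)
    (h : ∀ q, ∀ ε > 0, ∃ δ > 0, ∀ σ ∈ Metric.ball q δ, ∀ τ ∈ Metric.ball q δ,
      (c q - ε) * dist σ τ ≤ |π σ - π τ| ∧ |π σ - π τ| ≤ (c q + ε) * dist σ τ) :
    (volume : Measure ℝ).comap π =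
      (Measure.hausdorffMeasure 1 : Measure X).withDensity fun x => ENNReal.ofReal (c x) := by
  have key : ∀ η : ℝ, 0 < η → ∀ q, ∃ V ∈ 𝓝 q, ∀ E ⊆ V, MeasurableSet E →
      (volume : Measure ℝ).comap π E ≤ ENNReal.ofReal (1 + η) *
        (Measure.hausdorffMeasure 1 : Measure X).withDensity (fun x => ENNReal.ofReal (c x)) E ∧
      (Measure.hausdorffMeasure 1 : Measure X).withDensity (fun x => ENNReal.ofReal (c x)) E ≤
        ENNReal.ofReal (1 + η) * (volume : Measure ℝ).comap π E := by
    intro η hη q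
    have hq := hpos q
    -- Chosen so that the upper and lower dilation ratios differ exactly by the factor `1 + η`.
    set ε := c q * η / (2 + η) with hε
    have hε0 : 0 < ε := by positivity
    have hsub : 0 < c q - ε := by
      rw [hε]; field_simp; linarith
    have hrel : c q + ε = (1 + η) * (c q - ε) := by
      rw [hε]; field_simp; ring
    obtain ⟨δ, hδ, hδ'⟩ := h q ε hε0
    have hcn : ∀ᶠ x in 𝓝 q, c q - ε < c x ∧ c x < c q + ε :=
      (hc.continuousAt.eventually_const_lt (by linarith)).and
        (hc.continuousAt.eventually_lt_const (by linarith))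
    refine ⟨_, Filter.inter_mem (Metric.ball_mem_nhds q hδ) hcn, fun E hE hEm => ?_⟩
    have hEπ : (volume : Measure ℝ).comap π E = Measure.hausdorffMeasure 1 (π '' E) := by
      rw [hπ.comap_apply, hausdorffMeasure_real]
    have hup : Measure.hausdorffMeasure 1 (π '' E) ≤
        ENNReal.ofReal (c q + ε) * Measure.hausdorffMeasure 1 E := by
      have hL : LipschitzOnWith (Real.toNNReal (c q + ε)) π E := by
        refine LipschitzOnWith.of_dist_le_mul fun σ hσ τ hτ => ?_
        rw [Real.coe_toNNReal _ (by positivity), Real.dist_eq]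
        exact (hδ' σ (hE hσ).1 τ (hE hτ).1).2
      simpa [ENNReal.ofReal] using hL.hausdorffMeasure_image_le (d := 1) zero_le_one
    -- The lower bound on distances makes the inverse map Lipschitz on the image, and Lipschitz maps
    -- control Hausdorff measure.
    have hlow : ENNReal.ofReal (c q - ε) * Measure.hausdorffMeasure 1 E ≤
        Measure.hausdorffMeasure 1 (π '' E) := by
      have hL : LipschitzOnWith (Real.toNNReal (c q - ε)⁻¹)
          (@Function.invFun _ _ ⟨q⟩ π) (π '' E) := by
        refine LipschitzOnWith.of_dist_le_mul ?_
        rintro _ ⟨σ, hσ, rfl⟩ _ ⟨τ, hτ, rfl⟩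
        have : Nonempty X := ⟨q⟩
        rw [Real.coe_toNNReal _ (by positivity), Real.dist_eq,
          Function.leftInverse_invFun hπ.injective, Function.leftInverse_invFun hπ.injective,
          inv_mul_eq_div, le_div_iff₀' hsub]
        exact (hδ' σ (hE hσ).1 τ (hE hτ).1).1
      have h1 := hL.hausdorffMeasure_image_le (d := 1) zero_le_one
      have : Nonempty X := ⟨q⟩
      rw [← Set.image_comp, (Function.leftInverse_invFun hπ.injective).comp_eq_id, Set.image_id,
        ENNReal.rpow_one] at h1
      calc _ ≤ ENNReal.ofReal (c q - ε) *
            ((ENNReal.ofReal (c q - ε)⁻¹) * Measure.hausdorffMeasure 1 (π '' E)) := by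
            gcongr; exact h1
        _ = _ := by
            rw [← mul_assoc, ← ENNReal.ofReal_mul hsub.le, mul_inv_cancel₀ hsub.ne',
              ENNReal.ofReal_one, one_mul]
    have hdl : ENNReal.ofReal (c q - ε) * Measure.hausdorffMeasure 1 E ≤
        (Measure.hausdorffMeasure 1 : Measure X).withDensity (fun x => ENNReal.ofReal (c x)) E := by
      rw [withDensity_apply _ hEm, ← setLIntegral_const]
      exact setLIntegral_mono' hEm fun x hx => ENNReal.ofReal_le_ofReal (hE hx).2.1.le
    have hdu : (Measure.hausdorffMeasure 1 : Measure X).withDensity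
        (fun x => ENNReal.ofReal (c x)) E ≤
        ENNReal.ofReal (c q + ε) * Measure.hausdorffMeasure 1 E := by
      rw [withDensity_apply _ hEm, ← setLIntegral_const]
      exact setLIntegral_mono' hEm fun x hx => ENNReal.ofReal_le_ofReal (hE hx).2.2.le
    rw [hrel, ENNReal.ofReal_mul (by linarith), mul_assoc] at hup hdu
    rw [hEπ]
    exact ⟨hup.trans (by gcongr), hdu.trans (by gcongr)⟩
  refine le_antisymm (Measure.le_iff.2 fun E hE => ?_) (Measure.le_iff.2 fun E hE => ?_)
  · refine ENNReal.le_of_forall_le_ofReal_one_add_mul fun η hη => ?_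
    have : (volume : Measure ℝ).comap π ≤ ENNReal.ofReal (1 + η) •
        (Measure.hausdorffMeasure 1 : Measure X).withDensity (fun x => ENNReal.ofReal (c x)) :=
      Measure.le_of_locally_le fun q => by
        obtain ⟨V, hV, hVE⟩ := key η hη q
        exact ⟨V, hV, fun E hE hEm => by simpa using (hVE E hE hEm).1⟩
    simpa using this E
  · refine ENNReal.le_of_forall_le_ofReal_one_add_mul fun η hη => ?_
    have : (Measure.hausdorffMeasure 1 : Measure X).withDensity (fun x => ENNReal.ofReal (c x)) ≤
        ENNReal.ofReal (1 + η) • (volume : Measure ℝ).comap π :=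
      Measure.le_of_locally_le fun q => by
        obtain ⟨V, hV, hVE⟩ := key η hη q
        exact ⟨V, hV, fun E hE hEm => by simpa using (hVE E hE hEm).2⟩
    simpa using this E

open scoped ComplexConjugate in
-- In the frame of `n`, the vector `d` becomes `w = conj n * d`, which is almost purely imaginary.
-- Since `d * conj v` is `w` times the unit number `u = n * conj v`, its imaginary part is `u.re *
-- w.im` up to `ε‖d‖`: a tangential vector projected across `v` shrinks by the cosine `⟪n, v⟫`.
theorem abs_im_mul_conj_bounds {n v d : ℂ} {ε : ℝ} (hn : ‖n‖ = 1) (hv : ‖v‖ = 1)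
    (hc : 0 ≤ ⟪n, v⟫) (hd : |⟪n, d⟫| ≤ ε * ‖d‖) :
    (⟪n, v⟫ - 2 * ε) * ‖d‖ ≤ |(d * conj v).im| ∧ |(d * conj v).im| ≤ (⟪n, v⟫ + ε) * ‖d‖ := by
  set w := conj n * d with hw
  set u := n * conj v with hu
  have hcu : ⟪n, v⟫ = u.re := by
    rw [real_inner_comm, Complex.inner, hu, mul_comm]
  have hdw : ⟪n, d⟫ = w.re := by rw [Complex.inner, hw, mul_comm]
  have hwn : ‖w‖ = ‖d‖ := by simp [hw, hn]
  have hun : ‖u‖ = 1 := by simp [hu, hn, hv]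
  have hprod : d * conj v = u * w := by
    have : n * conj n = 1 := by rw [Complex.mul_conj']; simp [hn]
    linear_combination -(d * conj v) * this
  rw [hcu] at hc ⊢
  rw [hdw] at hd
  rw [hprod, Complex.mul_im]
  rw [← hwn] at hd ⊢
  have h1 := Complex.abs_im_le_norm w
  have h2 := Complex.norm_le_abs_re_add_abs_im w
  have h3 := Complex.abs_im_le_norm u
  have h4 := Complex.abs_re_le_norm u
  rw [hun] at h3 h4
  have h5 : |u.im * w.re| ≤ ε * ‖w‖ := by
    rw [abs_mul]
    exact (mul_le_of_le_one_left (abs_nonneg _) h3).trans hd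
  have h6 : |u.re * w.im| = u.re * |w.im| := by rw [abs_mul, abs_of_nonneg hc]
  have h7 : u.re * |w.im| ≤ u.re * ‖w‖ := by gcongr
  have h8 : u.re * ‖w‖ ≤ u.re * |w.im| + ε * ‖w‖ := by
    rw [abs_of_nonneg hc] at h4
    nlinarith [abs_nonneg w.re, abs_nonneg w.im]
  constructor
  · have := abs_sub_abs_le_abs_sub (u.re * w.im) (-(u.im * w.re))
    rw [abs_neg, sub_neg_eq_add] at this
    linarith
  · linarith [abs_add_le (u.re * w.im) (u.im * w.re)]

/-- On the ball of centre `p` and radius `r` the function `ρ` defines `Ω` and increases in the unit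
direction `v`. -/
structure IsBoundaryPatch (Ω : Set ℂ) (p : ℂ) (r : ℝ) (ρ : ℂ → ℝ) (v : ℂ) : Prop where
  isOpen : IsOpen Ω
  norm_eq : ‖v‖ = 1
  isLocalDefiningFunction : ∀ z ∈ Metric.ball p r, IsLocalDefiningFunction Ω z ρ
  fderiv_pos : ∀ z ∈ Metric.ball p r, 0 < fderiv ℝ ρ z v

theorem IsLocalDefiningFunction.eventually_fderiv_pos {Ω : Set ℂ} {p v : ℂ} {ρ : ℂ → ℝ}
    (h : IsLocalDefiningFunction Ω p ρ) (hv : 0 < fderiv ℝ ρ p v) :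
    ∀ᶠ z in 𝓝 p, 0 < fderiv ℝ ρ z v := by
  have hc : Continuous fun z => fderiv ℝ ρ z v :=
    (h.smooth.continuous_fderiv (by simp)).clm_apply continuous_const
  exact hc.continuousAt.eventually_const_lt hv

theorem IsLocalDefiningFunction.exists_isBoundaryPatch {Ω : Set ℂ} (hΩ : IsOpen Ω) {p v : ℂ}
    {ρ : ℂ → ℝ} (h : IsLocalDefiningFunction Ω p ρ) (hv1 : ‖v‖ = 1) (hv : 0 < fderiv ℝ ρ p v) :
    ∃ R > 0, ∀ r ≤ R, IsBoundaryPatch Ω p r ρ v := by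
  obtain ⟨R, hR, hb⟩ := Metric.eventually_nhds_iff_ball.1
    (h.eventually_isLocalDefiningFunction.and (h.eventually_fderiv_pos hv))
  exact ⟨R, hR, fun r hr => ⟨hΩ, hv1, fun z hz => (hb z (Metric.ball_subset_ball hr hz)).1,
    fun z hz => (hb z (Metric.ball_subset_ball hr hz)).2⟩⟩

/-! ### Boundary patches as graphs over the coordinate orthogonal to `v`. -/

namespace IsBoundaryPatch

variable {Ω : Set ℂ} {p v : ℂ} {r : ℝ} {ρ : ℂ → ℝ}

theorem mem_iff (h : IsBoundaryPatch Ω p r ρ v) {z : ℂ} (hz : z ∈ Metric.ball p r) :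
    z ∈ Ω ↔ ρ z < 0 := (h.isLocalDefiningFunction z hz).eventually_iff.self_of_nhds

theorem apply_eq_zero (h : IsBoundaryPatch Ω p r ρ v) {z : ℂ} (hz : z ∈ Metric.ball p r)
    (hz' : z ∈ frontier Ω) : ρ z = 0 :=
  (h.isLocalDefiningFunction z hz).apply_eq_zero h.isOpen hz'

theorem apply_lt (h : IsBoundaryPatch Ω p r ρ v) {z : ℂ} (hz : z ∈ Metric.ball p r) {t : ℝ}
    (ht : 0 < t) (hzt : z + t • v ∈ Metric.ball p r) : ρ z < ρ (z + t • v) := by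
  have hseg : ∀ s ∈ Set.Icc 0 t, z + s • v ∈ Metric.ball p r := by
    intro s hs
    have hsp : z + s • v ∈ segment ℝ z (z + t • v) := by
      rw [segment_eq_image']
      refine ⟨s / t, ⟨div_nonneg hs.1 ht.le, div_le_one_of_le₀ hs.2 ht.le⟩, ?_⟩
      simp only [add_sub_cancel_left, smul_smul, div_mul_cancel₀ _ ht.ne']
    exact (convex_ball p r).segment_subset hz hzt hsp
  have hρ := (h.isLocalDefiningFunction z hz).smooth
  have hder : ∀ s : ℝ, HasDerivAt (fun s : ℝ => ρ (z + s • v)) (fderiv ℝ ρ (z + s • v) v) s := by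
    intro s
    have h1 : HasDerivAt (fun t : ℝ => z + t • v) v s := by
      simpa using ((hasDerivAt_id s).smul_const v).const_add z
    exact (hρ.differentiable (by simp) _).hasFDerivAt.comp_hasDerivAt s h1
  have hmono : StrictMonoOn (fun s : ℝ => ρ (z + s • v)) (Set.Icc 0 t) := by
    refine strictMonoOn_of_deriv_pos (convex_Icc 0 t)
      (fun s _ => (hder s).continuousAt.continuousWithinAt) fun s hs => ?_
    rw [(hder s).deriv]
    exact h.fderiv_pos _ (hseg s (interior_subset hs))
  simpa using hmono (Set.left_mem_Icc.2 ht.le) (Set.right_mem_Icc.2 ht.le) ht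

theorem outwardNormal_eq (h : IsBoundaryPatch Ω p r ρ v) {z : ℂ} (hz : z ∈ Metric.ball p r)
    (hz' : z ∈ frontier Ω) : outwardNormal Ω z = ‖gradient ρ z‖⁻¹ • gradient ρ z :=
  _root_.outwardNormal_eq h.isOpen hz' (h.isLocalDefiningFunction z hz)

theorem norm_outwardNormal (h : IsBoundaryPatch Ω p r ρ v) {z : ℂ} (hz : z ∈ Metric.ball p r)
    (hz' : z ∈ frontier Ω) : ‖outwardNormal Ω z‖ = 1 := by
  rw [h.outwardNormal_eq hz hz']
  exact norm_smul_inv_norm (𝕜 := ℝ) (h.isLocalDefiningFunction z hz).gradient_ne_zero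

theorem inner_outwardNormal (h : IsBoundaryPatch Ω p r ρ v) {z : ℂ} (hz : z ∈ Metric.ball p r)
    (hz' : z ∈ frontier Ω) (u : ℂ) :
    ⟪outwardNormal Ω z, u⟫ = ‖gradient ρ z‖⁻¹ * fderiv ℝ ρ z u := by
  rw [h.outwardNormal_eq hz hz', real_inner_smul_left, IsLocalDefiningFunction.inner_gradient]

theorem inner_outwardNormal_pos (h : IsBoundaryPatch Ω p r ρ v) {z : ℂ} (hz : z ∈ Metric.ball p r)
    (hz' : z ∈ frontier Ω) : 0 < ⟪outwardNormal Ω z, v⟫ := by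
  rw [h.inner_outwardNormal hz hz']
  exact mul_pos (inv_pos.2 (norm_pos_iff.2 (h.isLocalDefiningFunction z hz).gradient_ne_zero))
    (h.fderiv_pos z hz)

open scoped ComplexConjugate in
theorem self_eq (h : IsBoundaryPatch Ω p r ρ v) (z : ℂ) :
    z = ((z * conj v).re + (z * conj v).im * Complex.I) * v := by
  have : v * conj v = 1 := by rw [Complex.mul_conj']; simp [h.norm_eq]
  rw [Complex.re_add_im]
  linear_combination -z * this

open scoped ComplexConjugate in
/-- Two points on a common line in the direction `v` differ by a multiple of `v`. -/
theorem eq_add_smul (h : IsBoundaryPatch Ω p r ρ v) {σ τ : ℂ}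
    (hστ : (σ * conj v).im = (τ * conj v).im) :
    τ = σ + ((τ * conj v).re - (σ * conj v).re) • v := by
  have h2 := h.self_eq σ
  have h1 := h.self_eq τ
  rw [hστ] at h2
  rw [Complex.real_smul]
  push_cast
  linear_combination h1 - h2

open scoped ComplexConjugate in
-- Along each line in the direction `v` the function `ρ` is strictly increasing, and it vanishes on
-- the boundary, so the line meets the patch at most once.
theorem injOn_im (h : IsBoundaryPatch Ω p r ρ v) :
    Set.InjOn (fun z : ℂ => (z * conj v).im) (frontier Ω ∩ Metric.ball p r) := by
  have key : ∀ σ ∈ frontier Ω ∩ Metric.ball p r, ∀ τ ∈ frontier Ω ∩ Metric.ball p r,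
      (σ * conj v).im = (τ * conj v).im → ¬ (σ * conj v).re < (τ * conj v).re := by
    intro σ hσ τ hτ hστ hlt
    have e := h.eq_add_smul hστ
    have := h.apply_lt hσ.2 (sub_pos.2 hlt) (by rw [← e]; exact hτ.2)
    rw [← e, h.apply_eq_zero hσ.2 hσ.1, h.apply_eq_zero hτ.2 hτ.1] at this
    exact lt_irrefl _ this
  intro σ hσ τ hτ hστ
  have hre : (σ * conj v).re = (τ * conj v).re :=
    le_antisymm (not_lt.1 (key τ hτ σ hσ hστ.symm)) (not_lt.1 (key σ hσ τ hτ hστ))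
  have e := h.eq_add_smul hστ
  rw [hre, sub_self, zero_smul, add_zero] at e
  exact e.symm

theorem measurableSet (_h : IsBoundaryPatch Ω p r ρ v) :
    MeasurableSet (frontier Ω ∩ Metric.ball p r) :=
  isClosed_frontier.measurableSet.inter measurableSet_ball

open scoped ComplexConjugate in
-- Lusin–Souslin: an injective Borel map from a standard Borel space is a measurable embedding, so
-- no inverse chart has to be constructed.
theorem measurableEmbedding (h : IsBoundaryPatch Ω p r ρ v) :
    MeasurableEmbedding fun σ : ↥(frontier Ω ∩ Metric.ball p r) => ((σ : ℂ) * conj v).im := by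
  have : StandardBorelSpace ↥(frontier Ω ∩ Metric.ball p r) := h.measurableSet.standardBorel
  refine Measurable.measurableEmbedding ?_ h.injOn_im.injective
  exact (by fun_prop : Continuous fun σ : ↥(frontier Ω ∩ Metric.ball p r) =>
    ((σ : ℂ) * conj v).im).measurable

theorem continuousOn_outwardNormal (h : IsBoundaryPatch Ω p r ρ v) :
    ContinuousOn (outwardNormal Ω) (frontier Ω ∩ Metric.ball p r) := by
  rcases Set.eq_empty_or_nonempty (frontier Ω ∩ Metric.ball p r) with he | ⟨q, hq⟩
  · simp [he]
  have hc := (h.isLocalDefiningFunction q hq.2).continuous_gradient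
  have h1 : ContinuousOn (fun q => ‖gradient ρ q‖⁻¹ • gradient ρ q)
      (frontier Ω ∩ Metric.ball p r) := by
    refine ContinuousOn.smul (hc.norm.continuousOn.inv₀ fun z hz => ?_) hc.continuousOn
    exact norm_ne_zero_iff.2 (h.isLocalDefiningFunction z hz.2).gradient_ne_zero
  exact h1.congr fun z hz => h.outwardNormal_eq hz.2 hz.1

open scoped ComplexConjugate in
theorem comap_volume (h : IsBoundaryPatch Ω p r ρ v) :
    (volume : Measure ℝ).comap
        (fun σ : ↥(frontier Ω ∩ Metric.ball p r) => ((σ : ℂ) * conj v).im) =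
      (Measure.hausdorffMeasure 1 : Measure ↥(frontier Ω ∩ Metric.ball p r)).withDensity
        fun σ => ENNReal.ofReal ⟪outwardNormal Ω σ, v⟫ := by
  refine comap_volume_eq_withDensity h.measurableEmbedding ?_
    (fun σ => h.inner_outwardNormal_pos σ.2.2 σ.2.1) ?_
  · exact (continuousOn_iff_continuous_domRestrict.1 h.continuousOn_outwardNormal).inner
      continuous_const
  · intro q ε hε
    have hq := h.isLocalDefiningFunction q q.2.2
    have hg : 0 < ‖gradient ρ q‖ := norm_pos_iff.2 hq.gradient_ne_zero
    -- Strict differentiability is needed because both endpoints of the chord move. With `ρ` zero at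
    -- both, it says that chords near `q` are almost orthogonal to the normal at `q`.
    have hs := (hq.smooth.contDiffAt (x := (q : ℂ))).hasStrictFDerivAt (by simp)
    have hε' : 0 < ‖gradient ρ q‖ * (ε / 2) := by positivity
    obtain ⟨δ, hδ, hb⟩ := Metric.eventually_nhds_iff_ball.1 (hs.isLittleO.def hε')
    refine ⟨δ, hδ, fun σ hσ τ hτ => ?_⟩
    have h1 := hb ((σ : ℂ), (τ : ℂ)) (by
      rw [← ball_prod_same]; exact ⟨hσ, hτ⟩)
    simp only [h.apply_eq_zero σ.2.2 σ.2.1, h.apply_eq_zero τ.2.2 τ.2.1, sub_self, zero_sub,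
      norm_neg, Real.norm_eq_abs] at h1
    have h2 : |⟪outwardNormal Ω q, (σ : ℂ) - τ⟫| ≤ ε / 2 * ‖(σ : ℂ) - τ‖ := by
      rw [h.inner_outwardNormal q.2.2 q.2.1, abs_mul, abs_of_pos (inv_pos.2 hg),
        inv_mul_le_iff₀ hg]
      linarith
    have h3 := abs_im_mul_conj_bounds (h.norm_outwardNormal q.2.2 q.2.1) h.norm_eq
      (h.inner_outwardNormal_pos q.2.2 q.2.1).le h2
    rw [sub_mul, sub_mul, Complex.sub_im] at h3
    rw [Subtype.dist_eq, dist_eq_norm]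
    refine ⟨by linarith [h3.1], h3.2.trans ?_⟩
    gcongr
    linarith

end IsBoundaryPatch

theorem comap_subtype_val_hausdorffMeasure {s : Set ℂ} (hs : MeasurableSet s) :
    (Measure.hausdorffMeasure 1 : Measure ℂ).comap (Subtype.val : s → ℂ) =
      Measure.hausdorffMeasure 1 := by
  refine Measure.ext fun E hE => ?_
  rw [(MeasurableEmbedding.subtype_coe hs).comap_apply,
    isometry_subtype_coe.hausdorffMeasure_image (Or.inl zero_le_one)]

theorem integral_arcLength {E : Type*} [NormedAddCommGroup E] [NormedSpace ℝ E] {Ω : Set ℂ}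
    (F : ℂ → E) : ∫ σ, F σ ∂(arcLength Ω) =
      ∫ σ in frontier Ω, F σ ∂(Measure.hausdorffMeasure 1) :=
  integral_subtype_comap isClosed_frontier.measurableSet F

theorem lintegral_arcLength {Ω : Set ℂ} (F : ℂ → ENNReal) : ∫⁻ σ, F σ ∂(arcLength Ω) =
      ∫⁻ σ in frontier Ω, F σ ∂(Measure.hausdorffMeasure 1) :=
  lintegral_subtype_comap isClosed_frontier.measurableSet F

namespace IsBoundaryPatch

variable {Ω : Set ℂ} {p v : ℂ} {r : ℝ} {ρ : ℂ → ℝ}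

open scoped ComplexConjugate in
theorem setIntegral_inner_smul {E : Type*} [NormedAddCommGroup E] [NormedSpace ℝ E]
    (h : IsBoundaryPatch Ω p r ρ v) {F : ℂ → E} {G : ℝ → E}
    (hFG : ∀ σ ∈ frontier Ω ∩ Metric.ball p r, F σ = G (σ * conj v).im) :
    ∫ σ in frontier Ω ∩ Metric.ball p r, ⟪outwardNormal Ω σ, v⟫ • F σ
        ∂(Measure.hausdorffMeasure 1) =
      ∫ x in (fun z : ℂ => (z * conj v).im) '' (frontier Ω ∩ Metric.ball p r), G x := by
  set π : ↥(frontier Ω ∩ Metric.ball p r) → ℝ := fun σ => ((σ : ℂ) * conj v).im with hπ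
  have hrange : (fun z : ℂ => (z * conj v).im) '' (frontier Ω ∩ Metric.ball p r) =
      Set.range π := by
    rw [Set.image_eq_range]
  rw [hrange, ← h.measurableEmbedding.map_comap, h.measurableEmbedding.integral_map,
    h.comap_volume, integral_withDensity_eq_integral_toReal_smul]
  · rw [← integral_subtype_comap h.measurableSet
      (fun σ => ⟪outwardNormal Ω σ, v⟫ • F σ), comap_subtype_val_hausdorffMeasure h.measurableSet]
    refine integral_congr_ae (ae_of_all _ fun σ => ?_)
    simp only
    rw [ENNReal.toReal_ofReal (h.inner_outwardNormal_pos σ.2.2 σ.2.1).le, hFG σ σ.2]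
  · exact (ENNReal.continuous_ofReal.comp ((continuousOn_iff_continuous_domRestrict.1
      h.continuousOn_outwardNormal).inner continuous_const)).measurable
  · exact ae_of_all _ fun σ => ENNReal.ofReal_lt_top

open scoped ComplexConjugate in
-- Only an upper bound is needed for length estimates, so the projected patch is replaced by the
-- interval that contains it.
theorem setLIntegral_inner_mul_le (h : IsBoundaryPatch Ω p r ρ v) {G : ℝ → ENNReal}
    (hG : Measurable G) :
    ∫⁻ σ in frontier Ω ∩ Metric.ball p r, ENNReal.ofReal ⟪outwardNormal Ω σ, v⟫ *
        G (σ * conj v).im ∂(Measure.hausdorffMeasure 1) ≤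
      ∫⁻ x in Metric.ball (p * conj v).im r, G x := by
  set π : ↥(frontier Ω ∩ Metric.ball p r) → ℝ := fun σ => ((σ : ℂ) * conj v).im with hπ
  rw [← lintegral_subtype_comap h.measurableSet
      (fun σ => ENNReal.ofReal ⟪outwardNormal Ω σ, v⟫ * G (σ * conj v).im),
    comap_subtype_val_hausdorffMeasure h.measurableSet]
  have h1 := lintegral_withDensity_eq_lintegral_mul
    (Measure.hausdorffMeasure 1 : Measure ↥(frontier Ω ∩ Metric.ball p r))
    (f := fun σ => ENNReal.ofReal ⟪outwardNormal Ω σ, v⟫)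
    (ENNReal.continuous_ofReal.comp ((continuousOn_iff_continuous_domRestrict.1
      h.continuousOn_outwardNormal).inner continuous_const)).measurable
    (g := G ∘ π) (hG.comp h.measurableEmbedding.measurable)
  refine h1.symm.le.trans ?_
  rw [← h.comap_volume]
  change ∫⁻ a, G (π a) ∂_ ≤ _
  rw [← h.measurableEmbedding.lintegral_map, h.measurableEmbedding.map_comap]
  refine lintegral_mono_set ?_
  rintro _ ⟨σ, rfl⟩
  have h2 : ‖((σ : ℂ) - p) * conj v‖ < r := by
    rw [norm_mul, Complex.norm_conj, h.norm_eq, mul_one, ← dist_eq_norm]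
    exact σ.2.2
  rw [Metric.mem_ball, Real.dist_eq, ← Complex.sub_im, ← sub_mul]
  exact (Complex.abs_im_le_norm _).trans_lt h2

end IsBoundaryPatch

/-! ### Length estimates on the boundary -/

theorem lintegral_poissonKernel {d : ℝ} (hd : 0 < d) (a : ℝ) :
    ∫⁻ x : ℝ, ENNReal.ofReal (d / (d ^ 2 + (x - a) ^ 2)) = ENNReal.ofReal Real.pi := by
  have h0 : ∀ x : ℝ, d / (d ^ 2 + (x - a) ^ 2) = d⁻¹ * (1 + ((x - a) / d) ^ 2)⁻¹ := by
    intro x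
    field_simp
  have hint : Integrable fun x : ℝ => (1 + ((x - a) / d) ^ 2)⁻¹ :=
    (integrable_inv_one_add_sq.comp_div hd.ne').comp_sub_right a
  rw [← ofReal_integral_eq_lintegral_ofReal]
  · simp_rw [h0]
    rw [integral_const_mul, integral_sub_right_eq_self (fun x : ℝ => (1 + (x / d) ^ 2)⁻¹) a,
      Measure.integral_comp_div (fun x : ℝ => (1 + x ^ 2)⁻¹), integral_univ_inv_one_add_sq,
      abs_of_pos hd, smul_eq_mul, inv_mul_cancel_left₀ hd.ne']
  · simp_rw [h0]
    exact hint.const_mul _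
  · exact ae_of_all _ fun x => by positivity

open scoped ComplexConjugate in
-- Near `p` the normals stay within `⟪n(σ), n(p)⟫ > 1/2`, so integrals over the patch are at most
-- twice integrals over its projection. Projection shortens distances, so the kernel is dominated by
-- the Poisson kernel of the line, whose mass is `π` for every `d` and every centre.
theorem IsSmoothlyBounded.exists_patch_bounds {Ω : Set ℂ} (hΩ : IsSmoothlyBounded Ω) {p : ℂ}
    (hp : p ∈ frontier Ω) : ∃ t ∈ 𝓝[frontier Ω] p, ∃ C : ENNReal, C ≠ ⊤ ∧
      Measure.hausdorffMeasure 1 t ≤ C ∧ ∀ z : ℂ, ∀ d > 0,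
        ∫⁻ σ in t, ENNReal.ofReal (d / (d ^ 2 + ‖σ - z‖ ^ 2)) ∂(Measure.hausdorffMeasure 1) ≤ C := by
  obtain ⟨ρ, h⟩ := hΩ.exists_defining p hp
  have hn1 := hΩ.norm_outwardNormal hp
  have hv : 0 < fderiv ℝ ρ p (outwardNormal Ω p) := by
    rw [← IsLocalDefiningFunction.inner_gradient, outwardNormal_eq hΩ.isOpen hp h,
      real_inner_smul_right, real_inner_self_eq_norm_sq]
    have := norm_pos_iff.2 h.gradient_ne_zero
    positivity
  obtain ⟨R, hR, hpatch⟩ := h.exists_isBoundaryPatch hΩ.isOpen hn1 hv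
  have hc : ∀ᶠ σ in 𝓝[frontier Ω] p, 1 / 2 < ⟪outwardNormal Ω σ, outwardNormal Ω p⟫ := by
    have hc : ContinuousWithinAt (fun σ => ⟪outwardNormal Ω σ, outwardNormal Ω p⟫)
        (frontier Ω) p := (hΩ.continuousOn_outwardNormal p hp).inner continuousWithinAt_const
    refine hc.eventually_const_lt ?_
    change 1 / 2 < ⟪outwardNormal Ω p, outwardNormal Ω p⟫
    rw [real_inner_self_eq_norm_sq, hn1]
    norm_num
  obtain ⟨R', hR', hb⟩ := Metric.mem_nhdsWithin_iff.1 hc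
  set r := min R R'
  have hr : 0 < r := lt_min hR hR'
  have P := hpatch r (min_le_left _ _)
  set v := outwardNormal Ω p
  have hle : ∀ G : ℝ → ENNReal, Measurable G →
      ∫⁻ σ in frontier Ω ∩ Metric.ball p r, G (σ * conj v).im ∂(Measure.hausdorffMeasure 1) ≤
        2 * ∫⁻ x in Metric.ball (p * conj v).im r, G x := by
    intro G hG
    refine le_trans ?_ (mul_le_mul_right (P.setLIntegral_inner_mul_le hG) 2)
    rw [← lintegral_const_mul' _ _ (by simp)]
    refine setLIntegral_mono' P.measurableSet fun σ hσ => ?_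
    rw [← mul_assoc]
    refine le_mul_of_one_le_left' ?_
    have h1 : 1 / 2 < ⟪outwardNormal Ω σ, v⟫ :=
      hb ⟨Metric.ball_subset_ball (min_le_right _ _) hσ.2, hσ.1⟩
    calc (1 : ENNReal) = ENNReal.ofReal (2 * (1 / 2)) := by norm_num
      _ = 2 * ENNReal.ofReal (1 / 2) := by rw [ENNReal.ofReal_mul (by norm_num)]; norm_num
      _ ≤ _ := by gcongr
  refine ⟨frontier Ω ∩ Metric.ball p r, ?_,
    max (2 * volume (Metric.ball (p * conj v).im r)) (2 * ENNReal.ofReal Real.pi), ?_, ?_, ?_⟩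
  · exact inter_mem self_mem_nhdsWithin (nhdsWithin_le_nhds (Metric.ball_mem_nhds p hr))
  · simp [ENNReal.mul_eq_top]
  · refine le_trans ?_ (le_max_left _ _)
    have := hle (fun _ => 1) measurable_const
    simpa using this
  · intro z d hd
    refine le_trans ?_ (le_max_right _ _)
    have hG : Measurable fun x : ℝ => ENNReal.ofReal (d / (d ^ 2 + (x - (z * conj v).im) ^ 2)) := by
      fun_prop
    calc _ ≤ ∫⁻ σ in frontier Ω ∩ Metric.ball p r,
          ENNReal.ofReal (d / (d ^ 2 + ((σ * conj v).im - (z * conj v).im) ^ 2))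
            ∂(Measure.hausdorffMeasure 1) := by
          refine lintegral_mono fun σ => ENNReal.ofReal_le_ofReal ?_
          have h2 : |(σ * conj v).im - (z * conj v).im| ≤ ‖σ - z‖ := by
            rw [← Complex.sub_im, ← sub_mul]
            refine (Complex.abs_im_le_norm _).trans ?_
            rw [norm_mul, Complex.norm_conj, hn1, mul_one]
          have h3 := sq_le_sq' (abs_le.1 h2).1 (abs_le.1 h2).2
          gcongr
      _ ≤ _ := hle _ hG
      _ ≤ 2 * ∫⁻ x, ENNReal.ofReal (d / (d ^ 2 + (x - (z * conj v).im) ^ 2)) := by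
          gcongr
          exact Measure.restrict_le_self
      _ = _ := by rw [lintegral_poissonKernel hd]

theorem IsSmoothlyBounded.exists_length_bounds {Ω : Set ℂ} (hΩ : IsSmoothlyBounded Ω) :
    ∃ C : ENNReal, C ≠ ⊤ ∧ Measure.hausdorffMeasure 1 (frontier Ω) ≤ C ∧ ∀ z : ℂ, ∀ d > 0,
      ∫⁻ σ in frontier Ω, ENNReal.ofReal (d / (d ^ 2 + ‖σ - z‖ ^ 2))
        ∂(Measure.hausdorffMeasure 1) ≤ C := by
  refine hΩ.isCompact_frontier.induction_on (p := fun t => ∃ C : ENNReal, C ≠ ⊤ ∧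
    Measure.hausdorffMeasure 1 t ≤ C ∧ ∀ z : ℂ, ∀ d > 0,
      ∫⁻ σ in t, ENNReal.ofReal (d / (d ^ 2 + ‖σ - z‖ ^ 2)) ∂(Measure.hausdorffMeasure 1) ≤ C)
    ⟨0, by simp⟩ ?_ ?_ fun p hp => hΩ.exists_patch_bounds hp
  · rintro s t hst ⟨C, h1, h2, h3⟩
    exact ⟨C, h1, (measure_mono hst).trans h2, fun z d hd =>
      (lintegral_mono_set hst).trans (h3 z d hd)⟩
  · rintro s t ⟨C, h1, h2, h3⟩ ⟨D, k1, k2, k3⟩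
    exact ⟨C + D, ENNReal.add_ne_top.2 ⟨h1, k1⟩, (measure_union_le _ _).trans (add_le_add h2 k2),
      fun z d hd => (lintegral_union_le _ _ _).trans (add_le_add (h3 z d hd) (k3 z d hd))⟩

theorem IsSmoothlyBounded.isFiniteMeasure_arcLength {Ω : Set ℂ} (hΩ : IsSmoothlyBounded Ω) :
    IsFiniteMeasure (arcLength Ω) := by
  obtain ⟨C, hC, h, -⟩ := hΩ.exists_length_bounds
  refine ⟨lt_of_le_of_lt ?_ (lt_top_iff_ne_top.2 hC)⟩
  rw [arcLength, (MeasurableEmbedding.subtype_coe isClosed_frontier.measurableSet).comap_apply]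
  simpa using h

theorem IsSmoothlyBounded.integrable_of_continuous {Ω : Set ℂ} (hΩ : IsSmoothlyBounded Ω)
    {E : Type*} [NormedAddCommGroup E] {F : frontier Ω → E} (hF : Continuous F) :
    Integrable F (arcLength Ω) := by
  have := hΩ.compactSpace
  have := hΩ.isFiniteMeasure_arcLength
  exact hF.integrable_of_hasCompactSupport (HasCompactSupport.of_compactSpace F)

theorem IsSmoothlyBounded.exists_integral_poissonKernel_le {Ω : Set ℂ}
    (hΩ : IsSmoothlyBounded Ω) : ∃ C : ℝ, 0 ≤ C ∧ ∀ z : ℂ, ∀ d > 0,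
      ∫ σ : frontier Ω, d / (d ^ 2 + ‖(σ : ℂ) - z‖ ^ 2) ∂(arcLength Ω) ≤ C := by
  obtain ⟨C, hC, -, h⟩ := hΩ.exists_length_bounds
  refine ⟨C.toReal, ENNReal.toReal_nonneg, fun z d hd => ?_⟩
  have hint : Integrable (fun σ : frontier Ω => d / (d ^ 2 + ‖(σ : ℂ) - z‖ ^ 2)) (arcLength Ω) :=
    hΩ.integrable_of_continuous (by
      refine continuous_const.div (by fun_prop) fun σ => ?_
      positivity)
  rw [integral_eq_lintegral_of_nonneg_ae (ae_of_all _ fun σ => by positivity)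
    hint.aestronglyMeasurable]
  refine ENNReal.toReal_mono hC ?_
  rw [lintegral_arcLength fun σ => ENNReal.ofReal (d / (d ^ 2 + ‖σ - z‖ ^ 2))]
  exact h z d hd

theorem nullSingletonClass_arcLength (Ω : Set ℂ) : NullSingletonClass (arcLength Ω) := by
  rw [arcLength, comap_subtype_val_hausdorffMeasure isClosed_frontier.measurableSet]
  exact Measure.nullSingletonClass_hausdorff _ one_pos

theorem ae_arcLength_ne {Ω : Set ℂ} (z : ℂ) : ∀ᵐ σ : frontier Ω ∂(arcLength Ω), (σ : ℂ) ≠ z := by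
  have := nullSingletonClass_arcLength Ω
  by_cases hz : z ∈ frontier Ω
  · have : (arcLength Ω) ({⟨z, hz⟩} : Set (frontier Ω)) = 0 := measure_singleton _
    filter_upwards [compl_mem_ae_iff.2 this] with σ hσ h
    exact hσ (Subtype.ext h)
  · exact ae_of_all _ fun σ (h : (σ : ℂ) = z) => hz (h ▸ σ.2)

/-! ### The divergence theorem in one direction -/

/-- Smoothness is asked only near `K`: a point of the half-line lies either in the support, hence in
`K`, or where `g` vanishes locally. Bounded support removes the contribution from `-∞`. -/
theorem integral_Iic_fderiv_line {E : Type*} [NormedAddCommGroup E] [NormedSpace ℝ E]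
    [CompleteSpace E] {g : ℂ → E} {K : Set ℂ} (hK : ∀ ζ ∈ K, ContDiffAt ℝ 1 g ζ)
    (hs : Bornology.IsBounded (tsupport g)) {c v : ℂ} (hv : ‖v‖ = 1) {a₀ : ℝ}
    (ha : ∀ a ≤ a₀, c + a • v ∈ tsupport g → c + a • v ∈ K) :
    ∫ a in Set.Iic a₀, fderiv ℝ g (c + a • v) v = g (c + a₀ • v) := by
  have hline : Continuous fun a : ℝ => c + a • v := by fun_prop
  have hsm : ∀ a ≤ a₀, ContDiffAt ℝ 1 g (c + a • v) := by
    intro a haa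
    by_cases h : c + a • v ∈ tsupport g
    · exact hK _ (ha a haa h)
    · exact contDiffAt_const.congr_of_eventuallyEq (notMem_tsupport_iff_eventuallyEq.1 h)
  obtain ⟨R, hR⟩ := hs.subset_closedBall 0
  have hzero : ∀ a < -(R + ‖c‖), c + a • v ∉ tsupport g := by
    intro a haR hmem
    have h1 : ‖c + a • v‖ ≤ R := by simpa using hR hmem
    have h2 : ‖a • v‖ ≤ ‖c + a • v‖ + ‖c‖ := by
      simpa using norm_sub_le (c + a • v) c
    rw [norm_smul, hv, mul_one, Real.norm_eq_abs] at h2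
    linarith [neg_abs_le a]
  have hder : ∀ a ∈ Set.Iic a₀,
      HasDerivAt (fun a : ℝ => g (c + a • v)) (fderiv ℝ g (c + a • v) v) a := by
    intro a haa
    have h1 : HasDerivAt (fun a : ℝ => c + a • v) v a := by
      simpa using ((hasDerivAt_id a).smul_const v).const_add c
    exact ((hsm a haa).differentiableAt (by simp)).hasFDerivAt.comp_hasDerivAt a h1
  have hcont : ContinuousOn (fun a : ℝ => fderiv ℝ g (c + a • v) v) (Set.Iic a₀) := by
    intro a haa
    have h1 : ContinuousAt (fderiv ℝ g) (c + a • v) :=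
      ((hsm a haa).fderiv_right (m := 0) (by simp)).continuousAt
    exact ((h1.comp (f := fun a : ℝ => c + a • v) hline.continuousAt).clm_apply
      continuousAt_const).continuousWithinAt
  have hint : IntegrableOn (fun a : ℝ => fderiv ℝ g (c + a • v) v) (Set.Iic a₀) := by
    have h1 : IntegrableOn (fun a : ℝ => fderiv ℝ g (c + a • v) v)
        (Set.Icc (-(R + ‖c‖)) a₀) :=
      (hcont.mono Set.Icc_subset_Iic_self).integrableOn_compact isCompact_Icc
    have h2 : IntegrableOn (fun a : ℝ => fderiv ℝ g (c + a • v) v) (Set.Iio (-(R + ‖c‖))) := by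
      refine (integrableOn_zero (ε' := E)).congr_fun (fun a haa => ?_) measurableSet_Iio
      rw [fderiv_of_notMem_tsupport ℝ (hzero a haa)]
      rfl
    refine (h2.union h1).mono_set fun a haa => ?_
    rcases lt_or_ge a (-(R + ‖c‖)) with h | h
    · exact Or.inl h
    · exact Or.inr ⟨h, haa⟩
  have hlim : Tendsto (fun a : ℝ => g (c + a • v)) atBot (𝓝 0) := by
    refine tendsto_const_nhds.congr' ?_
    filter_upwards [eventually_lt_atBot (-(R + ‖c‖))] with a haa
    exact (image_eq_zero_of_notMem_tsupport (hzero a haa)).symm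
  rw [integral_Iic_of_hasDerivAt_of_tendsto' hder hint hlim, sub_zero]

/-- Fubini's theorem in the orthonormal frame `v`, `i v`. -/
theorem integral_eq_integral_integral_frame {E : Type*} [NormedAddCommGroup E] [NormedSpace ℝ E]
    {F : ℂ → E} (hF : Integrable F) {v : ℂ} (hv : ‖v‖ = 1) :
    ∫ ζ, F ζ = ∫ x : ℝ, ∫ a : ℝ, F (x * Complex.I * v + a • v) := by
  have hrot : MeasurePreserving (rotation (⟨v, by simp [Submonoid.unitSphere, hv]⟩ : Circle))
      (volume : Measure ℂ) volume := LinearIsometryEquiv.measurePreserving _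
  have hF' : Integrable (fun ζ : ℂ => F (v * ζ)) := hrot.integrable_comp_emb
    (rotation _).toHomeomorph.measurableEmbedding |>.2 hF
  have h1 : ∫ ζ : ℂ, F (v * ζ) = ∫ ζ, F ζ :=
    hrot.integral_comp (rotation _).toHomeomorph.measurableEmbedding F
  have hvol := Complex.volume_preserving_equiv_real_prod.symm
  rw [← h1, ← hvol.integral_comp' (g := fun ζ => F (v * ζ))]
  rw [Measure.volume_eq_prod, integral_prod_symm]
  · refine integral_congr_ae (ae_of_all _ fun x => integral_congr_ae (ae_of_all _ fun a => ?_))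
    simp only [Complex.measurableEquivRealProd_symm_apply, Complex.real_smul]
    congr 1
    rw [Complex.mk_eq_add_mul_I]
    ring
  · exact hvol.integrable_comp_emb (Complex.measurableEquivRealProd.symm.measurableEmbedding) |>.2 hF'

theorem ContinuousOn.integrableOn_of_closure {E : Type*} [NormedAddCommGroup E] {Ω : Set ℂ}
    (hΩ : Bornology.IsBounded Ω) {F : ℂ → E} (hF : ContinuousOn F (closure Ω)) :
    IntegrableOn F Ω :=
  (hF.integrableOn_compact hΩ.isCompact_closure).mono_set subset_closure

theorem continuousOn_fderiv_of_contDiffAt {E : Type*} [NormedAddCommGroup E] [NormedSpace ℝ E]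
    {g : ℂ → E} {K : Set ℂ} (hg : ∀ ζ ∈ K, ContDiffAt ℝ 1 g ζ) :
    ContinuousOn (fderiv ℝ g) K := fun ζ hζ =>
  ((hg ζ hζ).fderiv_right (m := 0) (by simp)).continuousAt.continuousWithinAt

open scoped ComplexConjugate in
-- Fubini in the frame `v`, `i v` reduces the area integral to lines in the direction `v`. A line
-- crosses the patch at most once, with `Ω` on the lower side, so the fundamental theorem of
-- calculus leaves a single boundary value or nothing. The density `⟪n, v⟫` converts the transverse
-- Lebesgue measure into arc length.
theorem IsBoundaryPatch.setIntegral_fderiv {E : Type*} [NormedAddCommGroup E] [NormedSpace ℝ E]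
    [CompleteSpace E] {Ω : Set ℂ} {p v : ℂ} {r : ℝ} {ρ : ℂ → ℝ} (h : IsBoundaryPatch Ω p r ρ v)
    (hΩ : Bornology.IsBounded Ω) {g : ℂ → E} (hg : ∀ ζ ∈ closure Ω, ContDiffAt ℝ 1 g ζ)
    (hs : tsupport g ⊆ Metric.ball p r) :
    ∫ ζ in Ω, fderiv ℝ g ζ v = ∫ σ : frontier Ω, ⟪outwardNormal Ω σ, v⟫ • g σ ∂(arcLength Ω) := by
  classical
  have hsb : Bornology.IsBounded (tsupport g) := Metric.isBounded_ball.subset hs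
  have hvv : v * conj v = 1 := by rw [Complex.mul_conj']; simp [h.norm_eq]
  have hcoord : ∀ x a : ℝ, (x * Complex.I * v + a • v) * conj v = a + x * Complex.I := by
    intro x a
    rw [Complex.real_smul]
    linear_combination (x * Complex.I + a) * hvv
  have him : ∀ x a : ℝ, ((x * Complex.I * v + a • v) * conj v).im = x := by
    intro x a; rw [hcoord]; simp
  have hint : IntegrableOn (fun ζ => fderiv ℝ g ζ v) Ω :=
    ((continuousOn_fderiv_of_contDiffAt hg).clm_apply continuousOn_const).integrableOn_of_closure hΩ
  set F : ℂ → E := Ω.indicator fun ζ => fderiv ℝ g ζ v with hF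
  have hFint : Integrable F := (integrable_indicator_iff h.isOpen.measurableSet).2 hint
  have hF0 : ∀ ζ ∉ Metric.ball p r, F ζ = 0 := by
    intro ζ hζ
    have : fderiv ℝ g ζ v = 0 := by
      rw [fderiv_of_notMem_tsupport ℝ fun h => hζ (hs h)]; rfl
    simp only [hF, Set.indicator_apply, this, ite_self]
  -- the fibre integral vanishes on lines that miss the boundary
  have hmiss : ∀ x ∉ (fun z : ℂ => (z * conj v).im) '' (frontier Ω ∩ Metric.ball p r),
      ∫ a : ℝ, F (x * Complex.I * v + a • v) = 0 := by
    intro x hx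
    have hlin : IsLinearMap ℝ fun z : ℂ => (z * conj v).im :=
      ⟨fun a b => by rw [add_mul, Complex.add_im], fun c a => by
        rw [smul_mul_assoc, Complex.smul_im]⟩
    have hpre : IsPreconnected (Metric.ball p r ∩ {z : ℂ | (z * conj v).im = x}) :=
      ((convex_ball p r).inter (convex_hyperplane hlin x)).isPreconnected
    have hcov : Metric.ball p r ∩ {z : ℂ | (z * conj v).im = x} ⊆ Ω ∪ (closure Ω)ᶜ := by
      intro z hz
      by_contra hz'
      rw [Set.mem_union, not_or, Set.notMem_compl_iff] at hz'
      exact hx ⟨z, ⟨by rw [h.isOpen.frontier_eq]; exact ⟨hz'.2, hz'.1⟩, hz.1⟩, hz.2⟩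
    -- The chord of the ball is connected and avoids the boundary, so it lies in `Ω` or in the
    -- exterior. In the first case the integral runs to `a₀ + 1`, a point beyond the support.
    rcases hpre.subset_or_subset h.isOpen isClosed_closure.isOpen_compl
      (disjoint_compl_right.mono_left subset_closure) hcov with hin | hout
    · obtain ⟨R, hR⟩ := hsb.subset_closedBall 0
      set a₀ := R + ‖x * Complex.I * v‖ with ha₀
      have hbig : ∀ a > a₀, x * Complex.I * v + a • v ∉ tsupport g := by
        intro a haR hmem
        have h1 : ‖x * Complex.I * v + a • v‖ ≤ R := by simpa using hR hmem
        have h2 : ‖a • v‖ ≤ ‖x * Complex.I * v + a • v‖ + ‖x * Complex.I * v‖ := by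
          simpa using norm_sub_le (x * Complex.I * v + a • v) (x * Complex.I * v)
        rw [norm_smul, h.norm_eq, mul_one, Real.norm_eq_abs] at h2
        linarith [le_abs_self a]
      have hmem : ∀ a : ℝ, x * Complex.I * v + a • v ∈ tsupport g →
          x * Complex.I * v + a • v ∈ Ω := fun a ha => hin ⟨hs ha, him x a⟩
      have hb : x * Complex.I * v + (a₀ + 1) • v ∉ tsupport g := hbig _ (by linarith)
      have h3 := integral_Iic_fderiv_line (c := x * Complex.I * v) (a₀ := a₀ + 1) hg hsb h.norm_eq
        fun a _ ha => subset_closure (hmem a ha)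
      rw [image_eq_zero_of_notMem_tsupport hb] at h3
      rw [← h3, ← integral_indicator measurableSet_Iic]
      refine integral_congr_ae (ae_of_all _ fun a => ?_)
      simp only [hF, Set.indicator_apply, Set.mem_Iic]
      by_cases hm : x * Complex.I * v + a • v ∈ tsupport g
      · rw [if_pos (hmem a hm), if_pos]
        by_contra! hlt
        exact hbig a (by linarith) hm
      · rw [fderiv_of_notMem_tsupport ℝ hm, zero_apply, ite_self, ite_self]
    · have : ∀ a : ℝ, F (x * Complex.I * v + a • v) = 0 := by
        intro a
        by_cases hb : x * Complex.I * v + a • v ∈ Metric.ball p r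
        · have := hout ⟨hb, him x a⟩
          exact Set.indicator_of_notMem (fun hm => this (subset_closure hm)) _
        · exact hF0 _ hb
      simp only [this, integral_zero]
  -- on the other lines it is the boundary value
  have hhit : ∀ σ ∈ frontier Ω ∩ Metric.ball p r,
      g σ = ∫ a : ℝ, F (((σ * conj v).im : ℝ) * Complex.I * v + a • v) := by
    intro σ hσ
    set x := (σ * conj v).im with hx
    set a₀ := (σ * conj v).re with ha₀
    have hσeq : σ = x * Complex.I * v + a₀ • v := by
      rw [Complex.real_smul]
      linear_combination h.self_eq σ
    have hstep : ∀ a : ℝ, x * Complex.I * v + a • v = σ + (a - a₀) • v := by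
      intro a
      conv_rhs => rw [hσeq]
      module
    have hback : ∀ a : ℝ, σ = (x * Complex.I * v + a • v) + (a₀ - a) • v := by
      intro a
      conv_lhs => rw [hσeq]
      module
    have hρσ := h.apply_eq_zero hσ.2 hσ.1
    have hσΩ : σ ∉ Ω := by rw [h.mem_iff hσ.2, hρσ]; exact lt_irrefl 0
    have hball : ∀ a : ℝ, x * Complex.I * v + a • v ∈ Metric.ball p r →
        (x * Complex.I * v + a • v ∈ Ω ↔ a < a₀) := by
      intro a hab
      rcases lt_trichotomy a a₀ with hlt | heq | hgt
      · have := h.apply_lt hab (sub_pos.2 hlt) (by rw [← hback a]; exact hσ.2)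
        rw [← hback a, hρσ] at this
        exact iff_of_true ((h.mem_iff hab).2 this) hlt
      · subst heq
        rw [← hσeq]
        exact iff_of_false hσΩ (lt_irrefl _)
      · have := h.apply_lt hσ.2 (sub_pos.2 hgt) (by rw [← hstep a]; exact hab)
        rw [← hstep a, hρσ] at this
        exact iff_of_false (fun hm => ((h.mem_iff hab).1 hm).not_gt this) hgt.not_gt
    have h3 := integral_Iic_fderiv_line (c := x * Complex.I * v) (a₀ := a₀) hg hsb h.norm_eq
      fun a haa ha => by
        rcases haa.lt_or_eq with hlt | heq
        · exact subset_closure ((hball a (hs ha)).2 hlt)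
        · rw [heq, ← hσeq]; exact hσ.1.1
    rw [← hσeq] at h3
    rw [← h3, integral_Iic_eq_integral_Iio, ← integral_indicator measurableSet_Iio]
    refine integral_congr_ae (ae_of_all _ fun a => ?_)
    by_cases hab : x * Complex.I * v + a • v ∈ Metric.ball p r
    · simp only [hF, Set.indicator_apply, Set.mem_Iio, hball a hab]
    · change _ = F _
      rw [hF0 _ hab, Set.indicator_apply, fderiv_of_notMem_tsupport ℝ fun hm => hab (hs hm),
        zero_apply, ite_self]
  rw [← integral_indicator h.isOpen.measurableSet, ← hF,
    integral_eq_integral_integral_frame hFint h.norm_eq,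
    integral_arcLength fun σ => ⟪outwardNormal Ω σ, v⟫ • g σ,
    setIntegral_eq_of_subset_of_forall_sdiff_eq_zero isClosed_frontier.measurableSet
      (Set.inter_subset_left (t := Metric.ball p r)),
    h.setIntegral_inner_smul
      (G := fun x : ℝ => ∫ a : ℝ, F (x * Complex.I * v + a • v)) hhit]
  · refine (setIntegral_eq_integral_of_forall_compl_eq_zero hmiss).symm
  · intro σ hσ
    have : σ ∉ tsupport g := fun hm => hσ.2 ⟨hσ.1, hs hm⟩
    rw [image_eq_zero_of_notMem_tsupport this, smul_zero]

/-! ### Green's theorem -/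

/-- The operator `∂ₓ + i ∂ᵧ`, twice the Cauchy-Riemann operator. -/
noncomputable def dbar {E : Type*} [NormedAddCommGroup E] [NormedSpace ℂ E] (g : ℂ → E) (ζ : ℂ) : E :=
  fderiv ℝ g ζ 1 + Complex.I • fderiv ℝ g ζ Complex.I

section Green

variable {E : Type*} [NormedAddCommGroup E] [NormedSpace ℂ E]

theorem dbar_smul_of_differentiableAt {χ : ℂ → ℂ} {h : ℂ → E} {ζ : ℂ}
    (hχ : DifferentiableAt ℝ χ ζ) (hh : DifferentiableAt ℂ h ζ) :
    dbar (fun ζ => χ ζ • h ζ) ζ = dbar χ ζ • h ζ := by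
  have h1 : HasFDerivAt h ((fderiv ℂ h ζ).restrictScalars ℝ) ζ :=
    hh.hasFDerivAt.restrictScalars ℝ
  have h2 := (hχ.hasFDerivAt.smul h1).fderiv
  have h3 : fderiv ℂ h ζ Complex.I = Complex.I • fderiv ℂ h ζ 1 := by
    rw [← map_smul, smul_eq_mul, mul_one]
  unfold dbar
  change fderiv ℝ (χ • h) ζ 1 + Complex.I • fderiv ℝ (χ • h) ζ Complex.I = _
  rw [h2]
  simp only [add_apply, FunLike.coe_smul, Pi.smul_apply,
    ContinuousLinearMap.coe_restrictScalars', ContinuousLinearMap.smulRight_apply, h3, smul_add,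
    smul_smul, add_smul]
  have : Complex.I * (χ ζ * Complex.I) = -χ ζ := by
    linear_combination χ ζ * Complex.I_mul_I
  rw [this, neg_smul, smul_eq_mul]
  abel

theorem dbar_congr {g g' : ℂ → E} {ζ : ℂ} (h : g =ᶠ[𝓝 ζ] g') : dbar g ζ = dbar g' ζ := by
  unfold dbar
  rw [h.fderiv_eq]

theorem dbar_of_notMem_tsupport {g : ℂ → E} {ζ : ℂ} (h : ζ ∉ tsupport g) : dbar g ζ = 0 := by
  unfold dbar
  rw [fderiv_of_notMem_tsupport ℝ h]
  simp

theorem ContinuousOn.dbar {g : ℂ → E} {K : Set ℂ} (hg : ∀ ζ ∈ K, ContDiffAt ℝ 1 g ζ) :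
    ContinuousOn (dbar g) K := by
  have h := continuousOn_fderiv_of_contDiffAt hg
  exact (h.clm_apply continuousOn_const).add
    ((h.clm_apply continuousOn_const).const_smul Complex.I)

theorem ContDiff.continuous_dbar {g : ℂ → E} (hg : ContDiff ℝ 1 g) : Continuous (dbar g) := by
  rw [← continuousOn_univ]
  exact ContinuousOn.dbar fun ζ _ => hg.contDiffAt

/-- The divergence theorem in one direction has to be applied in two independent ones. The second is
the normal `m` turned by the 3-4-5 angle: still a unit vector, with positive component `3/5` along
the normal, so `ρ` increases along it too. -/
theorem IsSmoothlyBounded.exists_patches {Ω : Set ℂ} (hΩ : IsSmoothlyBounded Ω) {p : ℂ}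
    (hp : p ∈ frontier Ω) : ∃ R > 0, ∃ ρ : ℂ → ℝ, ∃ m : ℂ, ‖m‖ = 1 ∧ ∀ r ≤ R,
      IsBoundaryPatch Ω p r ρ m ∧ IsBoundaryPatch Ω p r ρ (m * (3 / 5 + 4 / 5 * Complex.I)) := by
  obtain ⟨ρ, h⟩ := hΩ.exists_defining p hp
  have hn1 := hΩ.norm_outwardNormal hp
  have hg := norm_pos_iff.2 h.gradient_ne_zero
  have hin : ∀ u, fderiv ℝ ρ p u = ‖gradient ρ p‖ * ⟪outwardNormal Ω p, u⟫ := by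
    intro u
    rw [← IsLocalDefiningFunction.inner_gradient, outwardNormal_eq hΩ.isOpen hp h,
      real_inner_smul_left]
    field_simp
  have hmn : (starRingEnd ℂ) (outwardNormal Ω p) * outwardNormal Ω p = 1 := by
    rw [Complex.conj_mul', hn1]; simp
  have hv1 : 0 < fderiv ℝ ρ p (outwardNormal Ω p) := by
    rw [hin, real_inner_self_eq_norm_sq, hn1]; positivity
  have hv2 : 0 < fderiv ℝ ρ p (outwardNormal Ω p * (3 / 5 + 4 / 5 * Complex.I)) := by
    rw [hin, Complex.inner]
    have : (outwardNormal Ω p * (3 / 5 + 4 / 5 * Complex.I)) *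
        (starRingEnd ℂ) (outwardNormal Ω p) = ((3 / 5 : ℝ) : ℂ) + ((4 / 5 : ℝ) : ℂ) * Complex.I := by
      push_cast
      linear_combination (3 / 5 + 4 / 5 * Complex.I) * hmn
    rw [this, Complex.add_re, Complex.re_ofReal_mul, Complex.I_re, Complex.ofReal_re]
    positivity
  have hn2 : ‖outwardNormal Ω p * (3 / 5 + 4 / 5 * Complex.I)‖ = 1 := by
    rw [norm_mul, hn1, one_mul]
    have : (3 / 5 + 4 / 5 * Complex.I : ℂ) = ((3 / 5 : ℝ) : ℂ) + ((4 / 5 : ℝ) : ℂ) * Complex.I := by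
      push_cast; ring
    rw [this, Complex.norm_add_mul_I]
    norm_num
  obtain ⟨R₁, hR₁, P₁⟩ := h.exists_isBoundaryPatch hΩ.isOpen hn1 hv1
  obtain ⟨R₂, hR₂, P₂⟩ := h.exists_isBoundaryPatch hΩ.isOpen hn2 hv2
  exact ⟨min R₁ R₂, lt_min hR₁ hR₂, ρ, _, hn1, fun r hr =>
    ⟨P₁ r (hr.trans (min_le_left _ _)), P₂ r (hr.trans (min_le_right _ _))⟩⟩

theorem continuous_comp_val {Ω : Set ℂ} {g : ℂ → E} (hg : ∀ ζ ∈ closure Ω, ContDiffAt ℝ 1 g ζ) :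
    Continuous fun σ : frontier Ω => g σ :=
  continuous_iff_continuousAt.2 fun σ =>
    ((hg σ σ.2.1).continuousAt).comp continuous_subtype_val.continuousAt

theorem inner_smul_add_I_smul (n : ℂ) (x : E) :
    ⟪n, (1 : ℂ)⟫ • x + Complex.I • ⟪n, Complex.I⟫ • x = n • x := by
  rw [Complex.inner, Complex.inner, ← Complex.coe_smul, ← Complex.coe_smul, smul_smul, ← add_smul]
  congr 1
  simp [mul_comm Complex.I, Complex.re_add_im]

theorem setIntegral_dbar_eq_of_setIntegral_fderiv_eq [CompleteSpace E] {Ω : Set ℂ}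
    (hΩ : IsSmoothlyBounded Ω) {g : ℂ → E}
    (hg : ∀ ζ ∈ closure Ω, ContDiffAt ℝ 1 g ζ)
    (h : ∀ v, ∫ ζ in Ω, fderiv ℝ g ζ v =
      ∫ σ : frontier Ω, ⟪outwardNormal Ω σ, v⟫ • g σ ∂(arcLength Ω)) :
    ∫ ζ in Ω, dbar g ζ = ∫ σ : frontier Ω, outwardNormal Ω σ • g σ ∂(arcLength Ω) := by
  have hint1 : ∀ v, IntegrableOn (fun ζ => fderiv ℝ g ζ v) Ω := fun v =>
    ((continuousOn_fderiv_of_contDiffAt hg).clm_apply continuousOn_const).integrableOn_of_closure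
      hΩ.isBounded
  have hint2 : ∀ v, Integrable (fun σ : frontier Ω => ⟪outwardNormal Ω σ, v⟫ • g σ)
      (arcLength Ω) := fun v => hΩ.integrable_of_continuous
    ((Continuous.inner (𝕜 := ℝ) hΩ.continuous_outwardNormal continuous_const).smul
      (continuous_comp_val hg))
  have e1 : ∫ ζ in Ω, dbar g ζ =
      (∫ ζ in Ω, fderiv ℝ g ζ 1) + Complex.I • ∫ ζ in Ω, fderiv ℝ g ζ Complex.I := by
    rw [← integral_smul]
    exact integral_add (hint1 1) ((hint1 _).smul Complex.I)
  rw [e1, h, h, ← integral_smul]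
  refine (integral_add (hint2 1) ((hint2 _).smul Complex.I)).symm.trans ?_
  simp only [Pi.smul_apply, inner_smul_add_I_smul]

theorem setIntegral_dbar_of_patches [CompleteSpace E] {Ω : Set ℂ} (hΩ : IsSmoothlyBounded Ω) {p m : ℂ} {r : ℝ}
    {ρ : ℂ → ℝ} (h1 : IsBoundaryPatch Ω p r ρ m)
    (h2 : IsBoundaryPatch Ω p r ρ (m * (3 / 5 + 4 / 5 * Complex.I))) {g : ℂ → E}
    (hg : ∀ ζ ∈ closure Ω, ContDiffAt ℝ 1 g ζ) (hs : tsupport g ⊆ Metric.ball p r) :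
    ∫ ζ in Ω, dbar g ζ = ∫ σ : frontier Ω, outwardNormal Ω σ • g σ ∂(arcLength Ω) := by
  have hint1 : ∀ v, IntegrableOn (fun ζ => fderiv ℝ g ζ v) Ω := fun v =>
    ((continuousOn_fderiv_of_contDiffAt hg).clm_apply continuousOn_const).integrableOn_of_closure
      hΩ.isBounded
  have hint2 : ∀ v, Integrable (fun σ : frontier Ω => ⟪outwardNormal Ω σ, v⟫ • g σ)
      (arcLength Ω) := fun v => hΩ.integrable_of_continuous
    ((Continuous.inner (𝕜 := ℝ) hΩ.continuous_outwardNormal continuous_const).smul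
      (continuous_comp_val hg))
  -- The directions in which the divergence formula holds form a real subspace; two independent
  -- elements make it all of `ℂ`.
  let V : Submodule ℝ ℂ :=
    { carrier := {v | ∫ ζ in Ω, fderiv ℝ g ζ v =
        ∫ σ : frontier Ω, ⟪outwardNormal Ω σ, v⟫ • g σ ∂(arcLength Ω)}
      zero_mem' := by simp
      add_mem' := by
        intro a b ha hb
        simp only [Set.mem_ofPred_eq, map_add, inner_add_right, add_smul] at ha hb ⊢
        rw [integral_add (hint1 a) (hint1 b), integral_add (hint2 a) (hint2 b), ha, hb]
      smul_mem' := by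
        intro c a ha
        simp only [Set.mem_ofPred_eq, map_smul, inner_smul_right, mul_smul] at ha ⊢
        rw [integral_smul, ha, ← integral_smul] }
  have e1 : m ∈ V := h1.setIntegral_fderiv hΩ.isBounded hg hs
  have e2 : m * (3 / 5 + 4 / 5 * Complex.I) ∈ V := h2.setIntegral_fderiv hΩ.isBounded hg hs
  have e3 : m * Complex.I ∈ V := by
    -- `(5/4)(3/5 + (4/5) i) - 3/4 = i`.
    have := V.sub_mem (V.smul_mem (5 / 4 : ℝ) e2) (V.smul_mem (3 / 4 : ℝ) e1)
    convert this using 1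
    rw [Complex.real_smul, Complex.real_smul]
    push_cast
    ring
  refine setIntegral_dbar_eq_of_setIntegral_fderiv_eq hΩ hg fun v => ?_
  have hmm : (starRingEnd ℂ) m * m = 1 := by rw [Complex.conj_mul', h1.norm_eq]; simp
  have : v = ((starRingEnd ℂ) m * v).re • m + ((starRingEnd ℂ) m * v).im • (m * Complex.I) := by
    rw [Complex.real_smul, Complex.real_smul]
    linear_combination -v * hmm - m * Complex.re_add_im ((starRingEnd ℂ) m * v)
  have hv : v ∈ V := by
    rw [this]
    exact V.add_mem (V.smul_mem _ e1) (V.smul_mem _ e3)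
  exact hv

theorem setIntegral_dbar_of_tsupport_subset [CompleteSpace E] {Ω : Set ℂ} (hΩ : IsSmoothlyBounded Ω)
    {g : ℂ → E} (hg : ∀ ζ ∈ closure Ω, ContDiffAt ℝ 1 g ζ) (hs : tsupport g ⊆ Ω) :
    ∫ ζ in Ω, dbar g ζ = ∫ σ : frontier Ω, outwardNormal Ω σ • g σ ∂(arcLength Ω) := by
  have hg' : ContDiff ℝ 1 g := contDiff_iff_contDiffAt.2 fun ζ => by
    by_cases h : ζ ∈ tsupport g
    · exact hg ζ (subset_closure (hs h))
    · exact contDiffAt_const.congr_of_eventuallyEq (notMem_tsupport_iff_eventuallyEq.1 h)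
  have hcs : HasCompactSupport g := hΩ.isCompact_closure.of_isClosed_subset (isClosed_tsupport g)
    (hs.trans subset_closure)
  refine setIntegral_dbar_eq_of_setIntegral_fderiv_eq hΩ hg fun v => ?_
  have hdz : ∀ ζ ∉ Ω, fderiv ℝ g ζ v = 0 := fun ζ hζ => by
    rw [fderiv_of_notMem_tsupport ℝ fun h => hζ (hs h)]; rfl
  rw [setIntegral_eq_integral_of_forall_compl_eq_zero hdz]
  have hR : ∀ σ : frontier Ω, ⟪outwardNormal Ω σ, v⟫ • g σ = 0 := fun σ => by
    have : (σ : ℂ) ∉ Ω := (hΩ.isOpen.frontier_eq ▸ σ.2 : (σ : ℂ) ∈ closure Ω \ Ω).2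
    rw [image_eq_zero_of_notMem_tsupport fun h => this (hs h), smul_zero]
  simp only [hR, integral_zero]
  have hfi : Integrable fun ζ => fderiv ℝ g ζ v :=
    ((hg'.continuous_fderiv (by simp)).clm_apply continuous_const).integrable_of_hasCompactSupport
      (hcs.fderiv_apply (𝕜 := ℝ) v)
  -- Integration by parts against the constant 1: the derivative of a compactly supported function
  -- has integral zero.
  have := integral_smul_fderiv_eq_neg_fderiv_smul_of_integrable (μ := (volume : Measure ℂ))
    (f := fun _ : ℂ => (1 : ℝ)) (g := g) (v := v) (by simp) (by simpa using hfi)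
    (by simpa using hg'.continuous.integrable_of_hasCompactSupport hcs)
    (fun x _ => by fun_prop) (fun x _ => (hg'.differentiable (by simp)) x)
  simpa using this

end Green

/-! ### Green's theorem for functions that are only continuous up to the boundary. -/

section Green

variable {E : Type*} [NormedAddCommGroup E] [NormedSpace ℂ E]

theorem smul_eventuallyEq_zero {χ : ℂ → ℂ} {f : ℂ → E} {ζ : ℂ} (h : ζ ∉ tsupport χ) :
    (fun ζ => χ ζ • f ζ) =ᶠ[𝓝 ζ] fun _ => 0 := by
  filter_upwards [notMem_tsupport_iff_eventuallyEq.1 h] with w hw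
  simp [hw]

theorem contDiffAt_smul_of_tsupport {χ : ℂ → ℂ} {f : ℂ → E} {ζ : ℂ} (hχ : ContDiff ℝ 1 χ)
    (h : ζ ∈ tsupport χ → ContDiffAt ℝ 1 f ζ) : ContDiffAt ℝ 1 (fun ζ => χ ζ • f ζ) ζ := by
  by_cases hζ : ζ ∈ tsupport χ
  · exact hχ.contDiffAt.smul (h hζ)
  · exact contDiffAt_const.congr_of_eventuallyEq (smul_eventuallyEq_zero hζ)

theorem dbar_smul_of_tsupport {χ : ℂ → ℂ} {f : ℂ → E} {ζ : ℂ} (hχ : ContDiff ℝ 1 χ)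
    (h : ζ ∈ tsupport χ → DifferentiableAt ℂ f ζ) :
    dbar (fun ζ => χ ζ • f ζ) ζ = dbar χ ζ • f ζ := by
  by_cases hζ : ζ ∈ tsupport χ
  · exact dbar_smul_of_differentiableAt (hχ.differentiable (by simp) ζ) (h hζ)
  · rw [dbar_congr (smul_eventuallyEq_zero hζ), dbar_of_notMem_tsupport hζ, zero_smul]
    simp [dbar]

theorem DifferentiableOn.contDiffAt_real [CompleteSpace E] {f : ℂ → E} {s : Set ℂ}
    (hf : DifferentiableOn ℂ f s) (hs : IsOpen s) {ζ : ℂ} (hζ : ζ ∈ s) : ContDiffAt ℝ 1 f ζ :=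
  ((hf.analyticAt (hs.mem_nhds hζ)).contDiffAt (n := 1)).restrict_scalars ℝ

theorem tsupport_smul_subset_of_left {χ : ℂ → ℂ} {f : ℂ → E} {s : Set ℂ} (h : tsupport χ ⊆ s) :
    tsupport (fun ζ => χ ζ • f ζ) ⊆ s :=
  (closure_mono (Function.support_smul_subset_left χ f)).trans h

theorem continuousOn_smul_of_forall_notMem {K T U : Set ℂ} (hT : IsClosed T) (hU : IsOpen U)
    (hTU : T ⊆ U) {f : ℂ → E} (hf : ContinuousOn f (K ∩ U)) {κ : ℂ → ℂ} (hκ : ContinuousOn κ K)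
    (h0 : ∀ ζ ∉ T, κ ζ = 0) : ContinuousOn (fun ζ => κ ζ • f ζ) K := by
  intro ζ hζ
  by_cases h : ζ ∈ T
  · have h1 : ContinuousWithinAt f K ζ :=
      (continuousWithinAt_inter (hU.mem_nhds (hTU h))).1 (hf ζ ⟨hζ, hTU h⟩)
    exact (hκ ζ hζ).smul h1
  · refine ContinuousAt.continuousWithinAt ((continuousAt_const (y := (0 : E))).congr ?_)
    filter_upwards [hT.isOpen_compl.mem_nhds h] with w hw
    rw [h0 w hw, zero_smul]

theorem exists_ball_green_of_mem [CompleteSpace E] {Ω : Set ℂ} (hΩ : IsSmoothlyBounded Ω)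
    {U : Set ℂ} (hU : IsOpen U) {f : ℂ → E} (hf : DifferentiableOn ℂ f (Ω ∩ U)) {p : ℂ}
    (hp : p ∈ Ω) (hpU : p ∈ U) : ∃ r > 0, ∀ χ : ℂ → ℂ, ContDiff ℝ 1 χ →
      tsupport χ ⊆ Metric.ball p r →
        ∫ ζ in Ω, dbar χ ζ • f ζ =
          ∫ σ : frontier Ω, (χ σ * outwardNormal Ω σ) • f σ ∂(arcLength Ω) := by
  have hop := hΩ.isOpen.inter hU
  obtain ⟨r, hr, hb⟩ := Metric.isOpen_iff.1 hop p ⟨hp, hpU⟩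
  refine ⟨r, hr, fun χ hχ hs => ?_⟩
  have hs' := hs.trans hb
  have h1 := setIntegral_dbar_of_tsupport_subset hΩ (g := fun ζ => χ ζ • f ζ)
    (fun ζ _ => contDiffAt_smul_of_tsupport hχ fun h => hf.contDiffAt_real hop (hs' h))
    (tsupport_smul_subset_of_left (hs'.trans Set.inter_subset_left))
  simp only [dbar_smul_of_tsupport hχ fun h => (hf.differentiableAt (hop.mem_nhds (hs' h)))] at h1
  simpa only [smul_smul, mul_comm] using h1

theorem IsBoundaryPatch.sub_smul_mem {Ω : Set ℂ} {p m : ℂ} {r : ℝ} {ρ : ℂ → ℝ}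
    (h : IsBoundaryPatch Ω p r ρ m) {ζ : ℂ} (hζ : ζ ∈ closure Ω) (hb : ζ ∈ Metric.ball p r)
    {t : ℝ} (ht : 0 < t) (hbt : ζ - t • m ∈ Metric.ball p r) : ζ - t • m ∈ Ω := by
  have h1 : ρ ζ ≤ 0 := by
    by_cases hm : ζ ∈ Ω
    · exact ((h.mem_iff hb).1 hm).le
    · exact (h.apply_eq_zero hb (by rw [h.isOpen.frontier_eq]; exact ⟨hζ, hm⟩)).le
  rw [h.mem_iff hbt]
  have := h.apply_lt hbt ht (by simpa using hb)
  rw [sub_add_cancel] at this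
  linarith

/-- Since `f` need not be differentiable at the boundary, it is replaced by its translate `f(· - t
m)`, which samples `f` strictly inside `Ω` on the relevant support. Green's theorem holds for the
translates, and both sides converge as `t → 0⁺` by continuity and domination. -/
theorem exists_ball_green_of_mem_frontier [CompleteSpace E] {Ω : Set ℂ} (hΩ : IsSmoothlyBounded Ω)
    {U : Set ℂ} (hU : IsOpen U) {f : ℂ → E} (hfc : ContinuousOn f (closure Ω ∩ U))
    (hf : DifferentiableOn ℂ f (Ω ∩ U)) {p : ℂ}
    (hp : p ∈ frontier Ω) (hpU : p ∈ U) : ∃ r > 0, ∀ χ : ℂ → ℂ, ContDiff ℝ 1 χ →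
      tsupport χ ⊆ Metric.ball p r →
        ∫ ζ in Ω, dbar χ ζ • f ζ =
          ∫ σ : frontier Ω, (χ σ * outwardNormal Ω σ) • f σ ∂(arcLength Ω) := by
  have hop := hΩ.isOpen.inter hU
  obtain ⟨R₁, hR₁, ρ, m, hm, hpatch⟩ := hΩ.exists_patches hp
  obtain ⟨R₂, hR₂, hbU⟩ := Metric.isOpen_iff.1 hU p hpU
  set r := min R₁ R₂
  have hr : 0 < r := lt_min hR₁ hR₂
  obtain ⟨P1, P2⟩ := hpatch r (min_le_left _ _)
  replace hbU : Metric.ball p r ⊆ U := (Metric.ball_subset_ball (min_le_right _ _)).trans hbU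
  refine ⟨r, hr, fun χ hχ hs => ?_⟩
  -- The support fits in the smaller radius `r'`, and shifts shorter than `r'' - r'` stay in the
  -- closed ball of radius `r'' < r`. There `f` is bounded by compactness, which supplies the
  -- dominating constant `B`.
  obtain ⟨r', hr', hs'⟩ := exists_lt_subset_ball (isClosed_tsupport χ) hs
  set r'' := (r + r') / 2 with hr''
  have hr1 : r' < r'' := by rw [hr'']; linarith
  have hr2 : r'' < r := by rw [hr'']; linarith
  set Q := closure Ω ∩ Metric.closedBall p r''
  have hQc : IsCompact Q := hΩ.isCompact_closure.inter_right Metric.isClosed_closedBall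
  have hQU : Q ⊆ closure Ω ∩ U := fun z hz =>
    ⟨hz.1, hbU (Metric.closedBall_subset_ball hr2 hz.2)⟩
  obtain ⟨B, hB⟩ := hQc.exists_bound_of_continuousOn (hfc.mono hQU)
  have hshift : ∀ t ∈ Set.Ioo 0 (r'' - r'), ∀ ζ ∈ closure Ω, ζ ∈ tsupport χ →
      ζ - t • m ∈ Ω ∩ U ∧ ζ - t • m ∈ Q := by
    intro t ht ζ hζ hζs
    have hb : ζ ∈ Metric.ball p r' := hs' hζs
    have hb2 : ζ - t • m ∈ Metric.ball p r'' := by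
      rw [Metric.mem_ball] at hb ⊢
      have h1 : dist (ζ - t • m) ζ = t := by
        rw [dist_eq_norm, sub_sub_cancel_left, norm_neg, norm_smul, hm, mul_one,
          Real.norm_of_nonneg ht.1.le]
      linarith [dist_triangle (ζ - t • m) ζ p, ht.2]
    have hb3 := Metric.ball_subset_ball hr2.le hb2
    have := P1.sub_smul_mem hζ (Metric.ball_subset_ball hr'.le hb) ht.1 hb3
    exact ⟨⟨this, hbU hb3⟩, subset_closure this, Metric.ball_subset_closedBall hb2⟩
  have hg : ∀ t ∈ Set.Ioo 0 (r'' - r'), ∀ ζ ∈ closure Ω,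
      ContDiffAt ℝ 1 (fun ζ => χ ζ • f (ζ - t • m)) ζ := fun t ht ζ hζ =>
    contDiffAt_smul_of_tsupport hχ fun h =>
      (hf.contDiffAt_real hop (hshift t ht ζ hζ h).1).comp ζ (by fun_prop)
  have hgreen : ∀ t ∈ Set.Ioo 0 (r'' - r'),
      ∫ ζ in Ω, dbar χ ζ • f (ζ - t • m) =
        ∫ σ : frontier Ω, (χ σ * outwardNormal Ω σ) • f (σ - t • m) ∂(arcLength Ω) := by
    intro t ht
    have h1 := setIntegral_dbar_of_patches hΩ P1 P2 (hg t ht) (tsupport_smul_subset_of_left hs)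
    rw [setIntegral_congr_fun (g := fun ζ => dbar χ ζ • f (ζ - t • m)) hΩ.isOpen.measurableSet] at h1
    · simpa only [smul_smul, mul_comm] using h1
    · intro ζ hζ
      refine dbar_smul_of_tsupport hχ fun h => ?_
      have := hf.differentiableAt (hop.mem_nhds (hshift t ht ζ (subset_closure hζ) h).1)
      exact this.comp ζ (by fun_prop)
  have hev : ∀ᶠ t in 𝓝[>] (0 : ℝ), t ∈ Set.Ioo 0 (r'' - r') :=
    Ioo_mem_nhdsGT (by linarith)
  have hlim0 : ∀ ζ, Tendsto (fun t : ℝ => ζ - t • m) (𝓝[>] 0) (𝓝 ζ) := fun ζ => by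
    have : Continuous fun t : ℝ => ζ - t • m := by fun_prop
    exact tendsto_nhdsWithin_of_tendsto_nhds (by simpa using this.tendsto 0)
  have hptw : ∀ ζ ∈ closure Ω, ζ ∈ tsupport χ →
      Tendsto (fun t : ℝ => f (ζ - t • m)) (𝓝[>] 0) (𝓝 (f ζ)) := by
    intro ζ hζ hζs
    have h1 : ContinuousWithinAt f (closure Ω ∩ U) ζ := hfc ζ ⟨hζ, hbU (hs hζs)⟩
    refine h1.tendsto.comp (tendsto_nhdsWithin_iff.2 ⟨hlim0 ζ, ?_⟩)
    filter_upwards [hev] with t ht using hQU (hshift t ht ζ hζ hζs).2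
  have hbound : ∀ t ∈ Set.Ioo 0 (r'' - r'), ∀ ζ ∈ closure Ω, ζ ∈ tsupport χ →
      ‖f (ζ - t • m)‖ ≤ B := fun t ht ζ hζ hζs => hB _ (hshift t ht ζ hζ hζs).2
  have L1 : Tendsto (fun t : ℝ => ∫ ζ in Ω, dbar χ ζ • f (ζ - t • m)) (𝓝[>] 0)
      (𝓝 (∫ ζ in Ω, dbar χ ζ • f ζ)) := by
    refine tendsto_integral_filter_of_dominated_convergence (fun ζ => ‖dbar χ ζ‖ * B) ?_ ?_ ?_ ?_
    · filter_upwards [hev] with t ht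
      have hc : ContinuousOn (dbar fun ζ => χ ζ • f (ζ - t • m)) (closure Ω) :=
        ContinuousOn.dbar (hg t ht)
      refine ((hc.mono subset_closure).aestronglyMeasurable hΩ.isOpen.measurableSet).congr ?_
      filter_upwards [ae_restrict_mem hΩ.isOpen.measurableSet] with ζ hζ
      refine dbar_smul_of_tsupport hχ fun h => ?_
      have := hf.differentiableAt (hop.mem_nhds (hshift t ht ζ (subset_closure hζ) h).1)
      exact this.comp ζ (by fun_prop)
    · filter_upwards [hev] with t ht
      filter_upwards [ae_restrict_mem hΩ.isOpen.measurableSet] with ζ hζ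
      by_cases hζs : ζ ∈ tsupport χ
      · rw [norm_smul]
        gcongr
        exact hbound t ht ζ (subset_closure hζ) hζs
      · simp [dbar_of_notMem_tsupport hζs]
    · exact (hχ.continuous_dbar.norm.mul continuous_const).continuousOn.integrableOn_of_closure
        hΩ.isBounded
    · filter_upwards [ae_restrict_mem hΩ.isOpen.measurableSet] with ζ hζ
      by_cases hζs : ζ ∈ tsupport χ
      · exact (hptw ζ (subset_closure hζ) hζs).const_smul _
      · simp [dbar_of_notMem_tsupport hζs]
  have L2 : Tendsto (fun t : ℝ => ∫ σ : frontier Ω, (χ σ * outwardNormal Ω σ) • f (σ - t • m)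
      ∂(arcLength Ω)) (𝓝[>] 0)
      (𝓝 (∫ σ : frontier Ω, (χ σ * outwardNormal Ω σ) • f σ ∂(arcLength Ω))) := by
    have hχc : Continuous fun σ : frontier Ω => χ σ := hχ.continuous.comp continuous_subtype_val
    refine tendsto_integral_filter_of_dominated_convergence
      (fun σ => ‖χ σ * outwardNormal Ω σ‖ * B) ?_ ?_ ?_ ?_
    · filter_upwards [hev] with t ht
      have := (hΩ.integrable_of_continuous
        (hΩ.continuous_outwardNormal.smul (continuous_comp_val (hg t ht)))).aestronglyMeasurable
      refine this.congr (ae_of_all _ fun σ => ?_)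
      simp only [Pi.smul_apply', smul_smul, mul_comm]
    · filter_upwards [hev] with t ht
      refine ae_of_all _ fun σ => ?_
      by_cases hζs : (σ : ℂ) ∈ tsupport χ
      · rw [norm_smul]
        gcongr
        exact hbound t ht σ σ.2.1 hζs
      · simp [image_eq_zero_of_notMem_tsupport hζs]
    · exact hΩ.integrable_of_continuous
        ((hχc.mul hΩ.continuous_outwardNormal).norm.mul continuous_const)
    · refine ae_of_all _ fun σ => ?_
      by_cases hζs : (σ : ℂ) ∈ tsupport χ
      · exact (hptw σ σ.2.1 hζs).const_smul _
      · simp [image_eq_zero_of_notMem_tsupport hζs]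
  refine tendsto_nhds_unique (L1.congr' ?_) L2
  filter_upwards [hev] with t ht using hgreen t ht

/-- **Green's theorem** on a smoothly bounded domain, for the product of a smooth function and a
function that is holomorphic inside and continuous up to the boundary. -/
theorem green [CompleteSpace E] {Ω : Set ℂ} (hΩ : IsSmoothlyBounded Ω)
    {U : Set ℂ} (hU : IsOpen U) {f : ℂ → E} (hfc : ContinuousOn f (closure Ω ∩ U))
    (hf : DifferentiableOn ℂ f (Ω ∩ U)) {χ : ℂ → ℂ} (hχ : ContDiff ℝ 1 χ) (hs : tsupport χ ⊆ U) :
    ∫ ζ in Ω, dbar χ ζ • f ζ =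
      ∫ σ : frontier Ω, (χ σ * outwardNormal Ω σ) • f σ ∂(arcLength Ω) := by
  have hKc : IsCompact (closure Ω ∩ tsupport χ) :=
    hΩ.isCompact_closure.inter_right (isClosed_tsupport χ)
  have hloc : ∀ p ∈ closure Ω ∩ tsupport χ, ∃ r > 0, ∀ χ : ℂ → ℂ, ContDiff ℝ 1 χ →
      tsupport χ ⊆ Metric.ball p r →
        ∫ ζ in Ω, dbar χ ζ • f ζ =
          ∫ σ : frontier Ω, (χ σ * outwardNormal Ω σ) • f σ ∂(arcLength Ω) := by
    intro p hp
    by_cases hpΩ : p ∈ Ω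
    · exact exists_ball_green_of_mem hΩ hU hf hpΩ (hs hp.2)
    · exact exists_ball_green_of_mem_frontier hΩ hU hfc hf
        (by rw [hΩ.isOpen.frontier_eq]; exact ⟨hp.1, hpΩ⟩) (hs hp.2)
  choose! r hr hgreen using hloc
  obtain ⟨s, hsK, hcov⟩ := hKc.elim_nhds_subcover (fun p => Metric.ball p (r p))
    fun p hp => Metric.ball_mem_nhds p (hr p hp)
  obtain ⟨θ, hθ⟩ := SmoothPartitionOfUnity.exists_isSubordinate (modelWithCornersSelf ℝ ℂ)
    hKc.isClosed (fun p : s => Metric.ball (p : ℂ) (r p)) (fun _ => Metric.isOpen_ball)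
    (by simpa only [Set.iUnion_coe_set, SetLike.mem_coe, Set.iUnion_subtype] using hcov)
  let η : s → ℂ → ℂ := fun p ζ => (θ p ζ : ℂ) * χ ζ
  have hη : ∀ p, ContDiff ℝ 1 (η p) := fun p =>
    (Complex.ofRealCLM.contDiff.comp ((θ p).contMDiff.contDiff.of_le (by simp))).mul hχ
  have hts : ∀ p, tsupport (η p) ⊆ tsupport χ := fun p =>
    closure_mono (Function.support_mul_subset_right (fun ζ => (θ p ζ : ℂ)) χ)
  have hts' : ∀ p : s, tsupport (η p) ⊆ Metric.ball (p : ℂ) (r p) := fun p => by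
    refine (closure_mono fun ζ hζ => ?_).trans (hθ p)
    have : (θ p ζ : ℂ) ≠ 0 := left_ne_zero_of_mul hζ
    exact fun h => this (by rw [h]; simp)
  have hsum : ∀ ζ ∈ closure Ω, ∑ p, η p ζ = χ ζ := by
    intro ζ hζ
    by_cases h : ζ ∈ tsupport χ
    · have h1 := θ.sum_eq_one (x := ζ) ⟨hζ, h⟩
      rw [finsum_eq_sum_of_fintype] at h1
      simp only [η]
      rw [← Finset.sum_mul, ← Complex.ofReal_sum, h1, Complex.ofReal_one, one_mul]
    · simp [η, image_eq_zero_of_notMem_tsupport h]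
  -- The pieces sum to `χ` only on the closure of `Ω`; on the open set `Ω` this identity may be
  -- differentiated, and the boundary integral needs no derivative.
  have hdsum : ∀ ζ ∈ Ω, ∑ p, dbar (η p) ζ = dbar χ ζ := by
    intro ζ hζ
    have h1 : (fun ζ => ∑ p, η p ζ) =ᶠ[𝓝 ζ] χ := by
      filter_upwards [hΩ.isOpen.mem_nhds hζ] with w hw using hsum w (subset_closure hw)
    rw [← dbar_congr h1]
    unfold dbar
    rw [fderiv_fun_sum fun p _ => (hη p).differentiable (by simp) ζ]
    simp [Finset.sum_add_distrib, Finset.mul_sum]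
  have hκ : ∀ p : s, ContinuousOn (fun ζ => dbar (η p) ζ • f ζ) (closure Ω) := fun p =>
    continuousOn_smul_of_forall_notMem (isClosed_tsupport χ) hU hs hfc
      (hη p).continuous_dbar.continuousOn fun ζ hζ =>
        dbar_of_notMem_tsupport fun h => hζ (hts p h)
  have hμ : ∀ p : s, ContinuousOn (fun ζ => η p ζ • f ζ) (closure Ω) := fun p =>
    continuousOn_smul_of_forall_notMem (isClosed_tsupport χ) hU hs hfc
      (hη p).continuous.continuousOn fun ζ hζ =>
        image_eq_zero_of_notMem_tsupport fun h => hζ (hts p h)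
  have hμ' : ∀ p : s, Integrable
      (fun σ : frontier Ω => (η p σ * outwardNormal Ω σ) • f σ) (arcLength Ω) := fun p => by
    have h1 : Continuous fun σ : frontier Ω => η p σ • f σ :=
      (hμ p).comp_continuous continuous_subtype_val fun σ => σ.2.1
    refine (hΩ.integrable_of_continuous (hΩ.continuous_outwardNormal.smul h1)).congr
      (ae_of_all _ fun σ => ?_)
    simp only [Pi.smul_apply', smul_smul, mul_comm]
  calc ∫ ζ in Ω, dbar χ ζ • f ζ = ∫ ζ in Ω, ∑ p, dbar (η p) ζ • f ζ := by
        refine setIntegral_congr_fun hΩ.isOpen.measurableSet fun ζ hζ => ?_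
        simp only [← Finset.sum_smul, hdsum ζ hζ]
    _ = ∑ p, ∫ ζ in Ω, dbar (η p) ζ • f ζ :=
        integral_finsetSum _ fun p _ => (hκ p).integrableOn_of_closure hΩ.isBounded
    _ = ∑ p, ∫ σ : frontier Ω, (η p σ * outwardNormal Ω σ) • f σ ∂(arcLength Ω) :=
        Finset.sum_congr rfl fun p _ => hgreen p (hsK p p.2) (η p) (hη p) (hts' p)
    _ = ∫ σ : frontier Ω, ∑ p, (η p σ * outwardNormal Ω σ) • f σ ∂(arcLength Ω) :=
        (integral_finsetSum _ fun p _ => hμ' p).symm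
    _ = _ := by
        refine integral_congr_ae (ae_of_all _ fun σ => ?_)
        simp only [← Finset.sum_smul, ← Finset.sum_mul, hsum σ σ.2.1]

end Green

/-! ### The mass of the regularized Cauchy kernel -/

theorem integral_two_mul_inv_one_add_sq_sq :
    ∫ u : ℂ, 2 * ((1 + ‖u‖ ^ 2) ^ 2)⁻¹ = 2 * Real.pi := by
  have h1 := integral_fun_norm_addHaar (volume : Measure ℂ) fun r : ℝ => ((1 + r ^ 2) ^ 2)⁻¹
  have h2 : ∫ y in Set.Ioi (0 : ℝ), y ^ (Module.finrank ℝ ℂ - 1) • ((1 + y ^ 2) ^ 2)⁻¹ = 1 / 2 := by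
    have hd : ∀ y ∈ Set.Ici (0 : ℝ), HasDerivAt (fun y : ℝ => -(1 / 2) * (1 + y ^ 2)⁻¹)
        (y ^ (Module.finrank ℝ ℂ - 1) • ((1 + y ^ 2) ^ 2)⁻¹) y := by
      intro y _
      have h0 : (1 + y ^ 2) ≠ 0 := by positivity
      have := (((hasDerivAt_pow 2 y).const_add 1).inv h0).const_mul (-(1 / 2 : ℝ))
      refine this.congr_deriv ?_
      rw [Complex.finrank_real_complex, smul_eq_mul]
      field_simp
      norm_num
    have hlim : Tendsto (fun y : ℝ => -(1 / 2) * (1 + y ^ 2)⁻¹) atTop (𝓝 (-(1 / 2) * 0)) := by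
      refine Tendsto.const_mul _ (tendsto_inv_atTop_zero.comp ?_)
      exact tendsto_atTop_add_const_left _ _ (tendsto_pow_atTop (by norm_num))
    rw [integral_Ioi_of_hasDerivAt_of_nonneg' hd (fun y hy => ?_) hlim]
    · norm_num
    · have : (0 : ℝ) < y := hy
      positivity
  rw [h2] at h1
  rw [integral_const_mul, h1, Measure.real, Complex.volume_ball, Complex.finrank_real_complex]
  simp
  ring

theorem integrable_two_mul_inv_one_add_sq_sq :
    Integrable fun u : ℂ => 2 * ((1 + ‖u‖ ^ 2) ^ 2)⁻¹ := by
  have h := integrable_rpow_neg_one_add_norm_sq (E := ℂ) (μ := volume) (r := 4)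
    (by rw [Complex.finrank_real_complex]; norm_num)
  refine (h.const_mul 2).congr (ae_of_all _ fun u => ?_)
  have : (-4 / 2 : ℝ) = -((2 : ℕ) : ℝ) := by norm_num
  simp only [this]
  rw [Real.rpow_neg (by positivity), Real.rpow_natCast]

theorem dbar_mul {f g : ℂ → ℂ} {ζ : ℂ} (hf : DifferentiableAt ℝ f ζ)
    (hg : DifferentiableAt ℝ g ζ) :
    dbar (fun ζ => f ζ * g ζ) ζ = dbar f ζ * g ζ + f ζ * dbar g ζ := by
  unfold dbar
  rw [fderiv_fun_mul hf hg]
  simp only [add_apply, FunLike.coe_smul, Pi.smul_apply, smul_eq_mul]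
  ring

theorem dbar_sub_const (w ζ : ℂ) : dbar (fun ζ : ℂ => ζ - w) ζ = 0 := by
  unfold dbar
  rw [fderiv_sub_const]
  simp

open scoped ComplexConjugate in
theorem dbar_conj_sub_const (w ζ : ℂ) : dbar (fun ζ : ℂ => conj (ζ - w)) ζ = 2 := by
  have h : HasFDerivAt (fun ζ : ℂ => conj (ζ - w)) (Complex.conjCLE : ℂ →L[ℝ] ℂ) ζ := by
    simp only [map_sub]
    exact (Complex.conjCLE : ℂ →L[ℝ] ℂ).hasFDerivAt.sub_const (conj w)
  unfold dbar
  rw [h.fderiv]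
  simp only [ContinuousLinearEquiv.coe_coe, Complex.conjCLE_apply, map_one, Complex.conj_I,
    smul_eq_mul, mul_neg, Complex.I_mul_I, neg_neg]
  norm_num

open scoped ComplexConjugate in
/-- A smooth regularization of `ζ ↦ (ζ - w)⁻¹`. -/
noncomputable def cauchyRegularization (w : ℂ) (ε : ℝ) (ζ : ℂ) : ℂ :=
  conj (ζ - w) * ((ζ - w) * conj (ζ - w) + (ε : ℂ) ^ 2)⁻¹

open scoped ComplexConjugate in
theorem mul_conj_add_sq (z : ℂ) (ε : ℝ) :
    z * conj z + (ε : ℂ) ^ 2 = ((‖z‖ ^ 2 + ε ^ 2 : ℝ) : ℂ) := by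
  rw [Complex.mul_conj']; push_cast; ring

open scoped ComplexConjugate in
theorem mul_conj_add_sq_ne_zero (z : ℂ) {ε : ℝ} (hε : ε ≠ 0) :
    z * conj z + (ε : ℂ) ^ 2 ≠ 0 := by
  rw [mul_conj_add_sq, Complex.ofReal_ne_zero]
  positivity

theorem contDiff_cauchyRegularization (w : ℂ) {ε : ℝ} (hε : ε ≠ 0) :
    ContDiff ℝ 1 (cauchyRegularization w ε) := by
  have h1 : ContDiff ℝ 1 fun ζ : ℂ => ζ - w := contDiff_id.sub contDiff_const
  have h2 : ContDiff ℝ 1 fun ζ : ℂ => (starRingEnd ℂ) (ζ - w) := Complex.conjCLE.contDiff.comp h1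
  exact h2.mul (((h1.mul h2).add contDiff_const).inv fun ζ => mul_conj_add_sq_ne_zero _ hε)

theorem dbar_cauchyRegularization (w : ℂ) {ε : ℝ} (hε : ε ≠ 0) (ζ : ℂ) :
    dbar (cauchyRegularization w ε) ζ =
      ((2 * ε ^ 2 * ((‖ζ - w‖ ^ 2 + ε ^ 2) ^ 2)⁻¹ : ℝ) : ℂ) := by
  have h1 : DifferentiableAt ℝ (fun ζ : ℂ => ζ - w) ζ := by fun_prop
  have h2 : DifferentiableAt ℝ (fun ζ : ℂ => (starRingEnd ℂ) (ζ - w)) ζ :=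
    Complex.conjCLE.differentiableAt.comp ζ h1
  have h3 : DifferentiableAt ℝ
      (fun ζ : ℂ => (ζ - w) * (starRingEnd ℂ) (ζ - w) + (ε : ℂ) ^ 2) ζ :=
    (h1.mul h2).add_const _
  have hN := mul_conj_add_sq_ne_zero (ζ - w) hε
  have h4 := (contDiff_cauchyRegularization w hε).differentiable (by simp) ζ
  have e1 : dbar (fun ζ : ℂ => (ζ - w) * (starRingEnd ℂ) (ζ - w) + (ε : ℂ) ^ 2) ζ =
      (ζ - w) * 2 := by
    have : dbar (fun ζ : ℂ => (ζ - w) * (starRingEnd ℂ) (ζ - w) + (ε : ℂ) ^ 2) ζ =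
        dbar (fun ζ : ℂ => (ζ - w) * (starRingEnd ℂ) (ζ - w)) ζ := by
      unfold dbar
      rw [fderiv_add_const]
    rw [this, dbar_mul h1 h2, dbar_sub_const, dbar_conj_sub_const, zero_mul, zero_add]
  have e2 : (fun ζ => cauchyRegularization w ε ζ *
      ((ζ - w) * (starRingEnd ℂ) (ζ - w) + (ε : ℂ) ^ 2)) =
      fun ζ => (starRingEnd ℂ) (ζ - w) := by
    funext ζ
    rw [cauchyRegularization, inv_mul_cancel_right₀ (mul_conj_add_sq_ne_zero _ hε)]
  have e3 := dbar_mul h4 h3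
  rw [e2, dbar_conj_sub_const, e1, cauchyRegularization] at e3
  have e4 : dbar (cauchyRegularization w ε) ζ *
      ((ζ - w) * (starRingEnd ℂ) (ζ - w) + (ε : ℂ) ^ 2) ^ 2 = 2 * (ε : ℂ) ^ 2 := by
    field_simp at e3
    linear_combination -e3
  rw [← eq_div_iff (pow_ne_zero 2 hN)] at e4
  rw [e4, mul_conj_add_sq]
  push_cast
  rw [div_eq_mul_inv]

theorem norm_cauchyRegularization_le (w : ℂ) (ε : ℝ) (ζ : ℂ) :
    ‖cauchyRegularization w ε ζ‖ ≤ ‖ζ - w‖⁻¹ := by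
  rw [cauchyRegularization, mul_conj_add_sq, norm_mul, Complex.norm_conj, norm_inv,
    Complex.norm_of_nonneg (by positivity)]
  by_cases h : ‖ζ - w‖ = 0
  · simp [h]
  · have h0 : 0 < ‖ζ - w‖ := lt_of_le_of_ne (norm_nonneg _) (Ne.symm h)
    calc ‖ζ - w‖ * (‖ζ - w‖ ^ 2 + ε ^ 2)⁻¹ ≤ ‖ζ - w‖ * (‖ζ - w‖ ^ 2)⁻¹ := by
          gcongr
          nlinarith [sq_nonneg ε]
      _ = _ := by field_simp

theorem tendsto_cauchyRegularization (w ζ : ℂ) :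
    Tendsto (fun ε => cauchyRegularization w ε ζ) (𝓝[>] 0) (𝓝 (ζ - w)⁻¹) := by
  by_cases h : ζ - w = 0
  · simp [cauchyRegularization, h]
  · have hconj : (starRingEnd ℂ) (ζ - w) ≠ 0 := (map_ne_zero _).2 h
    have hc : ContinuousAt (fun ε : ℝ => cauchyRegularization w ε ζ) 0 := by
      unfold cauchyRegularization
      refine continuousAt_const.mul (ContinuousAt.inv₀ (by fun_prop) ?_)
      simpa [-map_sub] using h
    have h0 : cauchyRegularization w 0 ζ = (ζ - w)⁻¹ := by
      simp only [cauchyRegularization, Complex.ofReal_zero, ne_eq, OfNat.ofNat_ne_zero,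
        not_false_eq_true, zero_pow, add_zero]
      field_simp
    rw [← h0]
    exact hc.tendsto.mono_left nhdsWithin_le_nhds

theorem setIntegral_dbar_cauchyRegularization {Ω : Set ℂ} (hΩ : MeasurableSet Ω) (w : ℂ) {ε : ℝ}
    (hε : 0 < ε) : ∫ ζ in Ω, dbar (cauchyRegularization w ε) ζ =
      ((∫ u : ℂ, Ω.indicator (fun _ => (1 : ℝ)) (w + ε • u) * (2 * ((1 + ‖u‖ ^ 2) ^ 2)⁻¹) : ℝ)
        : ℂ) := by
  classical
  simp_rw [dbar_cauchyRegularization w hε.ne']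
  rw [integral_complex_ofReal]
  congr 1
  rw [← integral_indicator hΩ]
  set F : ℂ → ℝ := Ω.indicator fun ζ => 2 * ε ^ 2 * ((‖ζ - w‖ ^ 2 + ε ^ 2) ^ 2)⁻¹ with hF
  have h1 := Measure.integral_comp_smul (volume : Measure ℂ) (fun u => F (w + u)) ε
  rw [integral_add_left_eq_self F w, Complex.finrank_real_complex,
    abs_of_pos (by positivity), smul_eq_mul] at h1
  have h2 : ∫ ζ, F ζ = ε ^ 2 * ∫ u : ℂ, F (w + ε • u) := by
    rw [h1, mul_inv_cancel_left₀ (by positivity)]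
  rw [h2, ← integral_const_mul]
  refine integral_congr_ae (ae_of_all _ fun u => ?_)
  simp only [hF, Set.indicator_apply]
  split_ifs
  · rw [add_sub_cancel_left, norm_smul, Real.norm_of_nonneg hε.le]
    field_simp
    ring
  · simp

/-- After the substitution `ζ = w + ε u`, the derivative of the regularized kernel is a fixed bump
of mass `2π`. The limit therefore sees only the blow-up of `Ω` at `w`: the plane at an interior
point, a half-plane at a boundary point. -/
theorem tendsto_setIntegral_dbar_cauchyRegularization {Ω : Set ℂ} (hΩ : MeasurableSet Ω) (w : ℂ)
    {g : ℂ → ℝ} (hg : ∀ᵐ u : ℂ, Tendsto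
      (fun ε : ℝ => Ω.indicator (fun _ => (1 : ℝ)) (w + ε • u)) (𝓝[>] 0) (𝓝 (g u))) :
    Tendsto (fun ε => ∫ ζ in Ω, dbar (cauchyRegularization w ε) ζ) (𝓝[>] 0)
      (𝓝 ((∫ u : ℂ, g u * (2 * ((1 + ‖u‖ ^ 2) ^ 2)⁻¹) : ℝ) : ℂ)) := by
  have h1 : Tendsto (fun ε : ℝ => ∫ u : ℂ, Ω.indicator (fun _ => (1 : ℝ)) (w + ε • u) *
      (2 * ((1 + ‖u‖ ^ 2) ^ 2)⁻¹)) (𝓝[>] 0)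
      (𝓝 (∫ u : ℂ, g u * (2 * ((1 + ‖u‖ ^ 2) ^ 2)⁻¹))) := by
    refine tendsto_integral_filter_of_dominated_convergence
      (fun u : ℂ => 2 * ((1 + ‖u‖ ^ 2) ^ 2)⁻¹) (Eventually.of_forall fun ε => ?_)
      (Eventually.of_forall fun ε => ae_of_all _ fun u => ?_)
      integrable_two_mul_inv_one_add_sq_sq ?_
    · refine AEStronglyMeasurable.mul ?_ integrable_two_mul_inv_one_add_sq_sq.aestronglyMeasurable
      refine Measurable.aestronglyMeasurable ?_
      exact (measurable_const.indicator hΩ).comp (by fun_prop)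
    · rw [norm_mul, Real.norm_of_nonneg (by positivity : 0 ≤ 2 * ((1 + ‖u‖ ^ 2) ^ 2)⁻¹)]
      refine mul_le_of_le_one_left (by positivity) ?_
      exact (norm_indicator_le_norm_self _ _).trans (by simp)
    · filter_upwards [hg] with u hu using hu.mul_const _
  refine ((Complex.continuous_ofReal.tendsto _).comp h1).congr' ?_
  filter_upwards [self_mem_nhdsWithin] with ε hε
  exact (setIntegral_dbar_cauchyRegularization hΩ w hε).symm

theorem ae_inner_ne_zero {n : ℂ} (hn : n ≠ 0) : ∀ᵐ u : ℂ, ⟪n, u⟫ ≠ 0 := by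
  have h : (innerSL ℝ n).ker ≠ ⊤ := fun h => by
    have : n ∈ (innerSL ℝ n).ker := h ▸ Submodule.mem_top
    simp [hn] at this
  have := Measure.addHaar_submodule (volume : Measure ℂ) _ h
  filter_upwards [compl_mem_ae_iff.2 this] with u hu h0
  exact hu (by simpa using h0)

/-- The bump is even, and `u ↦ -u` exchanges the two open half-planes, whose common edge is null. -/
theorem integral_halfPlane_two_mul_inv_one_add_sq_sq {n : ℂ} (hn : n ≠ 0) :
    ∫ u : ℂ, {u : ℂ | ⟪n, u⟫ < 0}.indicator (fun _ => (1 : ℝ)) u *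
      (2 * ((1 + ‖u‖ ^ 2) ^ 2)⁻¹) = Real.pi := by
  classical
  set κ : ℂ → ℝ := fun u => 2 * ((1 + ‖u‖ ^ 2) ^ 2)⁻¹ with hκ
  set s : Set ℂ := {u : ℂ | ⟪n, u⟫ < 0} with hs
  have hsm : MeasurableSet s :=
    (isOpen_lt (continuous_const.inner continuous_id) continuous_const).measurableSet
  have hint : Integrable fun u : ℂ => s.indicator (fun _ => (1 : ℝ)) u * κ u := by
    refine (integrable_two_mul_inv_one_add_sq_sq.indicator hsm).congr (ae_of_all _ fun u => ?_)
    simp [Set.indicator_apply, hκ]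
  have h1 : ∫ u : ℂ, s.indicator (fun _ => (1 : ℝ)) (-u) * κ (-u) =
      ∫ u : ℂ, s.indicator (fun _ => (1 : ℝ)) u * κ u :=
    integral_neg_eq_self (fun u => s.indicator (fun _ => (1 : ℝ)) u * κ u) volume
  have h2 : (∫ u : ℂ, s.indicator (fun _ => (1 : ℝ)) u * κ u) +
      ∫ u : ℂ, s.indicator (fun _ => (1 : ℝ)) (-u) * κ (-u) = 2 * Real.pi := by
    rw [← integral_two_mul_inv_one_add_sq_sq, ← integral_add hint hint.comp_neg]
    refine integral_congr_ae ?_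
    filter_upwards [ae_inner_ne_zero hn] with u hu
    simp only [Set.indicator_apply, hs, Set.mem_ofPred_eq, inner_neg_right, hκ, norm_neg,
      Left.neg_neg_iff]
    rcases hu.lt_or_gt with h | h
    · rw [if_pos h, if_neg h.not_gt]; ring
    · rw [if_neg h.not_gt, if_pos h]; ring
  rw [h1] at h2
  linarith

/-! ### The Cauchy kernel and the double-layer kernel on the boundary -/

namespace IsSmoothlyBounded

variable {Ω : Set ℂ}

theorem setIntegral_dbar_eq (hΩ : IsSmoothlyBounded Ω) {χ : ℂ → ℂ} (hχ : ContDiff ℝ 1 χ) :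
    ∫ ζ in Ω, dbar χ ζ = ∫ σ : frontier Ω, χ σ * outwardNormal Ω σ ∂(arcLength Ω) := by
  simpa using green hΩ isOpen_univ (f := fun _ => (1 : ℂ)) continuousOn_const
    (differentiableOn_const _) hχ (Set.subset_univ _)

theorem exists_pos_le_norm_sub {w : ℂ} (hw : w ∉ frontier Ω) :
    ∃ d > 0, ∀ σ ∈ frontier Ω, d ≤ ‖σ - w‖ := by
  obtain ⟨d, hd, h⟩ := Metric.isOpen_iff.1 isClosed_frontier.isOpen_compl w hw
  refine ⟨d, hd, fun σ hσ => ?_⟩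
  by_contra! hlt
  exact h (by rwa [Metric.mem_ball, dist_eq_norm]) hσ

theorem notMem_frontier (hΩ : IsSmoothlyBounded Ω) {w : ℂ} (hw : w ∈ Ω) : w ∉ frontier Ω :=
  fun h => (hΩ.isOpen.frontier_eq ▸ h : w ∈ closure Ω \ Ω).2 hw

theorem aestronglyMeasurable_cauchyRegularization (hΩ : IsSmoothlyBounded Ω) (w : ℂ) {ε : ℝ}
    (hε : ε ≠ 0) : AEStronglyMeasurable
      (fun σ : frontier Ω => cauchyRegularization w ε σ * outwardNormal Ω σ) (arcLength Ω) :=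
  (hΩ.integrable_of_continuous (((contDiff_cauchyRegularization w hε).continuous.comp
    continuous_subtype_val).mul hΩ.continuous_outwardNormal)).aestronglyMeasurable

theorem integral_outwardNormal_div (hΩ : IsSmoothlyBounded Ω) {w : ℂ} (hw : w ∈ Ω) :
    ∫ σ : frontier Ω, outwardNormal Ω σ / ((σ : ℂ) - w) ∂(arcLength Ω) = 2 * Real.pi := by
  have := hΩ.isFiniteMeasure_arcLength
  have h1 := tendsto_setIntegral_dbar_cauchyRegularization hΩ.isOpen.measurableSet w
    (g := fun _ => 1) (ae_of_all _ fun u => by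
      refine tendsto_const_nhds.congr' ?_
      have := (IsLocalDefiningFunction.tendsto_add_smul w u).eventually (hΩ.isOpen.mem_nhds hw)
      filter_upwards [this] with ε hε
      exact (Set.indicator_of_mem hε (fun _ => (1 : ℝ))).symm)
  simp only [one_mul] at h1
  rw [integral_two_mul_inv_one_add_sq_sq] at h1
  obtain ⟨d, hd, hdw⟩ := exists_pos_le_norm_sub (hΩ.notMem_frontier hw)
  have h2 : Tendsto (fun ε => ∫ σ : frontier Ω, cauchyRegularization w ε σ * outwardNormal Ω σ
      ∂(arcLength Ω)) (𝓝[>] 0)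
      (𝓝 (∫ σ : frontier Ω, outwardNormal Ω σ / ((σ : ℂ) - w) ∂(arcLength Ω))) := by
    refine tendsto_integral_filter_of_dominated_convergence (fun _ => d⁻¹) ?_ ?_
      (integrable_const _) (ae_of_all _ fun σ => ?_)
    · filter_upwards [self_mem_nhdsWithin] with ε hε
      exact hΩ.aestronglyMeasurable_cauchyRegularization w (ne_of_gt hε)
    · refine Eventually.of_forall fun ε => ae_of_all _ fun σ => ?_
      rw [norm_mul, hΩ.norm_outwardNormal σ.2, mul_one]
      refine (norm_cauchyRegularization_le w ε σ).trans ?_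
      gcongr
      exact hdw σ σ.2
    · simp only [div_eq_inv_mul]
      exact (tendsto_cauchyRegularization w σ).mul_const _
  refine tendsto_nhds_unique (h2.congr' ?_) (by simpa using h1)
  filter_upwards [self_mem_nhdsWithin] with ε hε
  exact (hΩ.setIntegral_dbar_eq (contDiff_cauchyRegularization w (ne_of_gt hε))).symm

theorem re_div_sub_eq (n σ z : ℂ) : (n / (σ - z)).re = ⟪n, σ - z⟫ / ‖σ - z‖ ^ 2 := by
  rw [Complex.inner, div_eq_mul_inv, Complex.inv_def, Complex.normSq_eq_norm_sq, ← mul_assoc,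
    Complex.re_mul_ofReal, div_eq_mul_inv]
  congr 1
  rw [← Complex.conj_re, map_mul, Complex.conj_conj, mul_comm]

theorem doubleLayer_eq (Ω : Set ℂ) (σ z : ℂ) :
    doubleLayer Ω σ z = Real.pi⁻¹ * (⟪outwardNormal Ω σ, σ - z⟫ / ‖σ - z‖ ^ 2) := by
  rw [doubleLayer, re_div_sub_eq]

theorem exists_abs_re_div_le (hΩ : IsSmoothlyBounded Ω) : ∃ C : ℝ, 0 ≤ C ∧
    ∀ σ ∈ frontier Ω, ∀ z ∈ frontier Ω, |(outwardNormal Ω σ / (σ - z)).re| ≤ C := by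
  obtain ⟨C, hC, h⟩ := hΩ.exists_abs_inner_le
  refine ⟨C, hC, fun σ hσ z hz => ?_⟩
  rw [re_div_sub_eq, abs_div, abs_of_nonneg (by positivity : 0 ≤ ‖σ - z‖ ^ 2)]
  exact div_le_of_le_mul₀ (by positivity) hC (h σ hσ z hz)

theorem measurable_outwardNormal (hΩ : IsSmoothlyBounded Ω) :
    Measurable fun σ : frontier Ω => outwardNormal Ω σ := hΩ.continuous_outwardNormal.measurable

/-- The blow-up at a boundary point is a half-plane, hence half of the interior value `2π`. Only the
real part is used, because the chord estimate keeps it bounded while the full Cauchy kernel is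
singular; this halving produces the jump relation. -/
theorem integral_re_outwardNormal_div (hΩ : IsSmoothlyBounded Ω) {z : ℂ} (hz : z ∈ frontier Ω) :
    ∫ σ : frontier Ω, (outwardNormal Ω σ / ((σ : ℂ) - z)).re ∂(arcLength Ω) = Real.pi := by
  have := hΩ.isFiniteMeasure_arcLength
  obtain ⟨ρ, hρ⟩ := hΩ.exists_defining z hz
  have hg0 := hρ.gradient_ne_zero
  have h1 := tendsto_setIntegral_dbar_cauchyRegularization hΩ.isOpen.measurableSet z
    (g := {u : ℂ | ⟪gradient ρ z, u⟫ < 0}.indicator fun _ => 1) (by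
      filter_upwards [ae_inner_ne_zero hg0] with u hu
      rcases hu.lt_or_gt with h | h
      · rw [Set.indicator_of_mem (by exact h)]
        refine tendsto_const_nhds.congr' ?_
        rw [IsLocalDefiningFunction.inner_gradient] at h
        filter_upwards [hρ.eventually_add_smul_mem hΩ.isOpen hz h] with ε hε
        exact (Set.indicator_of_mem hε (fun _ => (1 : ℝ))).symm
      · rw [Set.indicator_of_notMem (by exact h.not_gt)]
        refine tendsto_const_nhds.congr' ?_
        rw [IsLocalDefiningFunction.inner_gradient] at h
        filter_upwards [hρ.eventually_add_smul_notMem hΩ.isOpen hz h] with ε hε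
        exact (Set.indicator_of_notMem hε (fun _ => (1 : ℝ))).symm)
  rw [integral_halfPlane_two_mul_inv_one_add_sq_sq hg0] at h1
  obtain ⟨C, hC, hCb⟩ := hΩ.exists_abs_re_div_le
  have h2 : Tendsto (fun ε => ∫ σ : frontier Ω,
      (cauchyRegularization z ε σ * outwardNormal Ω σ).re ∂(arcLength Ω)) (𝓝[>] 0)
      (𝓝 (∫ σ : frontier Ω, (outwardNormal Ω σ / ((σ : ℂ) - z)).re ∂(arcLength Ω))) := by
    refine tendsto_integral_filter_of_dominated_convergence (fun _ => C) ?_ ?_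
      (integrable_const _) (ae_of_all _ fun σ => ?_)
    · filter_upwards [self_mem_nhdsWithin] with ε hε
      exact Complex.continuous_re.comp_aestronglyMeasurable
        (hΩ.aestronglyMeasurable_cauchyRegularization z (ne_of_gt hε))
    · refine Eventually.of_forall fun ε => ae_of_all _ fun σ => ?_
      -- Regularization multiplies the real part of the kernel by a factor in `[0, 1]`, so the bound
      -- `C` persists for all `ε`.
      have e : (cauchyRegularization z ε σ * outwardNormal Ω σ).re =
          (outwardNormal Ω σ / ((σ : ℂ) - z)).re *
            (‖(σ : ℂ) - z‖ ^ 2 * (‖(σ : ℂ) - z‖ ^ 2 + ε ^ 2)⁻¹) := by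
        rw [re_div_sub_eq, cauchyRegularization, mul_conj_add_sq, mul_right_comm,
          ← Complex.ofReal_inv, Complex.re_mul_ofReal, Complex.inner, ← Complex.conj_re, map_mul,
          Complex.conj_conj]
        by_cases h0 : ‖(σ : ℂ) - z‖ = 0
        · rw [norm_eq_zero] at h0
          simp [h0]
        · field_simp
      rw [e, norm_mul, Real.norm_eq_abs]
      refine (mul_le_of_le_one_right (abs_nonneg _) ?_).trans (hCb σ σ.2 z hz)
      rw [Real.norm_of_nonneg (by positivity), ← div_eq_mul_inv]
      exact div_le_one_of_le₀ (by nlinarith [sq_nonneg ε]) (by positivity)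
    · simp only [div_eq_inv_mul]
      exact (Complex.continuous_re.tendsto _).comp
        ((tendsto_cauchyRegularization z σ).mul_const _)
  refine tendsto_nhds_unique (h2.congr' ?_)
    (by simpa using (Complex.continuous_re.tendsto _).comp h1)
  filter_upwards [self_mem_nhdsWithin] with ε hε
  rw [Function.comp_apply,
    hΩ.setIntegral_dbar_eq (contDiff_cauchyRegularization z (ne_of_gt hε))]
  exact integral_re (hΩ.integrable_of_continuous
    (((contDiff_cauchyRegularization z (ne_of_gt hε)).continuous.comp
    continuous_subtype_val).mul hΩ.continuous_outwardNormal))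

end IsSmoothlyBounded

/-! ### Lipschitz functions are dense -/

/-- Stone–Weierstrass: bounded Lipschitz functions form a star subalgebra, and distances to points
separate points. -/
theorem dense_lipschitz (X : Type*) [MetricSpace X] [CompactSpace X] :
    Dense {φ : C(X, ℂ) | ∃ C, LipschitzWith C φ} := by
  let A : StarSubalgebra ℂ C(X, ℂ) :=
    { carrier := {φ : C(X, ℂ) | ∃ C, LipschitzWith C φ}
      mul_mem' := by
        rintro φ ψ ⟨C, hC⟩ ⟨D, hD⟩
        refine ⟨‖φ‖₊ * D + ‖ψ‖₊ * C, LipschitzWith.of_dist_le_mul fun x y => ?_⟩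
        have e : φ x * ψ x - φ y * ψ y = φ x * (ψ x - ψ y) + ψ y * (φ x - φ y) := by ring
        rw [dist_eq_norm, ContinuousMap.mul_apply, ContinuousMap.mul_apply, e]
        refine (norm_add_le _ _).trans ?_
        rw [norm_mul, norm_mul, ← dist_eq_norm, ← dist_eq_norm]
        push_cast
        rw [add_mul, mul_assoc, mul_assoc]
        gcongr
        · exact φ.norm_coe_le_norm x
        · exact hD.dist_le_mul x y
        · exact ψ.norm_coe_le_norm y
        · exact hC.dist_le_mul x y
      add_mem' := by
        rintro φ ψ ⟨C, hC⟩ ⟨D, hD⟩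
        exact ⟨C + D, hC.add hD⟩
      algebraMap_mem' := fun c => ⟨0, LipschitzWith.const c⟩
      star_mem' := by
        rintro φ ⟨C, hC⟩
        refine ⟨C, LipschitzWith.of_dist_le_mul fun x y => ?_⟩
        rw [ContinuousMap.star_apply, ContinuousMap.star_apply, dist_star_star]
        exact hC.dist_le_mul x y }
  have hsep : A.SeparatesPoints := by
    intro x y hxy
    have hd : 0 < dist x y := dist_pos.2 hxy
    refine ⟨_, ⟨⟨fun u => (dist u x : ℂ), by fun_prop⟩, ⟨1, ?_⟩, rfl⟩, ?_⟩
    · refine LipschitzWith.of_dist_le_mul fun u v => ?_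
      simp only [ContinuousMap.coe_mk, NNReal.coe_one, one_mul]
      rw [dist_eq_norm, ← Complex.ofReal_sub, Complex.norm_real, Real.norm_eq_abs]
      exact abs_dist_sub_le u v x
    · simp only [ContinuousMap.coe_mk, dist_self, Complex.ofReal_zero]
      rw [ne_comm, Complex.ofReal_ne_zero, dist_comm]
      exact hd.ne'
  have h := ContinuousMap.starSubalgebra_topologicalClosure_eq_top_of_separatesPoints A hsep
  intro φ
  have : φ ∈ A.topologicalClosure := h ▸ StarSubalgebra.mem_top
  exact this

theorem isHolder_of_lipschitzWith {Ω : Set ℂ} {φ : C(frontier Ω, ℂ)} {C : NNReal}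
    (h : LipschitzWith C φ) : IsHolder φ := ⟨C, 1, one_pos, holderWith_one.2 h⟩

/-! ### Cauchy integrals -/

/-- The Cauchy integral of a function on the boundary. -/
noncomputable def cauchyIntegral (Ω : Set ℂ) (φ : C(frontier Ω, ℂ)) (w : ℂ) : ℂ :=
  (2 * Real.pi : ℂ)⁻¹ * ∫ σ : frontier Ω, φ σ * (outwardNormal Ω σ / ((σ : ℂ) - w)) ∂(arcLength Ω)

/-- Holomorphic functions with boundary limits extend continuously to the closure. -/
theorem exists_diffContOnCl_of_tendsto {Ω : Set ℂ} (hΩ : IsOpen Ω) {F : ℂ → ℂ}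
    (hF : DifferentiableOn ℂ F Ω)
    (h : ∀ z ∈ frontier Ω, ∃ y, Tendsto F (𝓝[Ω] z) (𝓝 y)) :
    ∃ G : ℂ → ℂ, DiffContOnCl ℂ G Ω ∧ Set.EqOn G F Ω ∧
      ∀ z ∈ frontier Ω, Tendsto F (𝓝[Ω] z) (𝓝 (G z)) := by
  have hin : ∀ z ∈ Ω, Tendsto F (𝓝[Ω] z) (𝓝 (F z)) := fun z hz => (hF z hz).continuousWithinAt
  have heq : Set.EqOn (extendFrom Ω F) F Ω := fun z hz =>
    extendFrom_eq (subset_closure hz) (hin z hz)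
  refine ⟨extendFrom Ω F, ⟨hF.congr heq, continuousOn_extendFrom subset_rfl fun z hz => ?_⟩, heq,
    fun z hz => ?_⟩
  · by_cases hm : z ∈ Ω
    · exact ⟨_, hin z hm⟩
    · exact h z (by rw [hΩ.frontier_eq]; exact ⟨hz, hm⟩)
  · obtain ⟨y, hy⟩ := h z hz
    rwa [extendFrom_eq hz.1 hy]

theorem DiffContOnCl.tendsto_frontier {Ω : Set ℂ} {F : ℂ → ℂ} (hF : DiffContOnCl ℂ F Ω) {z : ℂ}
    (hz : z ∈ frontier Ω) : Tendsto F (𝓝[Ω] z) (𝓝 (F z)) :=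
  ((hF.continuousOn z hz.1).mono subset_closure).tendsto

/-- The restriction to the boundary of a function continuous on the closure. -/
noncomputable def DiffContOnCl.boundaryMap {Ω : Set ℂ} {F : ℂ → ℂ} (hF : DiffContOnCl ℂ F Ω) :
    C(frontier Ω, ℂ) :=
  ⟨fun z => F z, hF.continuousOn.comp_continuous continuous_subtype_val fun z => z.2.1⟩

theorem DiffContOnCl.boundaryMap_mem {Ω : Set ℂ} {F : ℂ → ℂ} (hF : DiffContOnCl ℂ F Ω) :
    hF.boundaryMap ∈ analyticSpace Ω := ⟨F, hF, fun _ => rfl⟩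

theorem mem_analyticSpace_of_tendsto {Ω : Set ℂ} (hΩ : IsOpen Ω) {F : ℂ → ℂ}
    (hF : DifferentiableOn ℂ F Ω) {b : C(frontier Ω, ℂ)}
    (h : ∀ z : frontier Ω, Tendsto F (𝓝[Ω] (z : ℂ)) (𝓝 (b z))) : b ∈ analyticSpace Ω := by
  obtain ⟨G, hG, -, hlim⟩ := exists_diffContOnCl_of_tendsto hΩ hF fun z hz => ⟨_, h ⟨z, hz⟩⟩
  refine ⟨G, hG, fun z => ?_⟩
  have : (𝓝[Ω] (z : ℂ)).NeBot := mem_closure_iff_nhdsWithin_neBot.1 z.2.1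
  exact tendsto_nhds_unique (h z) (hlim z z.2)

/-! ### Holomorphy and boundary values of Cauchy integrals. -/

namespace IsSmoothlyBounded

variable {Ω : Set ℂ}

theorem integrable_cauchyKernel (hΩ : IsSmoothlyBounded Ω) (φ : C(frontier Ω, ℂ)) {w : ℂ}
    (hw : w ∉ frontier Ω) : Integrable
      (fun σ : frontier Ω => φ σ * (outwardNormal Ω σ / ((σ : ℂ) - w))) (arcLength Ω) := by
  refine hΩ.integrable_of_continuous (φ.continuous.mul
    (hΩ.continuous_outwardNormal.div (by fun_prop) fun σ h => hw ?_))
  rw [← sub_eq_zero.1 h]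
  exact σ.2

theorem differentiableOn_cauchyIntegral (hΩ : IsSmoothlyBounded Ω) (φ : C(frontier Ω, ℂ)) :
    DifferentiableOn ℂ (cauchyIntegral Ω φ) Ω := by
  have := hΩ.compactSpace
  have := hΩ.isFiniteMeasure_arcLength
  intro w hw
  obtain ⟨d, hd, hdw⟩ := exists_pos_le_norm_sub (hΩ.notMem_frontier hw)
  have hball : ∀ x ∈ Metric.ball w (d / 2), ∀ σ ∈ frontier Ω, d / 2 ≤ ‖σ - x‖ := by
    intro x hx σ hσ
    rw [Metric.mem_ball, dist_eq_norm] at hx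
    have := hdw σ hσ
    have h2 := norm_sub_le_norm_sub_add_norm_sub σ x w
    linarith
  have h := hasDerivAt_integral_of_dominated_loc_of_deriv_le (μ := arcLength Ω) (𝕜 := ℂ)
    (F := fun x (σ : frontier Ω) => φ σ * (outwardNormal Ω σ / ((σ : ℂ) - x)))
    (F' := fun x (σ : frontier Ω) => φ σ * (outwardNormal Ω σ / ((σ : ℂ) - x) ^ 2))
    (x₀ := w) (s := Metric.ball w (d / 2)) (bound := fun _ => ‖φ‖ * (1 / (d / 2) ^ 2))
    (Metric.ball_mem_nhds w (half_pos hd)) ?_ (hΩ.integrable_cauchyKernel φ (hΩ.notMem_frontier hw))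
    ?_ ?_ (integrable_const _) ?_
  · exact (h.2.differentiableAt.const_mul _).differentiableWithinAt
  · filter_upwards [hΩ.isOpen.mem_nhds hw] with x hx
    exact (hΩ.integrable_cauchyKernel φ (hΩ.notMem_frontier hx)).aestronglyMeasurable
  · refine (φ.continuous.measurable.mul (hΩ.measurable_outwardNormal.div ?_)).aestronglyMeasurable
    fun_prop
  · refine ae_of_all _ fun σ x hx => ?_
    rw [norm_mul, norm_div, hΩ.norm_outwardNormal σ.2, norm_pow]
    gcongr
    · exact φ.norm_coe_le_norm σ
    · exact hball x hx σ σ.2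
  · refine ae_of_all _ fun σ x hx => ?_
    have hne : (σ : ℂ) - x ≠ 0 := norm_pos_iff.1 ((half_pos hd).trans_le (hball x hx σ σ.2))
    have h1 := (((hasDerivAt_id x).const_sub (σ : ℂ)).inv hne).const_mul (outwardNormal Ω σ)
      |>.const_mul (φ σ)
    simp only [div_eq_mul_inv]
    refine h1.congr_deriv ?_
    simp [div_eq_mul_inv]

/-- A nearest boundary point. -/
theorem exists_nearest (hΩ : IsSmoothlyBounded Ω) (hne : (frontier Ω).Nonempty) :
    ∃ τ : ℂ → frontier Ω, ∀ w, ∀ σ ∈ frontier Ω, ‖(τ w : ℂ) - w‖ ≤ ‖σ - w‖ := by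
  have : ∀ w, ∃ t : frontier Ω, ∀ σ ∈ frontier Ω, ‖(t : ℂ) - w‖ ≤ ‖σ - w‖ := fun w => by
    obtain ⟨t, ht, h⟩ := hΩ.isCompact_frontier.exists_infDist_eq_dist hne w
    refine ⟨⟨t, ht⟩, fun σ hσ => ?_⟩
    rw [← dist_eq_norm, ← dist_eq_norm, dist_comm, ← h, dist_comm]
    exact Metric.infDist_le_dist_of_mem hσ
  choose τ hτ using this
  exact ⟨τ, hτ⟩

theorem norm_sub_nearest_le {τ : ℂ → frontier Ω}
    (hτ : ∀ w, ∀ σ ∈ frontier Ω, ‖(τ w : ℂ) - w‖ ≤ ‖σ - w‖) (w : ℂ) {σ : ℂ}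
    (hσ : σ ∈ frontier Ω) : ‖σ - τ w‖ ≤ 2 * ‖σ - w‖ := by
  have h1 := hτ w σ hσ
  have h2 := norm_sub_le_norm_sub_add_norm_sub σ w (τ w)
  rw [norm_sub_rev w] at h2
  linarith

/-- The Lipschitz increment cancels the singularity of the Cauchy kernel with a bound independent of
`w`. The hypothesis holds when `t` is a boundary point nearest to `w`, and trivially when `w = t`.
-/
theorem norm_mul_outwardNormal_div_le (hΩ : IsSmoothlyBounded Ω) {φ : C(frontier Ω, ℂ)} {L : NNReal}
    (hφ : LipschitzWith L φ) {σ t : frontier Ω} {w : ℂ} (h : ‖(σ : ℂ) - t‖ ≤ 2 * ‖(σ : ℂ) - w‖) :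
    ‖(φ σ - φ t) * (outwardNormal Ω σ / ((σ : ℂ) - w))‖ ≤ 2 * L := by
  have h1 := hφ.dist_le_mul σ t
  rw [dist_eq_norm, Subtype.dist_eq, dist_eq_norm] at h1
  rw [norm_mul, norm_div, hΩ.norm_outwardNormal σ.2, mul_one_div]
  refine div_le_of_le_mul₀ (norm_nonneg _) (by positivity) (h1.trans ?_)
  calc (L : ℝ) * ‖(σ : ℂ) - t‖ ≤ L * (2 * ‖(σ : ℂ) - w‖) := by gcongr
    _ = _ := by ring

theorem integrable_sub_mul_outwardNormal_div (hΩ : IsSmoothlyBounded Ω) {φ : C(frontier Ω, ℂ)}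
    {L : NNReal} (hφ : LipschitzWith L φ) (z : frontier Ω) : Integrable
      (fun σ : frontier Ω => (φ σ - φ z) * (outwardNormal Ω σ / ((σ : ℂ) - z))) (arcLength Ω) := by
  have := hΩ.isFiniteMeasure_arcLength
  refine (integrable_const (2 * (L : ℝ))).mono' ?_ (ae_of_all _ fun σ => ?_)
  · refine ((φ.continuous.measurable.sub_const _).mul
      (hΩ.measurable_outwardNormal.div ?_)).aestronglyMeasurable
    fun_prop
  · exact hΩ.norm_mul_outwardNormal_div_le hφ (by linarith [norm_nonneg ((σ : ℂ) - z)])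

theorem cauchyIntegral_eq (hΩ : IsSmoothlyBounded Ω) (φ : C(frontier Ω, ℂ)) {w : ℂ} (hw : w ∈ Ω)
    (c : ℂ) : cauchyIntegral Ω φ w = c + (2 * Real.pi : ℂ)⁻¹ *
      ∫ σ : frontier Ω, (φ σ - c) * (outwardNormal Ω σ / ((σ : ℂ) - w)) ∂(arcLength Ω) := by
  have h1 := hΩ.integrable_cauchyKernel φ (hΩ.notMem_frontier hw)
  have h2 := hΩ.integrable_cauchyKernel (ContinuousMap.const _ c) (hΩ.notMem_frontier hw)
  simp only [ContinuousMap.const_apply] at h2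
  have hpi : (Real.pi : ℂ) ≠ 0 := Complex.ofReal_ne_zero.2 Real.pi_ne_zero
  simp only [sub_mul]
  rw [integral_sub h1 h2, integral_const_mul, hΩ.integral_outwardNormal_div hw, cauchyIntegral]
  field_simp
  ring

/-- The Cauchy integral of a Lipschitz function has boundary values. -/
theorem tendsto_cauchyIntegral (hΩ : IsSmoothlyBounded Ω) {φ : C(frontier Ω, ℂ)} {L : NNReal}
    (hφ : LipschitzWith L φ) (z : frontier Ω) :
    Tendsto (cauchyIntegral Ω φ) (𝓝[Ω] (z : ℂ)) (𝓝 (φ z + (2 * Real.pi : ℂ)⁻¹ *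
      ∫ σ : frontier Ω, (φ σ - φ z) * (outwardNormal Ω σ / ((σ : ℂ) - z)) ∂(arcLength Ω))) := by
  have := hΩ.isFiniteMeasure_arcLength
  obtain ⟨τ, hτ⟩ := hΩ.exists_nearest ⟨z, z.2⟩
  have hτz : Tendsto τ (𝓝[Ω] (z : ℂ)) (𝓝 z) := by
    rw [tendsto_subtype_rng, tendsto_iff_norm_sub_tendsto_zero]
    have h1 : Tendsto (fun w : ℂ => 2 * ‖(z : ℂ) - w‖) (𝓝[Ω] (z : ℂ)) (𝓝 0) := by
      have : Continuous fun w : ℂ => 2 * ‖(z : ℂ) - w‖ := by fun_prop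
      exact tendsto_nhdsWithin_of_tendsto_nhds (by simpa using this.tendsto (z : ℂ))
    refine squeeze_zero (fun _ => norm_nonneg _) (fun w => ?_) h1
    rw [norm_sub_rev]
    exact norm_sub_nearest_le hτ w z.2
  have hφτ : Tendsto (fun w => φ (τ w)) (𝓝[Ω] (z : ℂ)) (𝓝 (φ z)) :=
    (φ.continuous.tendsto z).comp hτz
  -- Subtracting the value at the nearest point `τ w`, instead of at `z`, gives one dominating
  -- constant for every approach within `Ω`, tangential ones included.
  have hlim : Tendsto (fun w => φ (τ w) + (2 * Real.pi : ℂ)⁻¹ *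
      ∫ σ : frontier Ω, (φ σ - φ (τ w)) * (outwardNormal Ω σ / ((σ : ℂ) - w)) ∂(arcLength Ω))
      (𝓝[Ω] (z : ℂ)) (𝓝 (φ z + (2 * Real.pi : ℂ)⁻¹ *
      ∫ σ : frontier Ω, (φ σ - φ z) * (outwardNormal Ω σ / ((σ : ℂ) - z)) ∂(arcLength Ω))) := by
    refine hφτ.add (Tendsto.const_mul _ ?_)
    refine tendsto_integral_filter_of_dominated_convergence (fun _ => 2 * (L : ℝ)) ?_ ?_
      (integrable_const _) ?_
    · refine Eventually.of_forall fun w => ?_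
      refine ((φ.continuous.measurable.sub_const _).mul
        (hΩ.measurable_outwardNormal.div ?_)).aestronglyMeasurable
      fun_prop
    · exact Eventually.of_forall fun w => ae_of_all _ fun σ =>
        hΩ.norm_mul_outwardNormal_div_le hφ (norm_sub_nearest_le hτ w σ.2)
    · filter_upwards [ae_arcLength_ne (Ω := Ω) (z : ℂ)] with σ hσ
      refine (tendsto_const_nhds.sub hφτ).mul (tendsto_const_nhds.div
        (tendsto_const_nhds.sub (tendsto_nhdsWithin_of_tendsto_nhds tendsto_id)) ?_)
      exact sub_ne_zero.2 hσ
  refine hlim.congr' ?_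
  filter_upwards [self_mem_nhdsWithin] with w hw using (hΩ.cauchyIntegral_eq φ hw _).symm

end IsSmoothlyBounded

/-! ### Double-layer transforms -/

namespace IsSmoothlyBounded

variable {Ω : Set ℂ}

theorem measurable_doubleLayer (hΩ : IsSmoothlyBounded Ω) (w : ℂ) :
    Measurable fun σ : frontier Ω => doubleLayer Ω σ w := by
  unfold doubleLayer
  refine measurable_const.mul (Complex.measurable_re.comp (hΩ.measurable_outwardNormal.div ?_))
  fun_prop

theorem exists_abs_doubleLayer_le (hΩ : IsSmoothlyBounded Ω) : ∃ C : ℝ, 0 ≤ C ∧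
    ∀ σ ∈ frontier Ω, ∀ z ∈ frontier Ω, |doubleLayer Ω σ z| ≤ C := by
  obtain ⟨C, hC, h⟩ := hΩ.exists_abs_re_div_le
  refine ⟨Real.pi⁻¹ * C, by positivity, fun σ hσ z hz => ?_⟩
  rw [doubleLayer, abs_mul, abs_of_pos (inv_pos.2 Real.pi_pos)]
  gcongr
  exact h σ hσ z hz

theorem integrable_mul_doubleLayer (hΩ : IsSmoothlyBounded Ω) (φ : C(frontier Ω, ℂ))
    {z : ℂ} (hz : z ∈ frontier Ω) :
    Integrable (fun σ : frontier Ω => φ σ * (doubleLayer Ω σ z : ℂ)) (arcLength Ω) := by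
  have := hΩ.compactSpace
  have := hΩ.isFiniteMeasure_arcLength
  obtain ⟨C, hC, h⟩ := hΩ.exists_abs_doubleLayer_le
  refine (integrable_const (‖φ‖ * C)).mono' ?_ (ae_of_all _ fun σ => ?_)
  · exact (φ.continuous.measurable.mul
      (Complex.measurable_ofReal.comp (hΩ.measurable_doubleLayer z))).aestronglyMeasurable
  · rw [norm_mul, Complex.norm_real]
    exact mul_le_mul (φ.norm_coe_le_norm σ) (h σ σ.2 z hz) (norm_nonneg _) (norm_nonneg _)

theorem integral_doubleLayer (hΩ : IsSmoothlyBounded Ω) {z : ℂ} (hz : z ∈ frontier Ω) :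
    ∫ σ : frontier Ω, (doubleLayer Ω σ z : ℂ) ∂(arcLength Ω) = 1 := by
  rw [integral_complex_ofReal]
  unfold doubleLayer
  rw [integral_const_mul, hΩ.integral_re_outwardNormal_div hz, inv_mul_cancel₀ Real.pi_ne_zero,
    Complex.ofReal_one]

/-- The double-layer kernel is bounded on the boundary, so that the integral defines an operator. -/
theorem exists_singularTransform (hΩ : IsSmoothlyBounded Ω) :
    ∃ K : C(frontier Ω, ℂ) →L[ℂ] C(frontier Ω, ℂ), ∀ φ (z : frontier Ω),
      K φ z = ∫ σ : frontier Ω, φ σ * (doubleLayer Ω σ z : ℂ) ∂(arcLength Ω) := by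
  have := hΩ.compactSpace
  have := hΩ.isFiniteMeasure_arcLength
  obtain ⟨C, hC, h⟩ := hΩ.exists_abs_doubleLayer_le
  have hcont : ∀ φ : C(frontier Ω, ℂ), Continuous fun z : frontier Ω =>
      ∫ σ : frontier Ω, φ σ * (doubleLayer Ω σ z : ℂ) ∂(arcLength Ω) := by
    intro φ
    refine continuous_iff_continuousAt.2 fun z => ?_
    refine continuousAt_of_dominated (bound := fun _ => ‖φ‖ * C)
      (Eventually.of_forall fun x => (hΩ.integrable_mul_doubleLayer φ x.2).aestronglyMeasurable)
      (Eventually.of_forall fun x => ae_of_all _ fun σ => ?_) (integrable_const _) ?_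
    · rw [norm_mul, Complex.norm_real]
      exact mul_le_mul (φ.norm_coe_le_norm σ) (h σ σ.2 x x.2) (norm_nonneg _) (norm_nonneg _)
    · filter_upwards [ae_arcLength_ne (Ω := Ω) (z : ℂ)] with σ hσ
      unfold doubleLayer
      have h1 : ContinuousAt (fun x : frontier Ω => outwardNormal Ω σ / ((σ : ℂ) - x)) z :=
        continuousAt_const.div (by fun_prop) (sub_ne_zero.2 hσ)
      exact continuousAt_const.mul (Complex.continuous_ofReal.continuousAt.comp
        (continuousAt_const.mul (Complex.continuous_re.continuousAt.comp h1)))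
  let K₀ : C(frontier Ω, ℂ) →ₗ[ℂ] C(frontier Ω, ℂ) :=
    { toFun := fun φ => ⟨_, hcont φ⟩
      map_add' := fun φ ψ => by
        ext z
        simp only [ContinuousMap.coe_mk, ContinuousMap.add_apply, add_mul]
        exact integral_add (hΩ.integrable_mul_doubleLayer φ z.2)
          (hΩ.integrable_mul_doubleLayer ψ z.2)
      map_smul' := fun c φ => by
        ext z
        simp only [ContinuousMap.coe_mk, ContinuousMap.smul_apply, smul_eq_mul, mul_assoc,
          RingHom.id_apply]
        exact integral_const_mul _ _ }
  refine ⟨K₀.mkContinuous (C * (arcLength Ω).real Set.univ) fun φ => ?_, fun φ z => rfl⟩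
  rw [ContinuousMap.norm_le _ (by positivity)]
  intro z
  refine (norm_integral_le_of_norm_le_const (C := ‖φ‖ * C) (ae_of_all _ fun σ => ?_)).trans
    (le_of_eq (by ring))
  rw [norm_mul, Complex.norm_real]
  exact mul_le_mul (φ.norm_coe_le_norm σ) (h σ σ.2 z z.2) (norm_nonneg _) (norm_nonneg _)

/-- No cancellation is involved: the kernel is bounded, so the truncated integrals converge by
domination, every `σ ≠ z` being eventually included. -/
theorem isSingularDoubleLayerTransform (hΩ : IsSmoothlyBounded Ω)
    {K : C(frontier Ω, ℂ) →L[ℂ] C(frontier Ω, ℂ)} (hK : ∀ φ (z : frontier Ω),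
      K φ z = ∫ σ : frontier Ω, φ σ * (doubleLayer Ω σ z : ℂ) ∂(arcLength Ω)) :
    IsSingularDoubleLayerTransform Ω K := by
  intro φ _ z
  rw [hK]
  have hm : ∀ ε : ℝ, MeasurableSet {σ : frontier Ω | ε < dist σ z} := fun ε =>
    (isOpen_lt continuous_const (by fun_prop)).measurableSet
  simp only [← integral_indicator (hm _)]
  refine tendsto_integral_filter_of_dominated_convergence
    (fun σ : frontier Ω => ‖φ σ * (doubleLayer Ω σ z : ℂ)‖)
    (Eventually.of_forall fun ε =>
      (hΩ.integrable_mul_doubleLayer φ z.2).aestronglyMeasurable.indicator (hm ε))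
    (Eventually.of_forall fun ε => ae_of_all _ fun σ => norm_indicator_le_norm_self _ _)
    (hΩ.integrable_mul_doubleLayer φ z.2).norm ?_
  filter_upwards [ae_arcLength_ne (Ω := Ω) (z : ℂ)] with σ hσ
  have hd : 0 < dist σ z := dist_pos.2 fun h => hσ (h ▸ rfl)
  refine tendsto_const_nhds.congr' ?_
  filter_upwards [Ioo_mem_nhdsGT hd] with ε hε
  rw [Set.indicator_of_mem (by exact hε.2)]

/-- Source of uniqueness for both transforms: Lipschitz functions are Hölder, and dense. -/
theorem eq_of_eqOn_lipschitz (hΩ : IsSmoothlyBounded Ω) {Y : Type*} [TopologicalSpace Y] [T2Space Y]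
    {f g : C(frontier Ω, ℂ) → Y} (hf : Continuous f) (hg : Continuous g)
    (h : ∀ φ : C(frontier Ω, ℂ), ∀ L, LipschitzWith L φ → f φ = g φ) : f = g := by
  have := hΩ.compactSpace
  exact hf.ext_on (dense_lipschitz (frontier Ω)) hg fun φ ⟨L, hL⟩ => h φ L hL

theorem singularDoubleLayerTransform_unique (hΩ : IsSmoothlyBounded Ω)
    {K K' : C(frontier Ω, ℂ) →L[ℂ] C(frontier Ω, ℂ)} (hK : IsSingularDoubleLayerTransform Ω K)
    (hK' : IsSingularDoubleLayerTransform Ω K') : K = K' := by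
  refine DFunLike.coe_injective (hΩ.eq_of_eqOn_lipschitz K.continuous K'.continuous fun φ L hL => ?_)
  ext z
  exact tendsto_nhds_unique (hK φ (isHolder_of_lipschitzWith hL) z)
    (hK' φ (isHolder_of_lipschitzWith hL) z)

theorem interiorDoubleLayerTransform_unique (hΩ : IsSmoothlyBounded Ω)
    {K K' : C(frontier Ω, ℂ) →L[ℂ] harmonicSpace Ω} (hK : IsInteriorDoubleLayerTransform Ω K)
    (hK' : IsInteriorDoubleLayerTransform Ω K') : K = K' := by
  refine DFunLike.coe_injective (hΩ.eq_of_eqOn_lipschitz K.continuous K'.continuous fun φ L hL => ?_)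
  ext z
  have : (𝓝[Ω] (z : ℂ)).NeBot := mem_closure_iff_nhdsWithin_neBot.1 z.2.1
  exact tendsto_nhds_unique (hK φ (isHolder_of_lipschitzWith hL) z)
    (hK' φ (isHolder_of_lipschitzWith hL) z)

/-- The double-layer kernel has uniformly bounded mass in the domain. -/
theorem exists_integral_abs_doubleLayer_le (hΩ : IsSmoothlyBounded Ω) : ∃ M : ℝ, 0 ≤ M ∧
    ∀ w ∈ Ω, ∫ σ : frontier Ω, |doubleLayer Ω σ w| ∂(arcLength Ω) ≤ M := by
  have := hΩ.isFiniteMeasure_arcLength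
  obtain ⟨C, hC, hCb⟩ := hΩ.exists_abs_inner_le
  obtain ⟨D, hD, hDb⟩ := hΩ.exists_integral_poissonKernel_le
  refine ⟨Real.pi⁻¹ * (4 * C * (arcLength Ω).real Set.univ + 5 * D), by positivity,
    fun w hw => ?_⟩
  -- Without boundary points there is no nearest one; the integral is then zero.
  rcases Set.eq_empty_or_nonempty (frontier Ω) with he | hne
  · have : IsEmpty (frontier Ω) := Set.isEmpty_coe_sort.2 he
    rw [Measure.eq_zero_of_isEmpty (arcLength Ω), integral_zero_measure]
    positivity
  obtain ⟨τ, hτ⟩ := hΩ.exists_nearest hne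
  set d := ‖(τ w : ℂ) - w‖ with hd
  have hd0 : 0 < d := norm_pos_iff.2 (sub_ne_zero.2 fun h => hΩ.notMem_frontier hw (h ▸ (τ w).2))
  -- Split `σ - w` at the nearest point `τ w`. The chord estimate makes the first part a bounded
  -- term, and the second, of length `d`, is dominated by a Poisson kernel centred at `τ w`. The
  -- factors 4 and 5 come from `‖σ - τ w‖ ≤ 2‖σ - w‖` and `d ≤ ‖σ - w‖`.
  have hpt : ∀ σ : frontier Ω, |doubleLayer Ω σ w| ≤
      Real.pi⁻¹ * (4 * C + 5 * (d / (d ^ 2 + ‖(σ : ℂ) - τ w‖ ^ 2))) := by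
    intro σ
    have h1 : d ≤ ‖(σ : ℂ) - w‖ := hτ w σ σ.2
    have h2 : ‖(σ : ℂ) - τ w‖ ≤ 2 * ‖(σ : ℂ) - w‖ := norm_sub_nearest_le hτ w σ.2
    have h0 : 0 < ‖(σ : ℂ) - w‖ := hd0.trans_le h1
    have h3 : |⟪outwardNormal Ω σ, (σ : ℂ) - w⟫| ≤ C * ‖(σ : ℂ) - τ w‖ ^ 2 + d := by
      have e : (σ : ℂ) - w = (σ - τ w) + (τ w - w) := by ring
      rw [e, inner_add_right]
      refine (abs_add_le _ _).trans (add_le_add (hCb σ σ.2 _ (τ w).2) ?_)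
      have := abs_real_inner_le_norm (outwardNormal Ω σ) ((τ w : ℂ) - w)
      rwa [hΩ.norm_outwardNormal σ.2, one_mul] at this
    have h4 : ‖(σ : ℂ) - τ w‖ ^ 2 ≤ 4 * ‖(σ : ℂ) - w‖ ^ 2 := by
      nlinarith [norm_nonneg ((σ : ℂ) - τ w)]
    have h5 : d ^ 2 + ‖(σ : ℂ) - τ w‖ ^ 2 ≤ 5 * ‖(σ : ℂ) - w‖ ^ 2 := by
      nlinarith
    rw [doubleLayer_eq, abs_mul, abs_of_pos (inv_pos.2 Real.pi_pos), abs_div,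
      abs_of_nonneg (by positivity : 0 ≤ ‖(σ : ℂ) - w‖ ^ 2)]
    gcongr
    calc _ ≤ (C * ‖(σ : ℂ) - τ w‖ ^ 2 + d) / ‖(σ : ℂ) - w‖ ^ 2 := by gcongr
      _ = C * ‖(σ : ℂ) - τ w‖ ^ 2 / ‖(σ : ℂ) - w‖ ^ 2 + d / ‖(σ : ℂ) - w‖ ^ 2 := add_div _ _ _
      _ ≤ 4 * C + 5 * (d / (d ^ 2 + ‖(σ : ℂ) - τ w‖ ^ 2)) := by
        refine add_le_add ?_ ?_
        · rw [div_le_iff₀ (by positivity)]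
          nlinarith
        · rw [← mul_div_assoc, div_le_div_iff₀ (by positivity) (by positivity)]
          nlinarith
  have hint : Integrable (fun σ : frontier Ω => d / (d ^ 2 + ‖(σ : ℂ) - τ w‖ ^ 2))
      (arcLength Ω) := hΩ.integrable_of_continuous (by
    refine continuous_const.div (by fun_prop) fun σ => ?_
    positivity)
  have hint2 : Integrable (fun σ : frontier Ω =>
      Real.pi⁻¹ * (4 * C + 5 * (d / (d ^ 2 + ‖(σ : ℂ) - τ w‖ ^ 2)))) (arcLength Ω) :=
    ((integrable_const _).add (hint.const_mul 5)).const_mul _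
  refine (integral_mono_of_nonneg (ae_of_all _ fun σ => abs_nonneg _) hint2
    (ae_of_all _ hpt)).trans ?_
  rw [integral_const_mul, integral_add (integrable_const _) (hint.const_mul 5), integral_const,
    smul_eq_mul, integral_const_mul (5 : ℝ)]
  have := hDb (τ w) d hd0
  refine mul_le_mul_of_nonneg_left ?_ (by positivity)
  linarith

end IsSmoothlyBounded

/-- The double-layer potential of a function on the boundary. -/
noncomputable def doubleLayerPotential (Ω : Set ℂ) (φ : C(frontier Ω, ℂ)) (w : ℂ) : ℂ :=
  ∫ σ : frontier Ω, φ σ * (doubleLayer Ω σ w : ℂ) ∂(arcLength Ω)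

theorem inv_pi_mul_re_eq (a q : ℂ) : a * ((Real.pi⁻¹ * q.re : ℝ) : ℂ) =
    (2 * Real.pi : ℂ)⁻¹ * (a * q) +
      (starRingEnd ℂ) ((2 * Real.pi : ℂ)⁻¹ * ((starRingEnd ℂ) a * q)) := by
  have h := Complex.re_eq_add_conj q
  simp only [map_mul, map_inv₀, Complex.conj_conj, Complex.conj_ofReal, map_ofNat]
  push_cast
  rw [h, mul_inv]
  ring

/-! ### The jump relation and the interior transform. -/

namespace IsSmoothlyBounded

variable {Ω : Set ℂ}

/-- The real part of the Cauchy kernel is a half-sum, and moving the conjugation onto `φ` makes both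
terms Cauchy integrals. This splitting into holomorphic and antiholomorphic parts is what places the
boundary values in `ℋ(Ω⁻)`. -/
theorem doubleLayerPotential_eq (hΩ : IsSmoothlyBounded Ω) (φ : C(frontier Ω, ℂ)) {w : ℂ}
    (hw : w ∈ Ω) : doubleLayerPotential Ω φ w =
      cauchyIntegral Ω φ w + (starRingEnd ℂ) (cauchyIntegral Ω (star φ) w) := by
  have h1 := (hΩ.integrable_cauchyKernel φ (hΩ.notMem_frontier hw)).const_mul
    (2 * Real.pi : ℂ)⁻¹
  have h2 := (hΩ.integrable_cauchyKernel (star φ) (hΩ.notMem_frontier hw)).const_mul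
    (2 * Real.pi : ℂ)⁻¹
  have h3 : Integrable (fun σ : frontier Ω => (starRingEnd ℂ) ((2 * Real.pi : ℂ)⁻¹ *
      ((star φ) σ * (outwardNormal Ω σ / ((σ : ℂ) - w))))) (arcLength Ω) :=
    (LinearIsometryEquiv.integrable_comp_iff Complex.conjLIE).2 h2
  rw [cauchyIntegral, cauchyIntegral, ← integral_const_mul, ← integral_const_mul, ← integral_conj,
    ← integral_add h1 h3]
  exact integral_congr_ae (ae_of_all _ fun σ => inv_pi_mul_re_eq _ _)

theorem integrable_mul_doubleLayer_of_mem (hΩ : IsSmoothlyBounded Ω) (φ : C(frontier Ω, ℂ)) {w : ℂ}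
    (hw : w ∈ Ω) : Integrable (fun σ : frontier Ω => φ σ * (doubleLayer Ω σ w : ℂ))
      (arcLength Ω) := by
  refine hΩ.integrable_of_continuous (φ.continuous.mul (Complex.continuous_ofReal.comp
    (continuous_const.mul (Complex.continuous_re.comp (hΩ.continuous_outwardNormal.div
      (by fun_prop) fun σ h => hΩ.notMem_frontier hw ?_)))))
  rw [← sub_eq_zero.1 h]
  exact σ.2

theorem exists_norm_doubleLayerPotential_le (hΩ : IsSmoothlyBounded Ω)
    [CompactSpace (frontier Ω)] : ∃ M : ℝ, 0 ≤ M ∧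
    ∀ w ∈ Ω, ∀ φ : C(frontier Ω, ℂ), ‖doubleLayerPotential Ω φ w‖ ≤ M * ‖φ‖ := by
  obtain ⟨M, hM, h⟩ := hΩ.exists_integral_abs_doubleLayer_le
  refine ⟨M, hM, fun w hw φ => ?_⟩
  have hone := (hΩ.integrable_mul_doubleLayer_of_mem 1 hw).norm
  simp only [ContinuousMap.one_apply, one_mul, Complex.norm_real, Real.norm_eq_abs] at hone
  calc ‖doubleLayerPotential Ω φ w‖
      ≤ ∫ σ : frontier Ω, ‖φ‖ * |doubleLayer Ω σ w| ∂(arcLength Ω) := by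
        refine norm_integral_le_of_norm_le (hone.const_mul _) (ae_of_all _ fun σ => ?_)
        rw [norm_mul, Complex.norm_real, Real.norm_eq_abs]
        gcongr
        exact φ.norm_coe_le_norm σ
    _ = ‖φ‖ * ∫ σ : frontier Ω, |doubleLayer Ω σ w| ∂(arcLength Ω) := integral_const_mul _ _
    _ ≤ M * ‖φ‖ := by
        rw [mul_comm]
        gcongr
        exact h w hw

theorem doubleLayerPotential_sub (hΩ : IsSmoothlyBounded Ω) (φ ψ : C(frontier Ω, ℂ)) {w : ℂ}
    (hw : w ∈ Ω) : doubleLayerPotential Ω (φ - ψ) w =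
      doubleLayerPotential Ω φ w - doubleLayerPotential Ω ψ w := by
  unfold doubleLayerPotential
  simp only [ContinuousMap.sub_apply, sub_mul]
  exact integral_sub (hΩ.integrable_mul_doubleLayer_of_mem φ hw)
    (hΩ.integrable_mul_doubleLayer_of_mem ψ hw)

theorem lipschitzWith_star {φ : C(frontier Ω, ℂ)} {L : NNReal} (hφ : LipschitzWith L φ) :
    LipschitzWith L ⇑(star φ : C(frontier Ω, ℂ)) := LipschitzWith.of_dist_le_mul fun x y => by
  rw [ContinuousMap.star_apply, ContinuousMap.star_apply, dist_star_star]
  exact hφ.dist_le_mul x y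

/-- The two Cauchy integrals contribute `φ z` each. Their remaining integrals recombine into the
double layer of `φ - φ z`, which is `K_Ω φ z - φ z` because the kernel has mass 1 at a boundary
point. -/
theorem tendsto_doubleLayerPotential_of_lipschitzWith (hΩ : IsSmoothlyBounded Ω)
    {φ : C(frontier Ω, ℂ)} {L : NNReal} (hφ : LipschitzWith L φ) (z : frontier Ω) :
    Tendsto (doubleLayerPotential Ω φ) (𝓝[Ω] (z : ℂ)) (𝓝 (φ z +
      ∫ σ : frontier Ω, φ σ * (doubleLayer Ω σ z : ℂ) ∂(arcLength Ω))) := by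
  have hφ' := lipschitzWith_star hφ
  have h1 := hΩ.tendsto_cauchyIntegral hφ z
  have h2 := (Complex.continuous_conj.tendsto _).comp (hΩ.tendsto_cauchyIntegral hφ' z)
  have i1 := hΩ.integrable_sub_mul_outwardNormal_div hφ z |>.const_mul (2 * Real.pi : ℂ)⁻¹
  have i2 := hΩ.integrable_sub_mul_outwardNormal_div hφ' z |>.const_mul (2 * Real.pi : ℂ)⁻¹
  have i3 : Integrable (fun σ : frontier Ω => (starRingEnd ℂ) ((2 * Real.pi : ℂ)⁻¹ *
      (((star φ) σ - (star φ) z) * (outwardNormal Ω σ / ((σ : ℂ) - z))))) (arcLength Ω) :=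
    (LinearIsometryEquiv.integrable_comp_iff Complex.conjLIE).2 i2
  have i4 := hΩ.integrable_mul_doubleLayer (ContinuousMap.const _ (φ z)) z.2
  simp only [ContinuousMap.const_apply] at i4
  have key : (2 * Real.pi : ℂ)⁻¹ * ∫ σ : frontier Ω,
      (φ σ - φ z) * (outwardNormal Ω σ / ((σ : ℂ) - z)) ∂(arcLength Ω) +
      (starRingEnd ℂ) ((2 * Real.pi : ℂ)⁻¹ * ∫ σ : frontier Ω,
      ((star φ) σ - (star φ) z) * (outwardNormal Ω σ / ((σ : ℂ) - z)) ∂(arcLength Ω)) =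
      (∫ σ : frontier Ω, φ σ * (doubleLayer Ω σ z : ℂ) ∂(arcLength Ω)) - φ z := by
    rw [← integral_const_mul, ← integral_const_mul, ← integral_conj, ← integral_add i1 i3]
    conv_rhs => rw [← mul_one (φ z), ← hΩ.integral_doubleLayer z.2, ← integral_const_mul,
      ← integral_sub (hΩ.integrable_mul_doubleLayer φ z.2) i4]
    refine integral_congr_ae (ae_of_all _ fun σ => ?_)
    simp only [← sub_mul]
    rw [doubleLayer, inv_pi_mul_re_eq, map_sub]
    rfl
  refine ((h1.add h2).congr' ?_).trans (le_of_eq (congrArg 𝓝 ?_))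
  · filter_upwards [self_mem_nhdsWithin] with w hw using (hΩ.doubleLayerPotential_eq φ hw).symm
  · rw [map_add]
    simp only [ContinuousMap.star_apply, RCLike.star_def, Complex.conj_conj] at key ⊢
    linear_combination key

/-- The jump relation for the double-layer potential. -/
theorem tendsto_doubleLayerPotential (hΩ : IsSmoothlyBounded Ω)
    {K : C(frontier Ω, ℂ) →L[ℂ] C(frontier Ω, ℂ)} (hK : ∀ φ (z : frontier Ω),
      K φ z = ∫ σ : frontier Ω, φ σ * (doubleLayer Ω σ z : ℂ) ∂(arcLength Ω))
    (φ : C(frontier Ω, ℂ)) (z : frontier Ω) :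
    Tendsto (doubleLayerPotential Ω φ) (𝓝[Ω] (z : ℂ)) (𝓝 (φ z + K φ z)) := by
  have := hΩ.compactSpace
  obtain ⟨M, hM, hMb⟩ := hΩ.exists_norm_doubleLayerPotential_le
  rw [Metric.tendsto_nhds]
  intro ε hε
  have hc : Continuous fun ψ : C(frontier Ω, ℂ) => M * ‖φ - ψ‖ + ‖(ψ + K ψ) - (φ + K φ)‖ := by
    fun_prop
  have hnear : ∀ᶠ ψ in 𝓝 φ, M * ‖φ - ψ‖ + ‖(ψ + K ψ) - (φ + K φ)‖ < ε / 2 :=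
    hc.continuousAt.eventually_lt_const (by simpa using half_pos hε)
  obtain ⟨ψ, ⟨L, hL⟩, hψ⟩ :=
    ((mem_closure_iff_frequently.1 (dense_lipschitz (frontier Ω) φ)).and_eventually hnear).exists
  have hlim := Metric.tendsto_nhds.1 (hΩ.tendsto_doubleLayerPotential_of_lipschitzWith hL z)
    (ε / 2) (half_pos hε)
  filter_upwards [hlim, self_mem_nhdsWithin] with w hw hwΩ
  rw [← hK] at hw
  have h1 : dist (doubleLayerPotential Ω φ w) (doubleLayerPotential Ω ψ w) ≤ M * ‖φ - ψ‖ := by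
    rw [dist_eq_norm, ← hΩ.doubleLayerPotential_sub φ ψ hwΩ]
    exact hMb w hwΩ _
  have h2 : dist (ψ z + K ψ z) (φ z + K φ z) ≤ ‖(ψ + K ψ) - (φ + K φ)‖ := by
    rw [dist_eq_norm]
    exact ContinuousMap.norm_coe_le_norm ((ψ + K ψ) - (φ + K φ)) z
  have := dist_triangle4 (doubleLayerPotential Ω φ w) (doubleLayerPotential Ω ψ w)
    (ψ z + K ψ z) (φ z + K φ z)
  linarith

theorem exists_cauchyIntegral_extension (hΩ : IsSmoothlyBounded Ω) {φ : C(frontier Ω, ℂ)}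
    {L : NNReal} (hφ : LipschitzWith L φ) : ∃ G : ℂ → ℂ, DiffContOnCl ℂ G Ω ∧
      Set.EqOn G (cauchyIntegral Ω φ) Ω :=
  let ⟨G, h1, h2, _⟩ := exists_diffContOnCl_of_tendsto hΩ.isOpen
    (hΩ.differentiableOn_cauchyIntegral φ) fun z hz => ⟨_, hΩ.tendsto_cauchyIntegral hφ ⟨z, hz⟩⟩
  ⟨G, h1, h2⟩

theorem add_singularTransform_eq (hΩ : IsSmoothlyBounded Ω)
    {K : C(frontier Ω, ℂ) →L[ℂ] C(frontier Ω, ℂ)} (hK : ∀ φ (z : frontier Ω),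
      K φ z = ∫ σ : frontier Ω, φ σ * (doubleLayer Ω σ z : ℂ) ∂(arcLength Ω))
    {φ : C(frontier Ω, ℂ)} {F G : ℂ → ℂ} (hF : DiffContOnCl ℂ F Ω) (hG : DiffContOnCl ℂ G Ω)
    (hFe : Set.EqOn F (cauchyIntegral Ω φ) Ω) (hGe : Set.EqOn G (cauchyIntegral Ω (star φ)) Ω) :
    φ + K φ = hF.boundaryMap + star hG.boundaryMap := by
  ext z
  have : (𝓝[Ω] (z : ℂ)).NeBot := mem_closure_iff_nhdsWithin_neBot.1 z.2.1
  refine tendsto_nhds_unique (hΩ.tendsto_doubleLayerPotential hK φ z) ?_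
  have h1 := (hF.tendsto_frontier z.2).add
    ((Complex.continuous_conj.tendsto _).comp (hG.tendsto_frontier z.2))
  refine h1.congr' ?_
  filter_upwards [self_mem_nhdsWithin] with w hw
  rw [hΩ.doubleLayerPotential_eq φ hw, ← hFe hw, ← hGe hw]
  rfl

/-- Lipschitz functions land in `𝒜(Ω⁻) + 𝒜(Ω⁻)*` itself; the closure is needed only to pass to
general continuous ones. -/
theorem add_singularTransform_mem (hΩ : IsSmoothlyBounded Ω)
    {K : C(frontier Ω, ℂ) →L[ℂ] C(frontier Ω, ℂ)} (hK : ∀ φ (z : frontier Ω),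
      K φ z = ∫ σ : frontier Ω, φ σ * (doubleLayer Ω σ z : ℂ) ∂(arcLength Ω))
    (φ : C(frontier Ω, ℂ)) : φ + K φ ∈ harmonicSpace Ω := by
  have := hΩ.compactSpace
  have hcl : IsClosed {φ : C(frontier Ω, ℂ) | φ + K φ ∈ harmonicSpace Ω} :=
    (analyticAddConj Ω).isClosed_topologicalClosure.preimage (by fun_prop)
  refine hcl.closure_subset_iff.2 ?_ (dense_lipschitz (frontier Ω) φ)
  rintro ψ ⟨L, hL⟩
  obtain ⟨F, hF, hFe⟩ := hΩ.exists_cauchyIntegral_extension hL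
  obtain ⟨G, hG, hGe⟩ := hΩ.exists_cauchyIntegral_extension (lipschitzWith_star hL)
  rw [Set.mem_ofPred_eq, hΩ.add_singularTransform_eq hK hF hG hFe hGe]
  exact add_star_mem_harmonicSpace ⟨_, hF.boundaryMap_mem⟩ ⟨_, hG.boundaryMap_mem⟩

theorem exists_interiorTransform (hΩ : IsSmoothlyBounded Ω)
    {K : C(frontier Ω, ℂ) →L[ℂ] C(frontier Ω, ℂ)} (hK : ∀ φ (z : frontier Ω),
      K φ z = ∫ σ : frontier Ω, φ σ * (doubleLayer Ω σ z : ℂ) ∂(arcLength Ω)) :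
    ∃ K' : C(frontier Ω, ℂ) →L[ℂ] harmonicSpace Ω, IsInteriorDoubleLayerTransform Ω K' ∧
      ∀ φ, (K' φ : C(frontier Ω, ℂ)) = φ + K φ :=
  ⟨(ContinuousLinearMap.id ℂ C(frontier Ω, ℂ) + K).codRestrict (harmonicSpace Ω)
    (hΩ.add_singularTransform_mem hK),
    fun φ _ z => hΩ.tendsto_doubleLayerPotential hK φ z, fun _ => rfl⟩

end IsSmoothlyBounded

/-! ### The Cauchy integral formula -/

namespace IsSmoothlyBounded

variable {Ω : Set ℂ}

theorem integral_outwardNormal_smul_eq_zero (hΩ : IsSmoothlyBounded Ω) {F : ℂ → ℂ}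
    (hF : DiffContOnCl ℂ F Ω) :
    ∫ σ : frontier Ω, outwardNormal Ω σ * F σ ∂(arcLength Ω) = 0 := by
  have h := green hΩ isOpen_univ (f := F) (by simpa using hF.continuousOn)
    (by simpa using hF.differentiableOn) (χ := fun _ => 1) contDiff_const (Set.subset_univ _)
  have h0 : ∀ ζ : ℂ, dbar (fun _ : ℂ => (1 : ℂ)) ζ = 0 := fun ζ => by simp [dbar]
  simpa [h0] using h.symm

/-- The difference quotient of `F` at `w` is holomorphic and continuous up to the boundary, so its
integral against the normal vanishes; the total mass `2π` of the kernel does the rest. -/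
theorem cauchyIntegral_boundaryMap (hΩ : IsSmoothlyBounded Ω) {F : ℂ → ℂ}
    (hF : DiffContOnCl ℂ F Ω) {w : ℂ} (hw : w ∈ Ω) :
    cauchyIntegral Ω hF.boundaryMap w = F w := by
  have hd : DiffContOnCl ℂ (dslope F w) Ω :=
    ⟨(Complex.differentiableOn_dslope (hΩ.isOpen.mem_nhds hw)).2 hF.differentiableOn,
      (continuousOn_dslope (mem_of_superset (hΩ.isOpen.mem_nhds hw) subset_closure)).2
        ⟨hF.continuousOn, hF.differentiableAt hΩ.isOpen hw⟩⟩
  have h := hΩ.integral_outwardNormal_smul_eq_zero hd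
  have hnf := hΩ.notMem_frontier hw
  have e : ∀ σ : frontier Ω, outwardNormal Ω σ * dslope F w σ =
      hF.boundaryMap σ * (outwardNormal Ω σ / ((σ : ℂ) - w)) -
        F w * (outwardNormal Ω σ / ((σ : ℂ) - w)) := by
    intro σ
    have hne : (σ : ℂ) ≠ w := fun h => hnf (h ▸ σ.2)
    rw [dslope_of_ne _ hne, slope_def_field, DiffContOnCl.boundaryMap, ContinuousMap.coe_mk]
    ring
  have i2 := hΩ.integrable_cauchyKernel (ContinuousMap.const _ (F w)) hnf
  simp only [ContinuousMap.const_apply] at i2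
  simp only [e] at h
  rw [integral_sub (hΩ.integrable_cauchyKernel _ hnf) i2, integral_const_mul,
    hΩ.integral_outwardNormal_div hw, sub_eq_zero] at h
  rw [cauchyIntegral, h]
  field_simp

end IsSmoothlyBounded

/-! ### Discs -/

theorem norm_eq_of_mem_frontier_ball {r : ℝ} {p : ℂ} (hr : 0 < r)
    (hp : p ∈ frontier (Metric.ball (0 : ℂ) r)) : ‖p‖ = r := by
  rwa [frontier_ball _ hr.ne', mem_sphere_zero_iff_norm] at hp

theorem isLocalDefiningFunction_ball {r : ℝ} {p : ℂ} (hr : 0 < r)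
    (hp : p ∈ frontier (Metric.ball (0 : ℂ) r)) :
    IsLocalDefiningFunction (Metric.ball 0 r) p fun z => ‖z‖ ^ 2 - r ^ 2 where
  smooth := (contDiff_norm_sq ℝ).sub contDiff_const
  deriv_ne h := by
    replace hp := norm_eq_of_mem_frontier_ball hr hp
    have h1 : HasFDerivAt (fun z : ℂ => ‖z‖ ^ 2 - r ^ 2) (2 • innerSL ℝ p) p :=
      (hasStrictFDerivAt_norm_sq p).hasFDerivAt.sub_const _
    rw [h1.fderiv] at h
    have := congrArg (fun T : ℂ →L[ℝ] ℝ => T p) h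
    simp [hp, hr.ne'] at this
  eventually_iff := Eventually.of_forall fun z => by
    rw [mem_ball_zero_iff, sub_neg, sq_lt_sq₀ (norm_nonneg z) hr.le]

theorem isSmoothlyBounded_ball {r : ℝ} (hr : 0 < r) : IsSmoothlyBounded (Metric.ball (0 : ℂ) r) :=
  ⟨Metric.isOpen_ball, Metric.isBounded_ball, fun _ hp => ⟨_, isLocalDefiningFunction_ball hr hp⟩⟩

theorem outwardNormal_ball {r : ℝ} {p : ℂ} (hr : 0 < r)
    (hp : p ∈ frontier (Metric.ball (0 : ℂ) r)) : outwardNormal (Metric.ball 0 r) p = p / r := by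
  rw [outwardNormal_eq (isSmoothlyBounded_ball hr).isOpen hp (isLocalDefiningFunction_ball hr hp)]
  replace hp := norm_eq_of_mem_frontier_ball hr hp
  have h1 : HasGradientAt (fun z : ℂ => ‖z‖ ^ 2 - r ^ 2) ((2 : ℝ) • p) p := by
    rw [hasGradientAt_iff_hasFDerivAt]
    have h1 : HasFDerivAt (fun z : ℂ => ‖z‖ ^ 2 - r ^ 2) (2 • innerSL ℝ p) p :=
      (hasStrictFDerivAt_norm_sq p).hasFDerivAt.sub_const _
    refine h1.congr_fderiv ?_
    ext v
    simp [two_smul]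
  rw [h1.gradient, norm_smul, hp, smul_smul, Complex.real_smul]
  have : (r : ℂ) ≠ 0 := Complex.ofReal_ne_zero.2 hr.ne'
  push_cast
  rw [Real.norm_ofNat]
  push_cast
  field_simp

/-- On the circle `n(σ)/σ` is the constant `1/r`, so the length is read off from the mass `2π` of
the Cauchy kernel at the centre. -/
theorem measureReal_arcLength_ball {r : ℝ} (hr : 0 < r) :
    (arcLength (Metric.ball (0 : ℂ) r)).real Set.univ = 2 * Real.pi * r := by
  have h := (isSmoothlyBounded_ball hr).integral_outwardNormal_div (Metric.mem_ball_self hr)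
  have e : ∀ σ : frontier (Metric.ball (0 : ℂ) r),
      outwardNormal (Metric.ball 0 r) σ / ((σ : ℂ) - 0) = (r : ℂ)⁻¹ := by
    intro σ
    have hσ := norm_eq_of_mem_frontier_ball hr σ.2
    have h0 : (σ : ℂ) ≠ 0 := fun h => by rw [h, norm_zero] at hσ; exact hr.ne hσ
    rw [outwardNormal_ball hr σ.2, sub_zero, div_div, mul_comm, ← div_div, div_self h0, one_div]
  simp only [e] at h
  rw [integral_const, Complex.real_smul] at h
  have hr' : (r : ℂ) ≠ 0 := Complex.ofReal_ne_zero.2 hr.ne'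
  rw [← Complex.ofReal_inj]
  push_cast
  field_simp at h
  linear_combination h

/-! ### Smooth cutoffs -/

/-- A continuous weight `a` on a compact set `K` that represents the holomorphic functional calculus
for operators with spectrum in `S`. -/
structure IsCutoffWeight (E : Type*) [NormedAddCommGroup E] [NormedSpace ℂ E] (Ω S K : Set ℂ)
    (a : ℂ → ℂ) : Prop where
  isCompact : IsCompact K
  subset : K ⊆ Ω
  disjoint : Disjoint K S
  continuous : Continuous a
  setIntegral_mul : ∀ h : ℂ → ℂ, DifferentiableOn ℂ h Ω → ∫ ζ in K, a ζ * h ζ = 0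
  setIntegral_smul : ∀ (Ω' : Set ℂ) (_ : IsSmoothlyBounded Ω') (_ : Ω ⊆ Ω') (F : ℂ → E)
    (_ : ContinuousOn F (closure Ω' ∩ Sᶜ)) (_ : DifferentiableOn ℂ F (Ω' ∩ Sᶜ)),
    ∫ ζ in K, a ζ • F ζ =
      (2 * Real.pi : ℂ)⁻¹ • ∫ σ : frontier Ω', outwardNormal Ω' σ • F σ ∂(arcLength Ω')

theorem setIntegral_tsupport_dbar_smul {E : Type*} [NormedAddCommGroup E] [NormedSpace ℂ E]
    {ψ : ℂ → ℂ} {s : Set ℂ} (hs : tsupport (dbar ψ) ⊆ s) (F : ℂ → E) :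
    ∫ ζ in tsupport (dbar ψ), (-(2 * Real.pi : ℂ)⁻¹ * dbar ψ ζ) • F ζ =
      -(2 * Real.pi : ℂ)⁻¹ • ∫ ζ in s, dbar ψ ζ • F ζ := by
  have h0 : ∀ ζ ∉ tsupport (dbar ψ), dbar ψ ζ • F ζ = 0 := fun ζ hζ => by
    rw [image_eq_zero_of_notMem_tsupport hζ, zero_smul]
  rw [setIntegral_eq_integral_of_forall_compl_eq_zero fun ζ hζ => h0 ζ fun h => hζ (hs h),
    ← setIntegral_eq_integral_of_forall_compl_eq_zero h0, ← integral_smul]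
  simp only [mul_smul]

/-- The weight is `-(2π)⁻¹ dbar ψ` for a cutoff `ψ` equal to 1 near `S` and supported in `Ω`.
Green's theorem with `ψ` has no boundary term; with `1 - ψ` it ignores singularities of `F` on `S`
and returns the full boundary integral. The weight does not depend on the larger domain `Ω'`, which
lets the contour be pushed out to large circles. -/
theorem IsSmoothlyBounded.exists_isCutoffWeight (E : Type*) [NormedAddCommGroup E] [NormedSpace ℂ E]
    [CompleteSpace E] {Ω S : Set ℂ} (hΩ : IsSmoothlyBounded Ω)
    (hS : IsCompact S) (hSΩ : S ⊆ Ω) : ∃ K a, IsCutoffWeight E Ω S K a := by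
  obtain ⟨K₀, hK₀, hSK, hKΩ⟩ := exists_compact_between hS hΩ.isOpen hSΩ
  obtain ⟨f, hf1, hf0, -⟩ := exists_contMDiffMap_one_nhds_of_subset_interior (n := 1)
    (modelWithCornersSelf ℝ ℂ) hS.isClosed hSK
  let ψ : ℂ → ℂ := fun ζ => (f ζ : ℂ)
  have hψ : ContDiff ℝ 1 ψ := Complex.ofRealCLM.contDiff.comp f.contMDiff.contDiff
  have hψK : tsupport ψ ⊆ K₀ := closure_minimal (fun ζ hζ => by
    by_contra h
    exact hζ (by simp [ψ, hf0 ζ h])) hK₀.isClosed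
  have hψ1 : ∀ ζ ∈ S, ψ =ᶠ[𝓝 ζ] fun _ => 1 := fun ζ hζ =>
    (eventually_nhdsSet_iff_forall.1 hf1 ζ hζ).mono fun x hx => by simp [ψ, hx]
  let K := tsupport (dbar ψ)
  have hKψ : K ⊆ tsupport ψ := closure_minimal (fun ζ hζ => by
    by_contra h
    exact hζ (dbar_of_notMem_tsupport h)) (isClosed_tsupport ψ)
  have hKS : Disjoint K S := by
    rw [Set.disjoint_left]
    intro ζ hζ hS
    refine (notMem_tsupport_iff_eventuallyEq.2 ?_) hζ
    filter_upwards [(hψ1 ζ hS).eventuallyEq_nhds] with x hx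
    rw [dbar_congr hx]
    simp [dbar]
  refine ⟨K, fun ζ => -(2 * Real.pi : ℂ)⁻¹ * dbar ψ ζ, ?_, (hKψ.trans hψK).trans hKΩ, hKS,
    continuous_const.mul hψ.continuous_dbar, fun h hh => ?_, ?_⟩
  · exact hK₀.of_isClosed_subset (isClosed_tsupport _) (hKψ.trans hψK)
  · have h1 := green hΩ hΩ.isOpen (f := h) (hh.continuousOn.mono Set.inter_subset_right)
      (hh.mono Set.inter_subset_right) hψ (hψK.trans hKΩ)
    have h2 := setIntegral_tsupport_dbar_smul ((hKψ.trans hψK).trans hKΩ) h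
    rw [h1] at h2
    simp only [smul_eq_mul] at h2
    rw [h2]
    refine mul_eq_zero_of_right _ (integral_eq_zero_of_ae (ae_of_all _ fun σ => ?_))
    have : ψ σ = 0 := image_eq_zero_of_notMem_tsupport fun h =>
      hΩ.notMem_frontier (hKΩ (hψK h)) σ.2
    simp [this]
  · intro Ω' hΩ' hsub F hFc hFd
    have hc : ContDiff ℝ 1 fun ζ => 1 - ψ ζ := contDiff_const.sub hψ
    have h1 := green hΩ' hS.isClosed.isOpen_compl hFc hFd hc (by
      intro ζ hζ hS
      refine (notMem_tsupport_iff_eventuallyEq.2 ?_) hζ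
      filter_upwards [hψ1 ζ hS] with x hx
      simp [hx])
    have h2 : ∀ ζ, dbar (fun ζ => 1 - ψ ζ) ζ = -dbar ψ ζ := fun ζ => by
      unfold dbar
      rw [fderiv_const_sub]
      simp
      ring
    simp only [h2, neg_smul, integral_neg] at h1
    rw [setIntegral_tsupport_dbar_smul (((hKψ.trans hψK).trans hKΩ).trans hsub), neg_smul, ← smul_neg, h1]
    congr 1
    refine integral_congr_ae (ae_of_all _ fun σ => ?_)
    have : ψ σ = 0 := image_eq_zero_of_notMem_tsupport fun h =>
      hΩ'.notMem_frontier (hsub (hKΩ (hψK h))) σ.2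
    simp [this]

/-! ### The holomorphic functional calculus -/

section AnalyticCalculus

variable {H : Type*} [NormedAddCommGroup H] [InnerProductSpace ℂ H]
  {A : H →L[ℂ] H} {Ω : Set ℂ}

theorem IsSmoothlyBounded.notMem_spectrum (hΩ : IsSmoothlyBounded Ω) (hA : spectrum ℂ A ⊆ Ω)
    (σ : frontier Ω) : (σ : ℂ) ∉ spectrum ℂ A := fun h => hΩ.notMem_frontier (hA h) σ.2

theorem sub_mul_resolvent {ζ : ℂ} (hζ : ζ ∉ spectrum ℂ A) :
    (algebraMap ℂ (H →L[ℂ] H) ζ - A) * resolvent A ζ = 1 :=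
  Ring.mul_inverse_cancel _ (Set.notMem_compl_iff.1 hζ)

theorem smul_resolvent {ζ : ℂ} (hζ : ζ ∉ spectrum ℂ A) :
    ζ • resolvent A ζ = 1 + A * resolvent A ζ := by
  have h := sub_mul_resolvent hζ
  rw [sub_mul, Algebra.algebraMap_eq_smul_one, smul_mul_assoc, one_mul] at h
  rw [← h, sub_add_cancel]

variable [CompleteSpace H]

theorem continuousOn_resolvent (A : H →L[ℂ] H) : ContinuousOn (resolvent A) (spectrum ℂ A)ᶜ :=
  fun _ hζ => (spectrum.hasDerivAt_resolvent_const_left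
    (Set.notMem_compl_iff.1 hζ)).continuousAt.continuousWithinAt

theorem differentiableOn_resolvent (A : H →L[ℂ] H) :
    DifferentiableOn ℂ (resolvent A) (spectrum ℂ A)ᶜ :=
  fun _ hζ => (spectrum.hasDerivAt_resolvent_const_left
    (Set.notMem_compl_iff.1 hζ)).differentiableAt.differentiableWithinAt

theorem IsSmoothlyBounded.continuous_resolvent (hΩ : IsSmoothlyBounded Ω)
    (hA : spectrum ℂ A ⊆ Ω) : Continuous fun σ : frontier Ω => resolvent A (σ : ℂ) :=
  (continuousOn_resolvent A).comp_continuous continuous_subtype_val (hΩ.notMem_spectrum hA)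

theorem analyticCalculus_eq (A : H →L[ℂ] H) (f : C(frontier Ω, ℂ)) :
    analyticCalculus Ω A f = (2 * Real.pi : ℂ)⁻¹ •
      ∫ σ : frontier Ω, (f σ * outwardNormal Ω σ) • resolvent A (σ : ℂ) ∂(arcLength Ω) := by
  have e : ∀ σ : frontier Ω, (f σ * (Complex.I * outwardNormal Ω σ)) • resolvent A (σ : ℂ) =
      Complex.I • ((f σ * outwardNormal Ω σ) • resolvent A (σ : ℂ)) := fun σ => by
    rw [smul_smul]
    ring_nf
  rw [analyticCalculus]
  simp only [e]
  rw [integral_smul, smul_smul, mul_inv _ Complex.I, mul_assoc, inv_mul_cancel₀ Complex.I_ne_zero,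
    mul_one]

theorem IsSmoothlyBounded.integrable_smul_resolvent (hΩ : IsSmoothlyBounded Ω)
    (hA : spectrum ℂ A ⊆ Ω) (f : C(frontier Ω, ℂ)) :
    Integrable (fun σ : frontier Ω => (f σ * outwardNormal Ω σ) • resolvent A (σ : ℂ))
      (arcLength Ω) :=
  hΩ.integrable_of_continuous ((f.continuous.mul hΩ.continuous_outwardNormal).smul
    (hΩ.continuous_resolvent hA))

theorem analyticCalculus_add (hΩ : IsSmoothlyBounded Ω) (hA : spectrum ℂ A ⊆ Ω)
    (f g : C(frontier Ω, ℂ)) :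
    analyticCalculus Ω A (f + g) = analyticCalculus Ω A f + analyticCalculus Ω A g := by
  simp only [analyticCalculus_eq, ContinuousMap.add_apply, add_mul, add_smul]
  rw [integral_add (hΩ.integrable_smul_resolvent hA f) (hΩ.integrable_smul_resolvent hA g),
    smul_add]

theorem analyticCalculus_smul (A : H →L[ℂ] H) (c : ℂ) (f : C(frontier Ω, ℂ)) :
    analyticCalculus Ω A (c • f) = c • analyticCalculus Ω A f := by
  simp only [analyticCalculus_eq, ContinuousMap.smul_apply, smul_eq_mul, mul_assoc, mul_smul]
  rw [integral_smul, smul_comm]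

variable {K : Set ℂ} {a : ℂ → ℂ}

namespace IsCutoffWeight

/-- The area integral lives on a compact set away from both the spectrum and the boundary, which
allows norm bounds and Fubini where the contour integral does not. -/
theorem analyticCalculus_eq (ha : IsCutoffWeight (H →L[ℂ] H) Ω (spectrum ℂ A) K a)
    {Ω' : Set ℂ} (hΩ' : IsSmoothlyBounded Ω') (hsub : Ω ⊆ Ω') {f : C(frontier Ω', ℂ)}
    {F : ℂ → ℂ} (hF : DiffContOnCl ℂ F Ω') (hf : ∀ z : frontier Ω', f z = F z) :
    analyticCalculus Ω' A f = ∫ ζ in K, (a ζ * F ζ) • resolvent A ζ := by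
  have h := ha.setIntegral_smul Ω' hΩ' hsub (fun ζ => F ζ • resolvent A ζ)
    ((hF.continuousOn.mono Set.inter_subset_left).smul
      ((continuousOn_resolvent A).mono Set.inter_subset_right))
    ((hF.differentiableOn.mono Set.inter_subset_left).smul
      ((differentiableOn_resolvent A).mono Set.inter_subset_right))
  simp only [smul_smul] at h
  rw [h, _root_.analyticCalculus_eq]
  simp only [hf, mul_comm]

theorem continuousOn_resolvent (ha : IsCutoffWeight (H →L[ℂ] H) Ω (spectrum ℂ A) K a) :
    ContinuousOn (resolvent A) K :=
  (_root_.continuousOn_resolvent A).mono fun _ h => Set.disjoint_left.1 ha.disjoint h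

/-- The functional calculus is unital. -/
theorem setIntegral_resolvent (ha : IsCutoffWeight (H →L[ℂ] H) Ω (spectrum ℂ A) K a)
    (hΩ : Bornology.IsBounded Ω) (hA : spectrum ℂ A ⊆ Ω) :
    ∫ ζ in K, a ζ • resolvent A ζ = 1 := by
  set T := ∫ ζ in K, a ζ • resolvent A ζ with hT
  rw [← sub_eq_zero, ← norm_le_zero_iff]
  refine le_of_forall_pos_le_add fun ε hε => ?_
  obtain ⟨r₀, hr₀⟩ := hΩ.subset_ball 0
  have hlim : Tendsto (fun ζ => ‖A‖ * ‖resolvent A ζ‖) (Bornology.cobounded ℂ) (𝓝 0) := by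
    simpa using ((spectrum.resolvent_tendsto_cobounded A (𝕜 := ℂ)).norm).const_mul ‖A‖
  obtain ⟨r₁, hr₁⟩ : ∃ r₁, ∀ ζ : ℂ, r₁ ≤ ‖ζ‖ → ‖A‖ * ‖resolvent A ζ‖ < ε := by
    have h := hlim.eventually_lt_const hε
    rw [← comap_norm_atTop, eventually_comap, eventually_atTop] at h
    exact h.imp fun r h ζ hζ => h _ hζ ζ rfl
  obtain ⟨r, hr, hr0, hr1⟩ : ∃ r : ℝ, 0 < r ∧ r₀ ≤ r ∧ r₁ ≤ r :=
    ⟨max 1 (max r₀ r₁), by positivity, by simp, by simp⟩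
  have hsub : Ω ⊆ Metric.ball 0 r := hr₀.trans (Metric.ball_subset_ball hr0)
  have hB := isSmoothlyBounded_ball hr
  have hAB := hA.trans hsub
  have h1 := ha.analyticCalculus_eq hB hsub (f := 1) (F := fun _ => 1) diffContOnCl_const
    fun _ => rfl
  simp only [mul_one] at h1
  have hrC : (r : ℂ) ≠ 0 := Complex.ofReal_ne_zero.2 hr.ne'
  -- On a large circle `σ (σ - A)⁻¹ = 1 + A (σ - A)⁻¹`; the first term integrates to the identity,
  -- and the second is below `ε` by the choice of `r`.
  have e : ∀ σ : frontier (Metric.ball (0 : ℂ) r),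
      ((1 : C(frontier (Metric.ball (0 : ℂ) r), ℂ)) σ * outwardNormal (Metric.ball 0 r) σ) •
        resolvent A (σ : ℂ) = (r : ℂ)⁻¹ • 1 + (r : ℂ)⁻¹ • (A * resolvent A (σ : ℂ)) := by
    intro σ
    rw [ContinuousMap.one_apply, one_mul, outwardNormal_ball hr σ.2, div_eq_inv_mul, mul_smul,
      smul_resolvent (hB.notMem_spectrum hAB σ), smul_add]
  have hfin := hB.isFiniteMeasure_arcLength
  have hi : Integrable (fun σ : frontier (Metric.ball (0 : ℂ) r) =>
      (r : ℂ)⁻¹ • (A * resolvent A (σ : ℂ))) (arcLength (Metric.ball 0 r)) :=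
    hB.integrable_of_continuous (by
      have := hB.continuous_resolvent hAB
      fun_prop)
  rw [_root_.analyticCalculus_eq] at h1
  simp only [e] at h1
  rw [integral_add (integrable_const _) hi, integral_const, measureReal_arcLength_ball hr,
    smul_add, ← hT] at h1
  have e1 : (2 * Real.pi : ℂ)⁻¹ • (2 * Real.pi * r : ℝ) • (r : ℂ)⁻¹ • (1 : H →L[ℂ] H) = 1 := by
    rw [← Complex.coe_smul, smul_smul, smul_smul]
    have : (Real.pi : ℂ) ≠ 0 := Complex.ofReal_ne_zero.2 Real.pi_ne_zero
    push_cast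
    rw [show (2 * Real.pi : ℂ)⁻¹ * (2 * Real.pi * r) * (r : ℂ)⁻¹ = 1 by field_simp, one_smul]
  rw [e1] at h1
  rw [← h1, add_sub_cancel_left, norm_smul, zero_add]
  have h2 : ‖∫ σ : frontier (Metric.ball (0 : ℂ) r), (r : ℂ)⁻¹ • (A * resolvent A (σ : ℂ))
      ∂(arcLength (Metric.ball 0 r))‖ ≤ r⁻¹ * ε * (2 * Real.pi * r) := by
    rw [← measureReal_arcLength_ball hr]
    refine norm_integral_le_of_norm_le_const (ae_of_all _ fun σ => ?_)
    rw [norm_smul, norm_inv, Complex.norm_of_nonneg hr.le]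
    gcongr
    refine (norm_mul_le _ _).trans (hr₁ σ ?_).le
    rwa [norm_eq_of_mem_frontier_ball hr σ.2]
  calc _ ≤ ‖(2 * Real.pi : ℂ)⁻¹‖ * (r⁻¹ * ε * (2 * Real.pi * r)) := by gcongr
    _ = ε := by
      have hp := Real.pi_pos
      rw [norm_inv, norm_mul, Complex.norm_of_nonneg hp.le, Complex.norm_ofNat]
      field_simp

theorem analyticCalculus_one (ha : IsCutoffWeight (H →L[ℂ] H) Ω (spectrum ℂ A) K a)
    (hΩ : IsSmoothlyBounded Ω) (hA : spectrum ℂ A ⊆ Ω) : analyticCalculus Ω A 1 = 1 := by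
  rw [ha.analyticCalculus_eq hΩ subset_rfl (F := fun _ => 1) diffContOnCl_const fun _ => rfl]
  simpa using ha.setIntegral_resolvent hΩ.isBounded hA

/-- The functional calculus maps the Cauchy kernel to the resolvent. -/
theorem setIntegral_inv_sub_smul_resolvent
    (ha : IsCutoffWeight (H →L[ℂ] H) Ω (spectrum ℂ A) K a)
    (hΩ : IsSmoothlyBounded Ω) (hA : spectrum ℂ A ⊆ Ω) {σ : ℂ} (hσ : σ ∈ frontier Ω) :
    ∫ ζ in K, (a ζ * (σ - ζ)⁻¹) • resolvent A ζ = resolvent A σ := by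
  have hne : ∀ ζ ∈ Ω, σ - ζ ≠ 0 := fun ζ hζ h =>
    hΩ.notMem_frontier hζ (by rwa [← sub_eq_zero.1 h])
  have hc : ContinuousOn (fun ζ => (σ - ζ)⁻¹) Ω :=
    ContinuousOn.inv₀ (by fun_prop) hne
  have h0 := ha.setIntegral_mul (fun ζ => (σ - ζ)⁻¹)
    (DifferentiableOn.inv (by fun_prop) hne)
  have hcK := hc.mono ha.subset
  have hi : IntegrableOn (fun ζ => (a ζ * (σ - ζ)⁻¹) • resolvent A ζ) K :=
    ((ha.continuous.continuousOn.mul hcK).smul ha.continuousOn_resolvent).integrableOn_compact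
      ha.isCompact
  have hi1 : IntegrableOn (fun ζ => a ζ • resolvent A ζ) K :=
    (ha.continuous.continuousOn.smul ha.continuousOn_resolvent).integrableOn_compact ha.isCompact
  have hi2 : IntegrableOn (fun ζ => (a ζ * (σ - ζ)⁻¹) • (1 : H →L[ℂ] H)) K :=
    ((ha.continuous.continuousOn.mul hcK).smul continuousOn_const).integrableOn_compact
      ha.isCompact
  -- Split `σ - A = (σ - ζ) + (ζ - A)`. The first term cancels the Cauchy kernel and leaves `γ(1) =
  -- 1`; the second cancels the resolvent and leaves the weight integrated against a holomorphic
  -- function, which is zero.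
  have key : (algebraMap ℂ (H →L[ℂ] H) σ - A) *
      ∫ ζ in K, (a ζ * (σ - ζ)⁻¹) • resolvent A ζ = 1 := by
    rw [← integral_const_mul_of_integrable hi]
    have e : ∀ ζ ∈ K, (algebraMap ℂ (H →L[ℂ] H) σ - A) * ((a ζ * (σ - ζ)⁻¹) • resolvent A ζ) =
        a ζ • resolvent A ζ + (a ζ * (σ - ζ)⁻¹) • 1 := by
      intro ζ hζ
      have h1 := sub_mul_resolvent (Set.disjoint_left.1 ha.disjoint hζ)
      have h2 : (algebraMap ℂ (H →L[ℂ] H) σ - A) = (σ - ζ) • 1 +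
          (algebraMap ℂ (H →L[ℂ] H) ζ - A) := by
        rw [Algebra.algebraMap_eq_smul_one, Algebra.algebraMap_eq_smul_one, sub_smul]
        abel
      rw [h2, mul_smul_comm, add_mul, h1, smul_mul_assoc, one_mul, smul_add, smul_smul, mul_assoc,
        inv_mul_cancel₀ (hne ζ (ha.subset hζ)), mul_one]
    rw [setIntegral_congr_fun ha.isCompact.measurableSet e, integral_add hi1 hi2,
      ha.setIntegral_resolvent hΩ.isBounded hA, integral_smul_const, h0, zero_smul, add_zero]
  have hu : IsUnit (algebraMap ℂ (H →L[ℂ] H) σ - A) :=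
    Set.notMem_compl_iff.1 (hΩ.notMem_spectrum hA ⟨σ, hσ⟩)
  rw [← hu.mul_right_inj, key, sub_mul_resolvent (hΩ.notMem_spectrum hA ⟨σ, hσ⟩)]

/-- The functional calculus of a Cauchy integral. -/
theorem setIntegral_cauchyIntegral_smul_resolvent
    (ha : IsCutoffWeight (H →L[ℂ] H) Ω (spectrum ℂ A) K a)
    (hΩ : IsSmoothlyBounded Ω) (hA : spectrum ℂ A ⊆ Ω) (φ : C(frontier Ω, ℂ)) :
    ∫ ζ in K, (a ζ * cauchyIntegral Ω φ ζ) • resolvent A ζ = (2 * Real.pi : ℂ)⁻¹ •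
      ∫ σ : frontier Ω, (φ σ * outwardNormal Ω σ) • resolvent A (σ : ℂ) ∂(arcLength Ω) := by
  have := hΩ.compactSpace
  have := hΩ.isFiniteMeasure_arcLength
  have e : ∀ ζ, (a ζ * cauchyIntegral Ω φ ζ) • resolvent A ζ = (2 * Real.pi : ℂ)⁻¹ •
      ∫ σ : frontier Ω, (a ζ * (φ σ * (outwardNormal Ω σ / ((σ : ℂ) - ζ)))) • resolvent A ζ
        ∂(arcLength Ω) := by
    intro ζ
    rw [integral_smul_const, integral_const_mul, smul_smul, cauchyIntegral,
      mul_left_comm]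
  -- `K` and `∂Ω` are disjoint compact sets, so the integrand is jointly continuous and Fubini
  -- applies.
  have hint : Integrable (Function.uncurry fun (ζ : ℂ) (σ : frontier Ω) =>
      (a ζ * (φ σ * (outwardNormal Ω σ / ((σ : ℂ) - ζ)))) • resolvent A ζ)
      ((volume.restrict K).prod (arcLength Ω)) := by
    have hc : ContinuousOn (Function.uncurry fun (ζ : ℂ) (σ : frontier Ω) =>
        (a ζ * (φ σ * (outwardNormal Ω σ / ((σ : ℂ) - ζ)))) • resolvent A ζ)
        (K ×ˢ Set.univ) := by
      refine ContinuousOn.smul (ContinuousOn.mul (ha.continuous.comp continuous_fst).continuousOn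
        (ContinuousOn.mul (φ.continuous.comp continuous_snd).continuousOn (ContinuousOn.div
          (hΩ.continuous_outwardNormal.comp continuous_snd).continuousOn (by fun_prop) ?_))) ?_
      · rintro ⟨ζ, σ⟩ ⟨hζ, -⟩ h
        exact hΩ.notMem_frontier (ha.subset hζ) (by
          rw [← sub_eq_zero.1 h]
          exact σ.2)
      · exact ha.continuousOn_resolvent.comp continuousOn_fst fun x hx => hx.1
    have h := hc.integrableOn_compact (μ := volume.prod (arcLength Ω))
      (ha.isCompact.prod isCompact_univ)
    rwa [IntegrableOn, ← Measure.prod_restrict, Measure.restrict_univ] at h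
  simp only [e]
  rw [integral_smul, integral_integral_swap hint]
  congr 1
  refine integral_congr_ae (ae_of_all _ fun σ => ?_)
  dsimp only
  rw [← ha.setIntegral_inv_sub_smul_resolvent hΩ hA σ.2, ← integral_smul]
  refine integral_congr_ae (ae_of_all _ fun ζ => ?_)
  simp only [smul_smul]
  ring_nf

end IsCutoffWeight

end AnalyticCalculus

/-! ### Bounds for conjugate functions -/

/-- The maximum principle for the real part. -/
theorem DiffContOnCl.re_le_of_forall_frontier {Ω : Set ℂ} (hb : Bornology.IsBounded Ω) {P : ℂ → ℂ}
    (hP : DiffContOnCl ℂ P Ω) {N : ℝ} (h : ∀ z ∈ frontier Ω, (P z).re ≤ N) {z : ℂ}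
    (hz : z ∈ closure Ω) : (P z).re ≤ N := by
  have hd : DiffContOnCl ℂ (fun z => Complex.exp (P z)) Ω :=
    ⟨hP.differentiableOn.cexp, hP.continuousOn.cexp⟩
  have := Complex.norm_le_of_forall_mem_frontier_norm_le hb hd (C := Real.exp N)
    (fun z hz => by rw [Complex.norm_exp]; exact Real.exp_le_exp.2 (h z hz)) hz
  rwa [Complex.norm_exp, Real.exp_le_exp] at this

/-- Borel–Carathéodory for `P(c + ·) - P(c)`, whose real part is at most `2N`; at half the radius
its factor `‖w‖/(r - ‖w‖)` is at most 1, which gives `4N`. -/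
theorem norm_sub_le_of_re_le {P : ℂ → ℂ} {c : ℂ} {r N : ℝ} (hr : 0 < r) (hN : 0 < N)
    (hP : DifferentiableOn ℂ P (Metric.ball c r)) (h : ∀ z ∈ Metric.ball c r, |(P z).re| ≤ N)
    {z : ℂ} (hz : z ∈ Metric.ball c (r / 2)) : ‖P z - P c‖ ≤ 4 * N := by
  have hm : ∀ w ∈ Metric.ball (0 : ℂ) r, c + w ∈ Metric.ball c r := fun w hw => by
    simpa using hw
  have hzn : ‖z - c‖ < r / 2 := by rwa [Metric.mem_ball, dist_eq_norm] at hz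
  have hb := Complex.borelCaratheodory_zero (f := fun w => P (c + w) - P c) (M := 2 * N)
    (by positivity) (R := r) (z := z - c)
    ((hP.comp (by fun_prop) hm).sub_const _) (fun w hw => ?_) hr
    (by rw [mem_ball_zero_iff]; linarith) (by simp)
  · simp only [add_sub_cancel] at hb
    refine hb.trans ?_
    rw [div_le_iff₀ (by linarith)]
    nlinarith
  · have h1 := abs_le.1 (h _ (hm w hw))
    have h2 := abs_le.1 (h c (Metric.mem_ball_self hr))
    rw [Set.mem_ofPred_eq, Complex.sub_re]
    linarith [h1.2, h2.1]

/-- A harmonic function controls its conjugate on compact subsets. -/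
theorem exists_norm_sub_le_of_re_le {Ω K : Set ℂ} (hΩ : IsOpen Ω) (hb : Bornology.IsBounded Ω)
    (hc : IsPreconnected Ω) (hK : IsCompact K) (hKΩ : K ⊆ Ω) {z₀ : ℂ} (hz₀ : z₀ ∈ Ω) :
    ∃ C : ℝ, ∀ (P : ℂ → ℂ) (N : ℝ), DiffContOnCl ℂ P Ω → 0 < N →
      (∀ z ∈ frontier Ω, |(P z).re| ≤ N) → ∀ z ∈ K, ‖P z - P z₀‖ ≤ C * N := by
  have hmax : ∀ (P : ℂ → ℂ) (N : ℝ), DiffContOnCl ℂ P Ω →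
      (∀ z ∈ frontier Ω, |(P z).re| ≤ N) → ∀ z ∈ Ω, |(P z).re| ≤ N := by
    intro P N hP h z hz
    rw [abs_le']
    refine ⟨hP.re_le_of_forall_frontier hb (fun z hz => (le_abs_self _).trans (h z hz))
      (subset_closure hz), ?_⟩
    have := hP.neg.re_le_of_forall_frontier hb (N := N)
      (fun z hz => (neg_le_abs _).trans (h z hz)) (subset_closure hz)
    simpa using this
  have hloc : ∀ c ∈ Ω, ∀ᶠ z in 𝓝 c, ∀ (P : ℂ → ℂ) (N : ℝ), DiffContOnCl ℂ P Ω → 0 < N →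
      (∀ z ∈ frontier Ω, |(P z).re| ≤ N) → ‖P z - P c‖ ≤ 4 * N := by
    intro c hc
    obtain ⟨r, hr, hrΩ⟩ := Metric.isOpen_iff.1 hΩ c hc
    filter_upwards [Metric.ball_mem_nhds c (half_pos hr)] with z hz P N hP hN h
    exact norm_sub_le_of_re_le hr hN (hP.differentiableOn.mono hrΩ)
      (fun z hz => hmax P N hP h z (hrΩ hz)) hz
  have hpt : ∀ c ∈ Ω, ∃ C : ℝ, ∀ (P : ℂ → ℂ) (N : ℝ), DiffContOnCl ℂ P Ω → 0 < N →
      (∀ z ∈ frontier Ω, |(P z).re| ≤ N) → ‖P c - P z₀‖ ≤ C * N := by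
    intro c hcΩ
    -- Having increments bounded uniformly in `P` is a local, symmetric and transitive relation
    -- between points, so connectedness spreads it over `Ω`.
    refine hc.induction₂ (fun x y => ∃ C : ℝ, ∀ (P : ℂ → ℂ) (N : ℝ), DiffContOnCl ℂ P Ω → 0 < N →
      (∀ z ∈ frontier Ω, |(P z).re| ≤ N) → ‖P x - P y‖ ≤ C * N) (fun x hx => ?_) ?_ ?_ hcΩ hz₀
    · filter_upwards [nhdsWithin_le_nhds (hloc x hx)] with y hy
      refine ⟨4, fun P N hP hN h => ?_⟩
      rw [norm_sub_rev]
      exact hy P N hP hN h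
    · rintro x y z - - - ⟨C, hC⟩ ⟨D, hD⟩
      refine ⟨C + D, fun P N hP hN h => ?_⟩
      have := norm_sub_le_norm_sub_add_norm_sub (P x) (P y) (P z)
      linarith [hC P N hP hN h, hD P N hP hN h]
    · rintro x y - - ⟨C, hC⟩
      exact ⟨C, fun P N hP hN h => by rw [norm_sub_rev]; exact hC P N hP hN h⟩
  refine hK.induction_on (p := fun K => ∃ C : ℝ, ∀ (P : ℂ → ℂ) (N : ℝ), DiffContOnCl ℂ P Ω → 0 < N →
      (∀ z ∈ frontier Ω, |(P z).re| ≤ N) → ∀ z ∈ K, ‖P z - P z₀‖ ≤ C * N) ⟨0, by simp⟩ ?_ ?_ ?_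
  · rintro s t hst ⟨C, hC⟩
    exact ⟨C, fun P N hP hN h z hz => hC P N hP hN h z (hst hz)⟩
  · rintro s t ⟨C, hC⟩ ⟨D, hD⟩
    refine ⟨max C D, fun P N hP hN h z hz => ?_⟩
    rcases hz with hz | hz
    · exact (hC P N hP hN h z hz).trans (by gcongr; exact le_max_left _ _)
    · exact (hD P N hP hN h z hz).trans (by gcongr; exact le_max_right _ _)
  · intro c hcK
    obtain ⟨C, hC⟩ := hpt c (hKΩ hcK)
    refine ⟨_, nhdsWithin_le_nhds (hloc c (hKΩ hcK)), 4 + C, fun P N hP hN h z hz => ?_⟩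
    have := norm_sub_le_norm_sub_add_norm_sub (P z) (P c) (P z₀)
    linarith [hC P N hP hN h, hz P N hP hN h]

/-- On compact subsets, the holomorphic and antiholomorphic parts of a harmonic function are bounded
by the boundary values of the function if the latter part vanishes at a base point. -/
theorem exists_norm_le_of_norm_add_conj_le {Ω K : Set ℂ} (hΩ : IsOpen Ω)
    (hb : Bornology.IsBounded Ω) (hc : IsPreconnected Ω) (hK : IsCompact K) (hKΩ : K ⊆ Ω) {z₀ : ℂ}
    (hz₀ : z₀ ∈ Ω) : ∃ C : ℝ, ∀ (F G : ℂ → ℂ) (N : ℝ), DiffContOnCl ℂ F Ω → DiffContOnCl ℂ G Ω →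
      G z₀ = 0 → 0 < N → (∀ z ∈ frontier Ω, ‖F z + (starRingEnd ℂ) (G z)‖ ≤ N) →
      ∀ z ∈ K, ‖F z‖ ≤ C * N ∧ ‖G z‖ ≤ C * N := by
  obtain ⟨C, hC⟩ := exists_norm_sub_le_of_re_le hΩ hb hc (hK.insert z₀)
    (Set.insert_subset hz₀ hKΩ) hz₀
  have hCn : 0 ≤ C := by
    have := hC (fun _ => 0) 1 diffContOnCl_const one_pos (by simp) z₀ (Set.mem_insert _ _)
    simpa using this
  -- `G` is bounded by `C * N`, and `F + conj G` by `2 * N` through the maximum principle for its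
  -- real and imaginary parts.
  refine ⟨C + 2, fun F G N hF hG hG0 hN h z hz => ?_⟩
  -- `F + G` has the real part of `F + conj G`, and `i (F - G)` has minus its imaginary part as real
  -- part, so the boundary bound controls two holomorphic functions.
  have hP : DiffContOnCl ℂ (fun z => F z + G z) Ω := hF.add hG
  have hQ : DiffContOnCl ℂ (fun z => Complex.I * (F z - G z)) Ω := (hF.sub hG).const_smul Complex.I
  have hPb : ∀ z ∈ frontier Ω, |(F z + G z).re| ≤ N := fun z hz => by
    have := (Complex.abs_re_le_norm _).trans (h z hz)
    simpa using this
  have hQb : ∀ z ∈ frontier Ω, |(Complex.I * (F z - G z)).re| ≤ N := fun z hz => by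
    have := (Complex.abs_im_le_norm _).trans (h z hz)
    rw [Complex.add_im, Complex.conj_im, ← sub_eq_add_neg] at this
    rw [Complex.I_mul_re, abs_neg, Complex.sub_im]
    exact this
  have h1 := hC _ N hP hN hPb z (Set.mem_insert_of_mem _ hz)
  have h2 := hC _ N hQ hN hQb z (Set.mem_insert_of_mem _ hz)
  have hGz : ‖G z‖ ≤ C * N := by
    -- `2G = P + iQ` for these two functions; `G z₀ = 0` allows their values at the base point to be
    -- subtracted.
    have e : 2 * G z = ((F z + G z) - (F z₀ + G z₀)) +
        Complex.I * (Complex.I * (F z - G z) - Complex.I * (F z₀ - G z₀)) := by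
      linear_combination -(F z - G z - F z₀ + G z₀) * Complex.I_mul_I + 2 * hG0
    have := (norm_add_le ((F z + G z) - (F z₀ + G z₀))
      (Complex.I * (Complex.I * (F z - G z) - Complex.I * (F z₀ - G z₀))))
    rw [← e, norm_mul, norm_mul, Complex.norm_I, one_mul, Complex.norm_ofNat] at this
    linarith
  have hzc : z ∈ closure Ω := subset_closure (hKΩ hz)
  have hre : |(F z + (starRingEnd ℂ) (G z)).re| ≤ N := by
    have a := hP.re_le_of_forall_frontier hb (fun z hz => (le_abs_self _).trans (hPb z hz)) hzc
    have b := hP.neg.re_le_of_forall_frontier hb (N := N)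
      (fun z hz => by simpa using (neg_le_abs _).trans (hPb z hz)) hzc
    rw [abs_le']
    simp at a b ⊢
    constructor <;> linarith
  have him : |(F z + (starRingEnd ℂ) (G z)).im| ≤ N := by
    have a := hQ.re_le_of_forall_frontier hb (fun z hz => (le_abs_self _).trans (hQb z hz)) hzc
    have b := hQ.neg.re_le_of_forall_frontier hb (N := N)
      (fun z hz => (neg_le_abs _).trans (hQb z hz)) hzc
    rw [abs_le']
    simp at a b ⊢
    constructor <;> linarith
  have hu := Complex.norm_le_abs_re_add_abs_im (F z + (starRingEnd ℂ) (G z))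
  have hF' : ‖F z‖ ≤ ‖F z + (starRingEnd ℂ) (G z)‖ + ‖G z‖ := by
    have := norm_sub_le (F z + (starRingEnd ℂ) (G z)) ((starRingEnd ℂ) (G z))
    rwa [add_sub_cancel_right, Complex.norm_conj] at this
  constructor <;> nlinarith

/-! ### The harmonic functional calculus -/

section HarmonicCalculus

variable {H : Type*} [NormedAddCommGroup H] [InnerProductSpace ℂ H] [CompleteSpace H]
  {A : H →L[ℂ] H} {Ω : Set ℂ}

theorem IsCutoffWeight.exists_norm_analyticCalculus_le {K : Set ℂ} {a : ℂ → ℂ}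
    (ha : IsCutoffWeight (H →L[ℂ] H) Ω (spectrum ℂ A) K a) (hΩ : IsSmoothlyBounded Ω) :
    ∃ M : ℝ, 0 ≤ M ∧ ∀ (f : C(frontier Ω, ℂ)) (F : ℂ → ℂ) (N : ℝ), DiffContOnCl ℂ F Ω →
      (∀ z : frontier Ω, f z = F z) → (∀ ζ ∈ K, ‖F ζ‖ ≤ N) → ‖analyticCalculus Ω A f‖ ≤ N * M := by
  have hi : IntegrableOn (fun ζ => ‖a ζ‖ * ‖resolvent A ζ‖) K :=
    (ha.continuous.continuousOn.norm.mul ha.continuousOn_resolvent.norm).integrableOn_compact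
      ha.isCompact
  refine ⟨∫ ζ in K, ‖a ζ‖ * ‖resolvent A ζ‖, by positivity, fun f F N hF hf hN => ?_⟩
  rw [ha.analyticCalculus_eq hΩ subset_rfl hF hf, ← integral_const_mul]
  refine norm_integral_le_of_norm_le (hi.const_mul N)
    ((ae_restrict_iff' ha.isCompact.measurableSet).2 (ae_of_all _ fun ζ hζ => ?_))
  rw [norm_smul, norm_mul, mul_comm ‖a ζ‖, mul_assoc]
  gcongr
  exact hN ζ hζ

theorem IsSmoothlyBounded.isCutoffWeight_spectrum (hΩ : IsSmoothlyBounded Ω)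
    (hA : spectrum ℂ A ⊆ Ω) :
    ∃ K a, IsCutoffWeight (H →L[ℂ] H) Ω (spectrum ℂ A) K a :=
  hΩ.exists_isCutoffWeight _ (spectrum.isCompact A) hA

/-- Boundedness of the harmonic functional calculus in the uniform norm. -/
theorem IsSmoothlyBounded.exists_norm_harmonicCalculus_le (hΩ : IsSmoothlyBounded Ω)
    [CompactSpace (frontier Ω)] (hconn : IsConnected Ω) (hA : spectrum ℂ A ⊆ Ω) :
    ∃ C : ℝ, ∀ f ∈ analyticSpace Ω, ∀ g ∈ analyticSpace Ω,
      ‖analyticCalculus Ω A f + star (analyticCalculus Ω A g)‖ ≤ C * ‖f + star g‖ := by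
  obtain ⟨K, a, ha⟩ := hΩ.isCutoffWeight_spectrum hA
  obtain ⟨z₀, hz₀⟩ := hconn.nonempty
  obtain ⟨M, hM, hMb⟩ := ha.exists_norm_analyticCalculus_le hΩ
  obtain ⟨C, hC⟩ := exists_norm_le_of_norm_add_conj_le hΩ.isOpen hΩ.isBounded
    hconn.isPreconnected ha.isCompact ha.subset hz₀
  refine ⟨C * M + C * M, fun f ⟨F, hF, hf⟩ g ⟨G, hG, hg⟩ => ?_⟩
  set c := G z₀ with hc
  have hadd := analyticCalculus_add hΩ hA
  have hone := ha.analyticCalculus_one hΩ hA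
  -- Moving the constant `G z₀` from `G*` to `F` changes neither `f + g*` nor, as `γ(1) = 1`, the
  -- operator. The strict inequality keeps `N` positive when `f + g* = 0`; the limit in `N` recovers
  -- the norm.
  have key : ∀ N > ‖f + star g‖,
      ‖analyticCalculus Ω A f + star (analyticCalculus Ω A g)‖ ≤ (C * M + C * M) * N := by
    intro N hN
    have hF' : DiffContOnCl ℂ (fun z => F z + star c) Ω := hF.add diffContOnCl_const
    have hG' : DiffContOnCl ℂ (fun z => G z + -c) Ω := hG.add diffContOnCl_const
    have hfb : ∀ z ∈ frontier Ω, ‖F z + star c + (starRingEnd ℂ) (G z + -c)‖ ≤ N := by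
      intro z hz
      have h1 := ((f + star g).norm_coe_le_norm ⟨z, hz⟩).trans hN.le
      rw [ContinuousMap.add_apply, ContinuousMap.star_apply, hf, hg] at h1
      have e : F z + star c + (starRingEnd ℂ) (G z + -c) = F z + star (G z) := by
        simp only [starRingEnd_apply, star_add, star_neg]
        ring
      rwa [e]
    have hKb := hC _ _ N hF' hG' (add_neg_cancel c) ((norm_nonneg _).trans_lt hN) hfb
    have e1 := hMb (f + star c • (1 : C(frontier Ω, ℂ))) _ (C * N) hF' (fun z => by simp [hf])
      fun ζ hζ => (hKb ζ hζ).1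
    have e2 := hMb (g + (-c) • (1 : C(frontier Ω, ℂ))) _ (C * N) hG' (fun z => by simp [hg])
      fun ζ hζ => (hKb ζ hζ).2
    rw [hadd, analyticCalculus_smul, hone] at e1 e2
    have e3 : analyticCalculus Ω A f + star (analyticCalculus Ω A g) =
        (analyticCalculus Ω A f + star c • 1) + star (analyticCalculus Ω A g + (-c) • 1) := by
      rw [star_add, star_smul, star_one, star_neg, neg_smul]
      abel
    rw [e3]
    refine (norm_add_le _ _).trans ?_
    rw [norm_star]
    linarith
  have hlim : Tendsto (fun N => (C * M + C * M) * N) (𝓝[>] ‖f + star g‖)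
      (𝓝 ((C * M + C * M) * ‖f + star g‖)) :=
    (Continuous.tendsto (by fun_prop) _).mono_left nhdsWithin_le_nhds
  exact ge_of_tendsto hlim (eventually_nhdsWithin_of_forall key)

/-- The space `𝒜(Ω⁻)*` of conjugates. -/
def conjAnalyticSpace (Ω : Set ℂ) : Submodule ℂ C(frontier Ω, ℂ) where
  carrier := {h | (star h : C(frontier Ω, ℂ)) ∈ analyticSpace Ω}
  add_mem' := fun {f g} hf hg => by
    change (star (f + g) : C(frontier Ω, ℂ)) ∈ analyticSpace Ω
    rw [star_add]
    exact add_mem hf hg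
  zero_mem' := by
    change (star 0 : C(frontier Ω, ℂ)) ∈ analyticSpace Ω
    rw [star_zero]
    exact zero_mem _
  smul_mem' := fun c f hf => by
    change (star (c • f) : C(frontier Ω, ℂ)) ∈ analyticSpace Ω
    rw [star_smul]
    exact Submodule.smul_mem _ _ hf

/-- Addition as a map from `𝒜(Ω⁻) × 𝒜(Ω⁻)*` to `ℋ(Ω⁻)`. -/
noncomputable def harmonicSpaceOfProd (Ω : Set ℂ) :
    analyticSpace Ω × conjAnalyticSpace Ω →ₗ[ℂ] harmonicSpace Ω :=
  ((analyticSpace Ω).subtype.coprod (conjAnalyticSpace Ω).subtype).codRestrict _ fun p => by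
    have := add_star_mem_harmonicSpace p.1 ⟨_, p.2.2⟩
    simpa using this

theorem harmonicSpaceOfProd_apply (p : analyticSpace Ω × conjAnalyticSpace Ω) :
    (harmonicSpaceOfProd Ω p : C(frontier Ω, ℂ)) = p.1 + p.2 := rfl

theorem harmonicSpaceOfProd_star (f g : analyticSpace Ω) :
    harmonicSpaceOfProd Ω (f, ⟨star (g : C(frontier Ω, ℂ)), by
      change star (star (g : C(frontier Ω, ℂ))) ∈ analyticSpace Ω
      rw [star_star]
      exact g.2⟩) = ⟨(f : C(frontier Ω, ℂ)) + star (g : C(frontier Ω, ℂ)),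
        add_star_mem_harmonicSpace f g⟩ := rfl

theorem denseRange_harmonicSpaceOfProd : DenseRange (harmonicSpaceOfProd Ω) := by
  intro x
  rw [closure_subtype]
  refine closure_mono ?_ x.2
  rintro _ ⟨f, hf, g, hg, rfl⟩
  exact ⟨_, ⟨_, harmonicSpaceOfProd_star ⟨f, hf⟩ ⟨g, hg⟩⟩, rfl⟩

/-- The splitting `f + g*` is not unique, since constants belong to both spaces. The norm bound
gives independence of the splitting and the extension to the closure together. The second factor
consists of conjugates so that the map is complex linear on the product. -/
theorem IsSmoothlyBounded.exists_isHarmonicCalculus (hΩ : IsSmoothlyBounded Ω)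
    (hconn : IsConnected Ω) (hA : spectrum ℂ A ⊆ Ω) : ∃ G, IsHarmonicCalculus Ω A G := by
  have := hΩ.compactSpace
  obtain ⟨C, hC⟩ := hΩ.exists_norm_harmonicCalculus_le hconn hA
  let T : analyticSpace Ω × conjAnalyticSpace Ω →ₗ[ℂ] (H →L[ℂ] H) :=
    { toFun := fun p => analyticCalculus Ω A p.1 +
        star (analyticCalculus Ω A (star (p.2 : C(frontier Ω, ℂ))))
      map_add' := fun p q => by
        simp only [Prod.fst_add, Prod.snd_add, Submodule.coe_add, star_add,
          analyticCalculus_add hΩ hA]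
        abel
      map_smul' := fun c p => by
        simp only [Prod.smul_fst, Prod.smul_snd, Submodule.coe_smul, star_smul,
          analyticCalculus_smul, star_star, smul_add, RingHom.id_apply] }
  have hT : ∀ p, ‖T p‖ ≤ C * ‖harmonicSpaceOfProd Ω p‖ := fun p => by
    have := hC p.1 p.1.2 _ p.2.2
    rwa [star_star] at this
  refine ⟨T.extendOfNorm (harmonicSpaceOfProd Ω), fun f g => ?_⟩
  rw [← harmonicSpaceOfProd_star, LinearMap.extendOfNorm_eq (denseRange_harmonicSpaceOfProd (Ω := Ω)) ⟨C, hT⟩]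
  exact congrArg (fun h => analyticCalculus Ω A f + star (analyticCalculus Ω A h))
    (star_star (g : C(frontier Ω, ℂ)))

theorem IsHarmonicCalculus.unique {G G' : harmonicSpace Ω →L[ℂ] (H →L[ℂ] H)}
    (hG : IsHarmonicCalculus Ω A G) (hG' : IsHarmonicCalculus Ω A G') : G = G' := by
  refine DFunLike.coe_injective
    (denseRange_harmonicSpaceOfProd.equalizer G.continuous G'.continuous ?_)
  ext1 p
  have e : harmonicSpaceOfProd Ω p = ⟨(p.1 : C(frontier Ω, ℂ)) + star (star p.2.1),
      add_star_mem_harmonicSpace p.1 ⟨_, p.2.2⟩⟩ :=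
    Subtype.ext ((harmonicSpaceOfProd_apply p).trans (congrArg _ (star_star _).symm))
  simp only [Function.comp_apply, e]
  exact (hG p.1 ⟨_, p.2.2⟩).trans (hG' p.1 ⟨_, p.2.2⟩).symm

theorem IsSmoothlyBounded.continuous_operatorDoubleLayer (hΩ : IsSmoothlyBounded Ω)
    (hA : spectrum ℂ A ⊆ Ω) :
    Continuous fun σ : frontier Ω => operatorDoubleLayer Ω σ A := by
  have h : Continuous fun σ : frontier Ω => outwardNormal Ω σ • resolvent A (σ : ℂ) :=
    hΩ.continuous_outwardNormal.smul (hΩ.continuous_resolvent hA)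
  simp only [operatorDoubleLayer, realPart_apply_coe]
  have h2 := continuous_star.comp h
  fun_prop

theorem IsSmoothlyBounded.integrable_smul_operatorDoubleLayer (hΩ : IsSmoothlyBounded Ω)
    (hA : spectrum ℂ A ⊆ Ω) (φ : C(frontier Ω, ℂ)) :
    Integrable (fun σ : frontier Ω => φ σ • operatorDoubleLayer Ω σ A) (arcLength Ω) :=
  hΩ.integrable_of_continuous (φ.continuous.smul (hΩ.continuous_operatorDoubleLayer hA))

theorem IsSmoothlyBounded.continuous_integral_smul_operatorDoubleLayer (hΩ : IsSmoothlyBounded Ω)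
    (hA : spectrum ℂ A ⊆ Ω) : Continuous fun φ : C(frontier Ω, ℂ) =>
      ∫ σ : frontier Ω, φ σ • operatorDoubleLayer Ω σ A ∂(arcLength Ω) := by
  have := hΩ.compactSpace
  have hP := (hΩ.integrable_of_continuous (hΩ.continuous_operatorDoubleLayer hA)).norm
  refine LipschitzWith.continuous (K := Real.toNNReal
    (∫ σ : frontier Ω, ‖operatorDoubleLayer Ω σ A‖ ∂(arcLength Ω)))
    (LipschitzWith.of_dist_le_mul fun φ ψ => ?_)
  rw [dist_eq_norm, dist_eq_norm, ← integral_sub (hΩ.integrable_smul_operatorDoubleLayer hA φ)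
    (hΩ.integrable_smul_operatorDoubleLayer hA ψ), Real.coe_toNNReal _ (by positivity), mul_comm,
    ← integral_const_mul]
  refine norm_integral_le_of_norm_le (hP.const_mul _) (ae_of_all _ fun σ => ?_)
  rw [← sub_smul, norm_smul]
  gcongr
  exact (φ - ψ).norm_coe_le_norm σ

/-- Here `analyticCalculus` is merely an integral, defined for every continuous `φ`; taking adjoints
under the integral assembles the operator real part. -/
theorem IsSmoothlyBounded.analyticCalculus_add_star (hΩ : IsSmoothlyBounded Ω)
    (hA : spectrum ℂ A ⊆ Ω) (φ : C(frontier Ω, ℂ)) :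
    analyticCalculus Ω A φ + star (analyticCalculus Ω A (star φ)) =
      ∫ σ : frontier Ω, φ σ • operatorDoubleLayer Ω σ A ∂(arcLength Ω) := by
  have h1 : Integrable (fun σ : frontier Ω => (2 * Real.pi : ℂ)⁻¹ •
      ((φ σ * outwardNormal Ω σ) • resolvent A (σ : ℂ))) (arcLength Ω) :=
    (hΩ.integrable_smul_resolvent hA φ).fun_smul _
  have h2 := (hΩ.integrable_smul_resolvent hA (star φ)).smul (2 * Real.pi : ℂ)⁻¹
  have h3 : Integrable (fun σ : frontier Ω => star ((2 * Real.pi : ℂ)⁻¹ •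
      (((star φ) σ * outwardNormal Ω σ) • resolvent A (σ : ℂ)))) (arcLength Ω) :=
    (starL' ℝ : (H →L[ℂ] H) ≃L[ℝ] (H →L[ℂ] H)).integrable_comp_iff.2 h2
  have h4 : star (∫ σ : frontier Ω, (2 * Real.pi : ℂ)⁻¹ •
      (((star φ) σ * outwardNormal Ω σ) • resolvent A (σ : ℂ)) ∂(arcLength Ω)) =
      ∫ σ : frontier Ω, star ((2 * Real.pi : ℂ)⁻¹ •
      (((star φ) σ * outwardNormal Ω σ) • resolvent A (σ : ℂ))) ∂(arcLength Ω) :=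
    ((starL' ℝ : (H →L[ℂ] H) ≃L[ℝ] (H →L[ℂ] H)).integral_comp_comm _).symm
  rw [analyticCalculus_eq, analyticCalculus_eq, ← integral_smul, ← integral_smul, h4,
    ← integral_add h1 h3]
  refine integral_congr_ae (ae_of_all _ fun σ => ?_)
  simp only [operatorDoubleLayer, realPart_apply_coe, ContinuousMap.star_apply, star_smul, star_mul',
    star_inv₀, RCLike.star_def, Complex.conj_ofReal, map_ofNat, Complex.conj_conj, smul_add,
    smul_smul]
  rw [← Complex.coe_smul, ← Complex.coe_smul]
  simp only [smul_smul]
  push_cast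
  congr 2
  · rw [mul_inv]
    ring
  · rw [mul_inv]
    ring

/-- The integral representation of the harmonic calculus on double-layer potentials. -/
theorem IsHarmonicCalculus.apply_add_singularTransform (hΩ : IsSmoothlyBounded Ω)
    (hA : spectrum ℂ A ⊆ Ω) {G : harmonicSpace Ω →L[ℂ] (H →L[ℂ] H)}
    (hG : IsHarmonicCalculus Ω A G) {K : C(frontier Ω, ℂ) →L[ℂ] C(frontier Ω, ℂ)}
    (hK : ∀ φ (z : frontier Ω),
      K φ z = ∫ σ : frontier Ω, φ σ * (doubleLayer Ω σ z : ℂ) ∂(arcLength Ω))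
    {K' : C(frontier Ω, ℂ) →L[ℂ] harmonicSpace Ω}
    (hK' : ∀ φ, (K' φ : C(frontier Ω, ℂ)) = φ + K φ) (φ : C(frontier Ω, ℂ)) :
    G (K' φ) = ∫ σ : frontier Ω, φ σ • operatorDoubleLayer Ω σ A ∂(arcLength Ω) := by
  obtain ⟨S, a, ha⟩ := hΩ.isCutoffWeight_spectrum hA
  -- The Cauchy integral of `φ` has different boundary values from `φ`, yet the same resolvent
  -- integral.
  have hcauchy : ∀ {φ : C(frontier Ω, ℂ)} {F : ℂ → ℂ} (hF : DiffContOnCl ℂ F Ω),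
      Set.EqOn F (cauchyIntegral Ω φ) Ω →
      analyticCalculus Ω A hF.boundaryMap = analyticCalculus Ω A φ := by
    intro φ F hF hFe
    rw [ha.analyticCalculus_eq hΩ subset_rfl hF fun _ => rfl, analyticCalculus_eq,
      ← ha.setIntegral_cauchyIntegral_smul_resolvent hΩ hA]
    refine setIntegral_congr_fun ha.isCompact.measurableSet fun ζ hζ => ?_
    simp only [hFe (ha.subset hζ)]
  refine congrFun (hΩ.eq_of_eqOn_lipschitz (G.continuous.comp K'.continuous)
    (hΩ.continuous_integral_smul_operatorDoubleLayer hA) fun φ L hL => ?_) φ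
  obtain ⟨F, hF, hFe⟩ := hΩ.exists_cauchyIntegral_extension hL
  obtain ⟨F', hF', hFe'⟩ := hΩ.exists_cauchyIntegral_extension (IsSmoothlyBounded.lipschitzWith_star hL)
  have e : K' φ = ⟨(⟨_, hF.boundaryMap_mem⟩ : analyticSpace Ω).1 +
      star (⟨_, hF'.boundaryMap_mem⟩ : analyticSpace Ω).1, add_star_mem_harmonicSpace _ _⟩ :=
    Subtype.ext ((hK' φ).trans (hΩ.add_singularTransform_eq hK hF hF' hFe hFe'))
  rw [Function.comp_apply, e, hG, ← hΩ.analyticCalculus_add_star hA, hcauchy hF hFe, hcauchy hF' hFe']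

/-- By Cauchy's formula the potential of `f` exceeds its extension `F` by the conjugate of the
Cauchy integral of `f*`; by the jump relation this excess has boundary value `K f`. -/
theorem IsSmoothlyBounded.star_singularTransform_mem (hΩ : IsSmoothlyBounded Ω)
    {K : C(frontier Ω, ℂ) →L[ℂ] C(frontier Ω, ℂ)} (hK : ∀ φ (z : frontier Ω),
      K φ z = ∫ σ : frontier Ω, φ σ * (doubleLayer Ω σ z : ℂ) ∂(arcLength Ω))
    {f : C(frontier Ω, ℂ)} (hf : f ∈ analyticSpace Ω) : star (K f) ∈ analyticSpace Ω := by
  obtain ⟨F, hF, hfF⟩ := hf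
  obtain rfl : f = hF.boundaryMap := ContinuousMap.ext hfF
  refine mem_analyticSpace_of_tendsto hΩ.isOpen (hΩ.differentiableOn_cauchyIntegral
    (star hF.boundaryMap)) fun z => ?_
  have h := (Complex.continuous_conj.tendsto _).comp
    ((hΩ.tendsto_doubleLayerPotential hK hF.boundaryMap z).sub (hF.tendsto_frontier z.2))
  rw [hfF z, add_sub_cancel_left] at h
  refine h.congr' ?_
  filter_upwards [self_mem_nhdsWithin] with w hw
  rw [Function.comp_apply, hΩ.doubleLayerPotential_eq _ hw, hΩ.cauchyIntegral_boundaryMap hF hw,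
    add_sub_cancel_left, Complex.conj_conj]

end HarmonicCalculus

/-! ### Identification of the chosen operators with the constructed ones. -/

theorem proposition3p2 {H : Type*} [NormedAddCommGroup H] [InnerProductSpace ℂ H]
    [CompleteSpace H] (A : H →L[ℂ] H) (Ω : Set ℂ) (hΩ : IsSmoothlyBounded Ω)
    (hconn : IsConnected Ω) (hA : spectrum ℂ A ⊆ Ω) :
    -- the operators `γ̂`, `K_Ω^i` and `K_Ω` are well defined
    (∃! G, IsHarmonicCalculus Ω A G) ∧
    (∃! K, IsInteriorDoubleLayerTransform Ω K) ∧
    (∃! K, IsSingularDoubleLayerTransform Ω K) ∧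
    -- the integral representation
    (∀ φ : C(frontier Ω, ℂ),
      Integrable (fun σ : frontier Ω => φ σ • operatorDoubleLayer Ω σ A) (arcLength Ω) ∧
      harmonicCalculus Ω A (interiorDoubleLayerTransform Ω φ) =
        ∫ σ, φ σ • operatorDoubleLayer Ω σ A ∂(arcLength Ω)) ∧
    -- the action on `𝒜(Ω⁻)`
    (∀ f ∈ analyticSpace Ω,
      star (singularDoubleLayerTransform Ω f) ∈ analyticSpace Ω ∧
      harmonicCalculus Ω A (interiorDoubleLayerTransform Ω f) =
        star (analyticCalculus Ω A (star (singularDoubleLayerTransform Ω f))) +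
          analyticCalculus Ω A f) := by
  obtain ⟨K, hK⟩ := hΩ.exists_singularTransform
  obtain ⟨K', hK', hK'e⟩ := hΩ.exists_interiorTransform hK
  have hKs := hΩ.isSingularDoubleLayerTransform hK
  have hcalc := hΩ.exists_isHarmonicCalculus hconn hA
  have hG : IsHarmonicCalculus Ω A (harmonicCalculus Ω A) := Classical.epsilon_spec hcalc
  have eK : singularDoubleLayerTransform Ω = K :=
    hΩ.singularDoubleLayerTransform_unique (Classical.epsilon_spec ⟨K, hKs⟩) hKs
  have eK' : interiorDoubleLayerTransform Ω = K' :=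
    hΩ.interiorDoubleLayerTransform_unique (Classical.epsilon_spec ⟨K', hK'⟩) hK'
  rw [eK, eK']
  refine ⟨⟨_, hG, fun _ h => h.unique hG⟩,
    ⟨K', hK', fun _ h => hΩ.interiorDoubleLayerTransform_unique h hK'⟩,
    ⟨K, hKs, fun _ h => hΩ.singularDoubleLayerTransform_unique h hKs⟩,
    fun φ => ⟨hΩ.integrable_smul_operatorDoubleLayer hA φ,
      hG.apply_add_singularTransform hΩ hA hK hK'e φ⟩, fun f hf => ?_⟩
  have hmem := hΩ.star_singularTransform_mem hK hf
  refine ⟨hmem, ?_⟩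
  -- The jump relation `f + K f` is already of the form `f + g*` with `g = (K f)*` in `𝒜(Ω⁻)`, so
  -- the defining property of the calculus applies directly.
  have e : K' f = ⟨(⟨f, hf⟩ : analyticSpace Ω).1 + star (⟨_, hmem⟩ : analyticSpace Ω).1,
      add_star_mem_harmonicSpace _ _⟩ :=
    Subtype.ext ((hK'e f).trans (congrArg _ (star_star (K f)).symm))
  rw [e, hG, add_comm]
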